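/- Let $\Bbbk$ be a field, $G$ a group, and $H=(\{H_\alpha\}_{\alpha\in G},\Delta,\varepsilon,S)$ a Hopf $G$-coalgebra over $\Bbbk$: each $H_\alpha$ is a $\Bbbk$-algebra, $\Delta_{\alpha,\beta}:H_{\alpha\beta}\to H_\alpha\otimes H_\beta$ and $\varepsilon:H_1\to\Bbbk$ are algebra homomorphisms which are coassociative and counital, and $S_\alpha:H_\alpha\to H_{\alpha^{-1}}$ are linear maps with $m_\alpha(S_{\alpha^{-1}}\otimes\mathrm{Id})\Delta_{\alpha^{-1},\alpha}=\varepsilon 1_\alpha=m_\alpha(\mathrm{Id}\otimes S_{\alpha^{-1}})\Delta_{\alpha,\alpha^{-1}}$. Assume that $H$ is of finite type (every $H_\alpha$ is finite dimensional) and unimodular (the left and right cointegrals of the Hopf algebra $H_1$ coincide), and let $g=(g_\alpha)_{\alpha\in G}$, $g_\alpha\in H_\alpha$, be a pivot: $\Delta_{\alpha,\beta}(g_{\alpha\beta})=g_\alpha\otimes g_\beta$, $\varepsilon(g_1)=1$ and $S_{\alpha^{-1}}S_\alpha(x)=g_\alpha xg_\alpha^{-1}$ for $x\in H_\alpha$,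 where $g_\alpha^{-1}=S_{\alpha^{-1}}(g_{\alpha^{-1}})$. A family $\mu=(\mu_\alpha)\in\prod_\alpha H_\alpha^*$ is a right (resp. left) $G$-integral if $(\mu_\alpha\otimes\mathrm{Id})\Delta_{\alpha,\beta}(x)=\mu_{\alpha\beta}(x)1_\beta$ (resp. $(\mathrm{Id}\otimes\mu_\beta)\Delta_{\alpha,\beta}(x)=\mu_{\alpha\beta}(x)1_\alpha$) for all $\alpha,\beta\in G$ and $x\in H_{\alpha\beta}$; the associated symmetrised right (resp. left) $G$-integral is the family $x\mapsto\mu_\alpha(g_\alpha x)$ (resp. $x\mapsto\mu_\alpha(g_\alpha^{-1}x)$). The pair $(H,g)$ is $G$-unibalanced if its symmetrised right $G$-integrals are also symmetrised left $G$-integrals. Let $H\text{-mod}=\bigoplus_{\alpha\in G}H_\alpha\text{-mod}$ be the category of finite direct sums of finite dimensional $H_\alpha$-modules, with tensor product $V_\alpha\otimes W_\beta\in H_{\alpha\beta}\text{-mod}$ given by $\Delta_{\alpha,\beta}$, and let $H\text{-pmod}$ be the full subcategory of its projective objects. For $V\in H_\alpha\text{-mod}$ with basis $(v_j)$ and dual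 basis $(v^j)$, put $\overrightarrow{\mathrm{ev}}_V(f\otimes v)=f(v)$, $\overrightarrow{\mathrm{coev}}_V(1)=\sum_j v_j\otimes v^j$, $\overleftarrow{\mathrm{ev}}_V(v\otimes f)=f(g_\alpha v)$, $\overleftarrow{\mathrm{coev}}_V(1)=\sum_j v^j\otimes g_\alpha^{-1}v_j$ (extended to direct sums). The right partial trace of $f:U\otimes W\to V\otimes W$ is $\mathrm{tr}^r_W(f)=(\mathrm{Id}_V\otimes\overleftarrow{\mathrm{ev}}_W)(f\otimes\mathrm{Id}_{W^*})(\mathrm{Id}_U\otimes\overrightarrow{\mathrm{coev}}_W)$, and the left partial trace of $f:W\otimes U\to W\otimes V$ is $\mathrm{tr}^l_W(f)=(\overrightarrow{\mathrm{ev}}_W\otimes\mathrm{Id}_V)(\mathrm{Id}_{W^*}\otimes f)(\overleftarrow{\mathrm{coev}}_W\otimes\mathrm{Id}_U)$. A right (resp. left) modified trace on $H\text{-pmod}$ is a family of linear forms $t_P:\mathrm{End}(P)\to\Bbbk$, $P\in H\text{-pmod}$, with $t_V(ff')=t_U(f'f)$ for all $f:U\to V$ and $f':V\to U$ in $H\text{-pmod}$,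 and $t_{P\otimes W}(f)=t_P(\mathrm{tr}^r_W(f))$ for all $P\in H\text{-pmod}$, $W\in H\text{-mod}$, $f\in\mathrm{End}(P\otimes W)$ (resp. $t_{W\otimes P}(f)=t_P(\mathrm{tr}^l_W(f))$ for all $f\in\mathrm{End}(W\otimes P)$). For such a family $t$ put $\lambda^t_\alpha(h)=t_{H_\alpha}(R_h)$ for $h\in H_\alpha$, where $R_h$ is the right multiplication by $h$ on the left regular module $H_\alpha$. Theorem. The map $t\mapsto\lambda^t=(\lambda^t_\alpha)_{\alpha\in G}$ is a bijection from the space of right modified traces on $H\text{-pmod}$ onto the space of symmetrised right $G$-integrals, and a bijection from the space of left modified traces on $H\text{-pmod}$ onto the space of symmetrised left $G$-integrals. Moreover, $(H,g)$ is $G$-unibalanced if and only if every right modified trace on $H\text{-pmod}$ is also a left modified trace. -/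

import Mathlib

set_option linter.unusedSectionVars false
set_option linter.unusedSimpArgs false

universe u

open scoped TensorProduct DirectSum

noncomputable section

/-- A Hopf `G`-coalgebra structure over the field `k` on a family of `k`-algebras `(H α)`, `α ∈ G`.
To avoid transports along equations in `G`, the coproduct `Δ_{α,β} : H_{αβ} → H_α ⊗ H_β` is indexed
by `α β γ` with a proof of `α * β = γ` (so `H γ` is `H_{αβ}`), and the antipode
`S_α : H_α → H_{α⁻¹}` by `α β` with a proof of `α * β = 1` (so `H β` is `H_{α⁻¹}`). -/
class HopfGCoalgebra (k : Type u) {G : Type u} [Field k] [Group G] (H : G → Type u)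
    [∀ α, Ring (H α)] [∀ α, Algebra k (H α)] where
  /-- the coproduct, a family of algebra homomorphisms -/
  comul {α β γ : G} (h : α * β = γ) : H γ →ₐ[k] H α ⊗[k] H β
  /-- the counit, an algebra homomorphism -/
  counit : H 1 →ₐ[k] k
  /-- the antipode, a family of linear maps -/
  antipode {α β : G} (h : α * β = 1) : H α →ₗ[k] H β
  coassoc {α β γ αβ βγ δ : G} (h₁ : α * β = αβ) (h₂ : αβ * γ = δ) (h₃ : β * γ = βγ)
    (h₄ : α * βγ = δ) (x : H δ) :
    TensorProduct.assoc k (H α) (H β) (H γ)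
        ((comul h₁).toLinearMap.rTensor (H γ) (comul h₂ x)) =
      (comul h₃).toLinearMap.lTensor (H α) (comul h₄ x)
  counit_left (α : G) (x : H α) :
    TensorProduct.lid k (H α) (counit.toLinearMap.rTensor (H α) (comul (one_mul α) x)) = x
  counit_right (α : G) (x : H α) :
    TensorProduct.rid k (H α) (counit.toLinearMap.lTensor (H α) (comul (mul_one α) x)) = x
  antipode_left {α β : G} (h : β * α = 1) (x : H 1) :
    LinearMap.mul' k (H α) ((antipode h).rTensor (H α) (comul h x)) = counit x • (1 : H α)
  antipode_right {α β : G} (h : α * β = 1) (h' : β * α = 1) (x : H 1) :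
    LinearMap.mul' k (H α) ((antipode h').lTensor (H α) (comul h x)) = counit x • (1 : H α)

namespace HopfGCoalgebra

section

variable (k : Type u) {G : Type u} [Field k] [Group G] (H : G → Type u)
  [∀ α, Ring (H α)] [∀ α, Algebra k (H α)] [HopfGCoalgebra k H]

/-- A pivot: a `G`-grouplike element `g = (g_α)` with `S_{α⁻¹} S_α (x) = g_α x g_α⁻¹`, where
`g_α⁻¹ = S_{α⁻¹}(g_{α⁻¹})` (see `Pivot.mul_inv` and `Pivot.inv_mul`). -/
structure Pivot where
  val (α : G) : H α
  comul_val {α β γ : G} (h : α * β = γ) : comul (k := k) h (val γ) = val α ⊗ₜ[k] val β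
  counit_val : counit (k := k) (val 1) = 1
  antipode_antipode {α β : G} (h : α * β = 1) (h' : β * α = 1) (x : H α) :
    antipode (k := k) h' (antipode (k := k) h x) = val α * x * antipode (k := k) h' (val β)

variable {k H}

/-- The inverse `g_α⁻¹ = S_{α⁻¹}(g_{α⁻¹})` of the component `g_α` of a pivot. -/
def Pivot.inv (g : Pivot k H) (α : G) : H α :=
  antipode (k := k) (inv_mul_cancel α) (g.val α⁻¹)

theorem Pivot.antipode_val (g : Pivot k H) {α β : G} (h : β * α = 1) :
    antipode (k := k) h (g.val β) = g.inv α := by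
  obtain rfl := eq_inv_of_mul_eq_one_left h
  rfl

theorem Pivot.mul_inv (g : Pivot k H) (α : G) : g.val α * g.inv α = 1 := by
  have := antipode_right (k := k) (H := H) (mul_inv_cancel α) (inv_mul_cancel α) (g.val 1)
  simpa [g.comul_val, g.counit_val, Pivot.inv] using this

theorem Pivot.inv_mul (g : Pivot k H) (α : G) : g.inv α * g.val α = 1 := by
  have := antipode_left (k := k) (H := H) (inv_mul_cancel α) (g.val 1)
  simpa [g.comul_val, g.counit_val, Pivot.inv] using this

variable (k H) in
/-- `H` is unimodular: the left and the right cointegrals of the Hopf algebra `H_1` coincide. -/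
def IsUnimodular : Prop :=
  ∀ c : H 1, (∀ x : H 1, x * c = counit (k := k) x • c) ↔
    (∀ x : H 1, c * x = counit (k := k) x • c)

/-- Right `G`-integrals: `(μ_α ⊗ id) Δ_{α,β}(x) = μ_{αβ}(x) 1_β`. -/
def IsRightIntegral (μ : ∀ α, H α →ₗ[k] k) : Prop :=
  ∀ {α β γ : G} (h : α * β = γ) (x : H γ),
    TensorProduct.lid k (H β) ((μ α).rTensor (H β) (comul h x)) = μ γ x • (1 : H β)

/-- Left `G`-integrals: `(id ⊗ μ_β) Δ_{α,β}(x) = μ_{αβ}(x) 1_α`. -/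
def IsLeftIntegral (μ : ∀ α, H α →ₗ[k] k) : Prop :=
  ∀ {α β γ : G} (h : α * β = γ) (x : H γ),
    TensorProduct.rid k (H α) ((μ β).lTensor (H α) (comul h x)) = μ γ x • (1 : H α)

/-- Symmetrised right `G`-integrals: `x ↦ μ_α(g_α x)` for a right `G`-integral `μ`. -/
def IsSymmetrisedRightIntegral (g : Pivot k H) (l : ∀ α, H α →ₗ[k] k) : Prop :=
  ∃ μ : ∀ α, H α →ₗ[k] k, IsRightIntegral μ ∧ ∀ α x, l α x = μ α (g.val α * x)

/-- Symmetrised left `G`-integrals: `x ↦ μ_α(g_α⁻¹ x)` for a left `G`-integral `μ`. -/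
def IsSymmetrisedLeftIntegral (g : Pivot k H) (l : ∀ α, H α →ₗ[k] k) : Prop :=
  ∃ μ : ∀ α, H α →ₗ[k] k, IsLeftIntegral μ ∧ ∀ α x, l α x = μ α (g.inv α * x)

/-- `(H, g)` is `G`-unibalanced: its symmetrised right `G`-integrals are also left. -/
def IsUnibalanced (g : Pivot k H) : Prop :=
  ∀ l : ∀ α, H α →ₗ[k] k, IsSymmetrisedRightIntegral g l → IsSymmetrisedLeftIntegral g l

/-! ### Sweedler-type identities -/

/-- Collapsing two neighbouring legs on the right of an iterated coproduct. -/
theorem collapse_right {M : Type u} [AddCommGroup M] [Module k M] {α β β' γ : G}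
    (h : α * β = γ) (h' : γ * β' = α) (hβ : β * β' = 1)
    (Θ : H α ⊗[k] (H β ⊗[k] H β') →ₗ[k] M) (Θ₀ : H α →ₗ[k] M)
    (hΘ : ∀ (a : H α) (x : H 1), Θ (a ⊗ₜ comul (k := k) hβ x) = counit (k := k) x • Θ₀ a) (x : H α) :
    Θ (TensorProduct.assoc k _ _ _
      ((comul h).toLinearMap.rTensor (H β') (comul h' x))) = Θ₀ x := by
  rw [coassoc h h' hβ (mul_one α)]
  conv_rhs => rw [← counit_right (k := k) α x]
  generalize comul (k := k) (mul_one α) x = z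
  induction z with
  | zero =>
    simp only [map_zero, TensorProduct.zero_tmul, TensorProduct.tmul_zero, zero_mul, mul_zero,
      LinearMap.zero_apply]
  | tmul a b => simpa using hΘ a b
  | add y z hy hz => simp only [map_add, hy, hz]

/-- Collapsing two neighbouring legs on the left of an iterated coproduct. -/
theorem collapse_left {M : Type u} [AddCommGroup M] [Module k M] {α β β' γ : G}
    (h : β * α = γ) (h' : β' * γ = α) (hβ : β' * β = 1)
    (Θ : H β' ⊗[k] (H β ⊗[k] H α) →ₗ[k] M) (Θ₀ : H α →ₗ[k] M)
    (hΘ : ∀ (x : H 1) (a : H α), Θ (TensorProduct.assoc k _ _ _ (comul (k := k) hβ x ⊗ₜ a)) =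
      counit (k := k) x • Θ₀ a) (x : H α) :
    Θ ((comul h).toLinearMap.lTensor (H β') (comul h' x)) = Θ₀ x := by
  rw [← coassoc hβ (one_mul α) h h']
  conv_rhs => rw [← counit_left (k := k) α x]
  generalize comul (k := k) (one_mul α) x = z
  induction z with
  | zero =>
    simp only [map_zero, TensorProduct.zero_tmul, TensorProduct.tmul_zero, zero_mul, mul_zero,
      LinearMap.zero_apply]
  | tmul a b => simpa using hΘ a b
  | add y z hy hz => simp only [map_add, hy, hz]

theorem antipode_one {α β : G} (h : β * α = 1) : antipode (k := k) h (1 : H β) = (1 : H α) := by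
  have := antipode_left (k := k) (H := H) h 1
  simpa [map_one, Algebra.TensorProduct.one_def] using this


theorem antipode_mul {α β : G} (h : β * α = 1) (h' : α * β = 1) (x y : H β) :
    antipode (k := k) h (x * y) = antipode (k := k) h y * antipode (k := k) h x := by
  set S : H β →ₗ[k] H α := antipode (k := k) h with hS
  let N : H β ⊗[k] H α →ₗ[k] H α := LinearMap.mul' k (H α) ∘ₗ S.rTensor (H α)
  let Θ : ((H β ⊗[k] H α) ⊗[k] H β) ⊗[k] ((H β ⊗[k] H α) ⊗[k] H β) →ₗ[k] H α :=
    LinearMap.mul' k (H α) ∘ₗ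
      TensorProduct.map (N ∘ₗ LinearMap.mul' k (H β ⊗[k] H α))
        (LinearMap.mul' k (H α) ∘ₗ (TensorProduct.comm k _ _).toLinearMap ∘ₗ
          TensorProduct.map S S) ∘ₗ
      (TensorProduct.tensorTensorTensorComm k _ _ _ _).toLinearMap
  have hΘ (p q : H β ⊗[k] H α) (c d : H β) :
      Θ ((p ⊗ₜ c) ⊗ₜ (q ⊗ₜ d)) = N (p * q) * (S d * S c) := by simp [Θ]
  have hN (x : H 1) : N (comul (k := k) h x) = counit (k := k) x • (1 : H α) :=
    antipode_left h x
  let X (x : H β) : (H β ⊗[k] H α) ⊗[k] H β :=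
    (comul (k := k) h).toLinearMap.rTensor (H β) (comul (k := k) (one_mul β) x)
  let e := TensorProduct.assoc k (H β) (H α) (H β)
  -- collapsing the left pairs
  have key₁ : Θ (X x ⊗ₜ X y) = S y * S x := by
    conv_rhs => rw [← counit_left (k := k) β x, ← counit_left (k := k) β y]
    simp only [X]
    generalize comul (k := k) (one_mul β) x = z
    generalize comul (k := k) (one_mul β) y = w
    induction z with
    | zero =>
      simp only [map_zero, TensorProduct.zero_tmul, TensorProduct.tmul_zero, zero_mul, mul_zero,
        LinearMap.zero_apply]
    | add z z' hz hz' =>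
      simp only [map_add, TensorProduct.add_tmul, mul_add, hz, hz']
    | tmul a b =>
      induction w with
      | zero =>
        simp only [map_zero, TensorProduct.zero_tmul, TensorProduct.tmul_zero, zero_mul, mul_zero,
          LinearMap.zero_apply]
      | add z z' hz hz' =>
        simp only [map_add, TensorProduct.tmul_add, add_mul, hz, hz']
      | tmul c d =>
        simp only [LinearMap.rTensor_tmul, AlgHom.toLinearMap_apply, hΘ, ← map_mul, hN]
        simp [smul_smul]
  -- collapsing the right pairs
  have key₂ : Θ (X x ⊗ₜ X y) = S (x * y) := by
    have h1 : ∀ (a : H β) (c : H α) (c' : H β), Θ (e.symm (a ⊗ₜ (c ⊗ₜ c')) ⊗ₜ X y) =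
        S (a * y) * c * S c' := by
      intro a c c'
      have := collapse_right (k := k) h (one_mul β) h'
        (Θ ∘ₗ TensorProduct.mk k _ _ (e.symm (a ⊗ₜ (c ⊗ₜ c'))) ∘ₗ e.symm.toLinearMap)
        (LinearMap.mulRight k (c * S c') ∘ₗ S ∘ₗ LinearMap.mulLeft k a) ?_ y
      · simpa [e, X, mul_assoc] using this
      · intro b d
        have hd := antipode_right (k := k) (H := H) h' h d
        rw [← hS] at hd
        simp only [LinearMap.comp_apply, LinearEquiv.coe_coe, TensorProduct.mk_apply,
          LinearMap.mulRight_apply, LinearMap.mulLeft_apply]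
        have : ∀ w : H α ⊗[k] H β, Θ (e.symm (a ⊗ₜ (c ⊗ₜ c')) ⊗ₜ e.symm (b ⊗ₜ w)) =
            S (a * b) * c * LinearMap.mul' k (H α) (S.lTensor (H α) w) * S c' := by
          intro w
          induction w with
          | zero =>
            simp only [map_zero, TensorProduct.zero_tmul, TensorProduct.tmul_zero, zero_mul, mul_zero,
              LinearMap.zero_apply]
          | add w w' hw hw' =>
            simp only [map_add, TensorProduct.tmul_add, mul_add, add_mul, hw, hw']
          | tmul d d' => simp [e, hΘ, N, mul_assoc]
        rw [this, hd]
        simp [mul_assoc]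
    have := collapse_right (k := k) h (one_mul β) h'
      (Θ ∘ₗ (TensorProduct.mk k _ _).flip (X y) ∘ₗ e.symm.toLinearMap)
      (S ∘ₗ LinearMap.mulRight k y) ?_ x
    · simpa [e, X] using this
    · intro a c
      have hd := antipode_right (k := k) (H := H) h' h c
      rw [← hS] at hd
      have : ∀ w : H α ⊗[k] H β, Θ (e.symm (a ⊗ₜ w) ⊗ₜ X y) =
          S (a * y) * LinearMap.mul' k (H α) (S.lTensor (H α) w) := by
        intro w
        induction w with
        | zero =>
          simp only [map_zero, TensorProduct.zero_tmul, TensorProduct.tmul_zero, zero_mul, mul_zero,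
            LinearMap.zero_apply]
        | add w w' hw hw' =>
          simp only [map_add, TensorProduct.tmul_add, TensorProduct.add_tmul, mul_add, hw, hw']
        | tmul d d' => simp [h1, mul_assoc]
      simp [this, hd]
  rw [← key₁, key₂]

theorem Pivot.antipode_antipode_mul_val (g : Pivot k H) {α β : G} (h : α * β = 1)
    (h' : β * α = 1) (x : H α) :
    antipode (k := k) h' (antipode (k := k) h x) * g.val α = g.val α * x := by
  rw [g.antipode_antipode, g.antipode_val h', mul_assoc, g.inv_mul, mul_one]

theorem Pivot.antipode_inv (g : Pivot k H) {α β : G} (h : α * β = 1) (h' : β * α = 1) :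
    antipode (k := k) h (g.inv α) = g.val β := by
  rw [← g.antipode_val h', g.antipode_antipode h' h, g.antipode_val h, mul_assoc, g.mul_inv,
    mul_one]

theorem Pivot.antipode_injective (g : Pivot k H) {α β : G} (h : α * β = 1) (h' : β * α = 1) :
    Function.Injective (antipode (k := k) (H := H) h) := by
  intro x y hxy
  have hx := g.antipode_antipode_mul_val h h' x
  rw [hxy, g.antipode_antipode_mul_val h h' y] at hx
  calc x = g.inv α * (g.val α * x) := by rw [← mul_assoc, g.inv_mul, one_mul]
    _ = y := by rw [← hx, ← mul_assoc, g.inv_mul, one_mul]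

/-- `S(x₂) g x₁ = ε(x) g` -/
theorem Pivot.antipode_val_mul (g : Pivot k H) {α β : G} (h : α * β = 1) (h' : β * α = 1)
    (x : H 1) :
    LinearMap.mul' k (H α) (TensorProduct.map (antipode (k := k) h')
      (LinearMap.mulLeft k (g.val α)) (TensorProduct.comm k _ _ (comul (k := k) h x))) =
      counit (k := k) x • g.val α := by
  have hx := congrArg (fun z => antipode (k := k) h' z * g.val α) (antipode_left (k := k) h x)
  simp only [map_smul, antipode_one, smul_mul_assoc, one_mul] at hx
  rw [← hx]
  generalize comul (k := k) h x = w
  induction w with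
  | zero =>
    simp only [map_zero, TensorProduct.zero_tmul, TensorProduct.tmul_zero, zero_mul, mul_zero,
      LinearMap.zero_apply]
  | add w w' hw hw' => simp only [map_add, add_mul, hw, hw']
  | tmul a b =>
    simp [antipode_mul (k := k) h' h, mul_assoc, g.antipode_antipode_mul_val h h']

/-- `x₂ g⁻¹ S(x₁) = ε(x) g⁻¹` -/
theorem Pivot.mul_inv_antipode (g : Pivot k H) {α β : G} (h : β * α = 1) (h' : α * β = 1)
    (x : H 1) :
    LinearMap.mul' k (H α) (TensorProduct.map LinearMap.id
      (LinearMap.mulLeft k (g.inv α) ∘ₗ antipode (k := k) h)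
        (TensorProduct.comm k _ _ (comul (k := k) h x))) =
      counit (k := k) x • g.inv α := by
  apply g.antipode_injective h' h
  have hx := congrArg (fun z => g.val β * z) (antipode_right (k := k) h h' x)
  simp only [mul_smul_comm, mul_one] at hx
  rw [map_smul, g.antipode_inv h' h, ← hx]
  generalize comul (k := k) h x = w
  induction w with
  | zero =>
    simp only [map_zero, TensorProduct.zero_tmul, TensorProduct.tmul_zero, zero_mul, mul_zero,
      LinearMap.zero_apply]
  | add w w' hw hw' => simp only [map_add, mul_add, hw, hw']
  | tmul a b =>
    simp only [TensorProduct.comm_tmul, TensorProduct.map_tmul, LinearMap.id_coe, id_eq,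
      LinearMap.comp_apply, LinearMap.mulLeft_apply, LinearMap.mul'_apply,
      antipode_mul (k := k) h' h, g.antipode_inv h' h, LinearMap.lTensor_tmul]
    rw [g.antipode_antipode_mul_val h h']
    simp [mul_assoc]


/-- `Δ(x₁) (1 ⊗ S(x₂)) = x ⊗ 1` -/
theorem comul_mul_antipode {α β β' γ : G} (h : α * β = γ) (h' : γ * β' = α) (hβ : β * β' = 1)
    (hβ' : β' * β = 1) (x : H α) :
    LinearMap.mul' k (H α ⊗[k] H β) (TensorProduct.map (comul (k := k) h).toLinearMap
      (TensorProduct.mk k (H α) (H β) 1 ∘ₗ antipode (k := k) hβ') (comul (k := k) h' x)) =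
      x ⊗ₜ 1 := by
  refine Eq.trans ?_ (collapse_right h h' hβ
    ((LinearMap.mul' k (H β) ∘ₗ (antipode (k := k) hβ').lTensor (H β)).lTensor (H α))
    ((TensorProduct.mk k (H α) (H β)).flip 1) ?_ x)
  · generalize comul (k := k) h' x = w
    induction w with
    | zero =>
      simp only [map_zero, TensorProduct.zero_tmul, TensorProduct.tmul_zero, zero_mul, mul_zero,
        LinearMap.zero_apply]
    | add w w' hw hw' => simp only [map_add, hw, hw']
    | tmul a b =>
      simp only [TensorProduct.map_tmul, AlgHom.toLinearMap_apply, LinearMap.mul'_apply,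
        LinearMap.rTensor_tmul, LinearMap.comp_apply, TensorProduct.mk_apply]
      generalize comul (k := k) h a = v
      induction v with
      | zero =>
        simp only [map_zero, TensorProduct.zero_tmul, TensorProduct.tmul_zero, zero_mul, mul_zero,
          LinearMap.zero_apply]
      | add w w' hw hw' => simp only [map_add, add_mul, TensorProduct.add_tmul, hw, hw']
      | tmul c d => simp
  · intro a y
    simp [antipode_right (k := k) hβ hβ' y]

/-- `(1 ⊗ S(x₂) g) Δ(x₁) = x ⊗ g` -/
theorem Pivot.antipode_val_mul_comul (g : Pivot k H) {α β β' γ : G} (h : α * β = γ)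
    (h' : γ * β' = α) (hβ : β * β' = 1) (hβ' : β' * β = 1) (x : H α) :
    LinearMap.mul' k (H α ⊗[k] H β) (TensorProduct.comm k _ _ (TensorProduct.map
      (comul (k := k) h).toLinearMap (TensorProduct.mk k (H α) (H β) 1 ∘ₗ
        LinearMap.mulRight k (g.val β) ∘ₗ antipode (k := k) hβ') (comul (k := k) h' x))) =
      x ⊗ₜ g.val β := by
  refine Eq.trans ?_ (collapse_right h h' hβ
    ((LinearMap.mul' k (H β) ∘ₗ TensorProduct.map (antipode (k := k) hβ')
      (LinearMap.mulLeft k (g.val β)) ∘ₗ (TensorProduct.comm k _ _).toLinearMap).lTensor (H α))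
    ((TensorProduct.mk k (H α) (H β)).flip (g.val β)) ?_ x)
  · generalize comul (k := k) h' x = w
    induction w with
    | zero =>
      simp only [map_zero, TensorProduct.zero_tmul, TensorProduct.tmul_zero, zero_mul, mul_zero,
        LinearMap.zero_apply]
    | add w w' hw hw' => simp only [map_add, hw, hw']
    | tmul a b =>
      simp only [TensorProduct.map_tmul, AlgHom.toLinearMap_apply, LinearMap.mul'_apply,
        LinearMap.rTensor_tmul, LinearMap.comp_apply, TensorProduct.mk_apply,
        TensorProduct.comm_tmul]
      generalize comul (k := k) h a = v
      induction v with
      | zero =>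
        simp only [map_zero, TensorProduct.zero_tmul, TensorProduct.tmul_zero, zero_mul, mul_zero,
          LinearMap.zero_apply]
      | add w w' hw hw' => simp only [map_add, mul_add, TensorProduct.add_tmul, hw, hw']
      | tmul c d => simp [mul_assoc]
  · intro a y
    simp [g.antipode_val_mul hβ hβ' y]

/-- `Δ(x₂) (g⁻¹ S(x₁) ⊗ 1) = g⁻¹ ⊗ x` -/
theorem Pivot.comul_mul_inv_antipode (g : Pivot k H) {α β β' γ : G} (h : β * α = γ)
    (h' : β' * γ = α) (hβ : β' * β = 1) (hβ' : β * β' = 1) (x : H α) :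
    LinearMap.mul' k (H β ⊗[k] H α) (TensorProduct.comm k _ _ (TensorProduct.map
      ((TensorProduct.mk k (H β) (H α)).flip 1 ∘ₗ LinearMap.mulLeft k (g.inv β) ∘ₗ
        antipode (k := k) hβ) (comul (k := k) h).toLinearMap (comul (k := k) h' x))) =
      g.inv β ⊗ₜ x := by
  refine Eq.trans ?_ (collapse_left h h' hβ
    (((LinearMap.mul' k (H β) ∘ₗ TensorProduct.map LinearMap.id
      (LinearMap.mulLeft k (g.inv β) ∘ₗ antipode (k := k) hβ) ∘ₗ
      (TensorProduct.comm k _ _).toLinearMap).rTensor (H α)) ∘ₗ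
      (TensorProduct.assoc k _ _ _).symm.toLinearMap)
    (TensorProduct.mk k (H β) (H α) (g.inv β)) ?_ x)
  · generalize comul (k := k) h' x = w
    induction w with
    | zero =>
      simp only [map_zero, TensorProduct.zero_tmul, TensorProduct.tmul_zero, zero_mul, mul_zero,
        LinearMap.zero_apply]
    | add w w' hw hw' => simp only [map_add, hw, hw']
    | tmul a b =>
      simp only [TensorProduct.map_tmul, AlgHom.toLinearMap_apply, LinearMap.mul'_apply,
        LinearMap.lTensor_tmul, LinearMap.comp_apply,
        TensorProduct.comm_tmul]
      generalize comul (k := k) h b = v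
      induction v with
      | zero =>
        simp only [map_zero, TensorProduct.zero_tmul, TensorProduct.tmul_zero, zero_mul, mul_zero,
          LinearMap.zero_apply]
      | add w w' hw hw' => simp only [map_add, add_mul, TensorProduct.tmul_add, hw, hw']
      | tmul c d => simp
  · intro y a
    have := g.mul_inv_antipode hβ hβ' y
    simp only [LinearMap.comp_apply, LinearEquiv.coe_coe, LinearEquiv.symm_apply_apply,
      LinearMap.rTensor_tmul, this]
    simp [TensorProduct.smul_tmul']

/-- `(g⁻¹ S(x₁) ⊗ 1) Δ(x₂) = g⁻¹ ⊗ x` -/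
theorem Pivot.inv_antipode_mul_comul (g : Pivot k H) {α β β' γ : G} (h : β * α = γ)
    (h' : β' * γ = α) (hβ : β' * β = 1) (x : H α) :
    LinearMap.mul' k (H β ⊗[k] H α) (TensorProduct.map
      ((TensorProduct.mk k (H β) (H α)).flip 1 ∘ₗ LinearMap.mulLeft k (g.inv β) ∘ₗ
        antipode (k := k) hβ) (comul (k := k) h).toLinearMap (comul (k := k) h' x)) =
      g.inv β ⊗ₜ x := by
  refine Eq.trans ?_ (collapse_left h h' hβ
    (((LinearMap.mulLeft k (g.inv β) ∘ₗ LinearMap.mul' k (H β) ∘ₗ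
      (antipode (k := k) hβ).rTensor (H β)).rTensor (H α)) ∘ₗ
      (TensorProduct.assoc k _ _ _).symm.toLinearMap)
    (TensorProduct.mk k (H β) (H α) (g.inv β)) ?_ x)
  · generalize comul (k := k) h' x = w
    induction w with
    | zero =>
      simp only [map_zero, TensorProduct.zero_tmul, TensorProduct.tmul_zero, zero_mul, mul_zero,
        LinearMap.zero_apply]
    | add w w' hw hw' => simp only [map_add, hw, hw']
    | tmul a b =>
      simp only [TensorProduct.map_tmul, AlgHom.toLinearMap_apply, LinearMap.mul'_apply,
        LinearMap.lTensor_tmul, LinearMap.comp_apply]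
      generalize comul (k := k) h b = v
      induction v with
      | zero =>
        simp only [map_zero, TensorProduct.zero_tmul, TensorProduct.tmul_zero, zero_mul, mul_zero,
          LinearMap.zero_apply]
      | add w w' hw hw' => simp only [map_add, mul_add, TensorProduct.tmul_add, hw, hw']
      | tmul c d => simp [mul_assoc]
  · intro y a
    have := antipode_left (k := k) hβ y
    simp only [LinearMap.comp_apply, LinearEquiv.coe_coe, LinearEquiv.symm_apply_apply,
      LinearMap.rTensor_tmul, this]
    simp [TensorProduct.smul_tmul']

/-- `((id ⊗ S) (Δ(x₁) w)) (1 ⊗ x₂) = (x ⊗ 1) (id ⊗ S) w` -/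
theorem antipode_comul_mul {α β β' γ : G} (h : α * β = γ) (h' : γ * β' = α) (hβ : β * β' = 1)
    (hβ' : β' * β = 1) (w : H γ ⊗[k] H β') (x : H γ) :
    LinearMap.mul' k (H γ ⊗[k] H β) (TensorProduct.map
      ((antipode (k := k) hβ').lTensor (H γ) ∘ₗ LinearMap.mulRight k w ∘ₗ
        (comul (k := k) h').toLinearMap)
      (TensorProduct.mk k (H γ) (H β) 1) (comul (k := k) h x)) =
      (x ⊗ₜ 1) * (antipode (k := k) hβ').lTensor (H γ) w := by
  induction w with
  | zero =>
    have : (LinearMap.mulRight k (0 : H γ ⊗[k] H β')) = 0 := by ext; simp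
    simp [this]
  | add w w' hw hw' =>
    have : (LinearMap.mulRight k (w + w')) = LinearMap.mulRight k w + LinearMap.mulRight k w' :=
      LinearMap.ext fun z => by simp [mul_add]
    simp only [this, LinearMap.add_comp, LinearMap.comp_add, TensorProduct.map_add_left,
      LinearMap.add_apply, map_add, hw, hw', mul_add]
  | tmul c d =>
    have key := collapse_right h' h hβ'
      (TensorProduct.map (LinearMap.mulRight k c) (LinearMap.mulLeft k (antipode (k := k) hβ' d) ∘ₗ
        LinearMap.mul' k (H β) ∘ₗ (antipode (k := k) hβ').rTensor (H β)))
      ((TensorProduct.mk k (H γ) (H β)).flip (antipode (k := k) hβ' d) ∘ₗ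
        LinearMap.mulRight k c) ?_ x
    · simp only [LinearMap.lTensor_tmul, Algebra.TensorProduct.tmul_mul_tmul, one_mul]
      rw [LinearMap.comp_apply, LinearMap.flip_apply, TensorProduct.mk_apply,
        LinearMap.mulRight_apply] at key
      rw [← key]
      generalize comul (k := k) h x = w
      induction w with
      | zero =>
        simp only [map_zero, TensorProduct.zero_tmul, TensorProduct.tmul_zero, zero_mul, mul_zero,
          LinearMap.zero_apply]
      | add w w' hw hw' => simp only [map_add, hw, hw']
      | tmul a b =>
        simp only [TensorProduct.map_tmul, AlgHom.toLinearMap_apply, LinearMap.mul'_apply,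
          LinearMap.rTensor_tmul, LinearMap.comp_apply, TensorProduct.mk_apply,
          LinearMap.mulRight_apply]
        generalize comul (k := k) h' a = v
        induction v with
        | zero =>
          simp only [map_zero, TensorProduct.zero_tmul, TensorProduct.tmul_zero, zero_mul, mul_zero,
            LinearMap.zero_apply]
        | add w w' hw hw' => simp only [map_add, add_mul, TensorProduct.add_tmul, hw, hw']
        | tmul p q => simp [antipode_mul (k := k) hβ' hβ, mul_assoc]
    · intro a y
      simp [antipode_left (k := k) hβ' y]

/-- The same for the opposite coproduct and `S⁻¹ = g⁻¹ S g`. -/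
theorem Pivot.antipode_comul_mul (g : Pivot k H) {α β β' γ : G} (h : β * α = γ)
    (h' : β' * γ = α) (hβ : β * β' = 1) (hβ' : β' * β = 1) (w : H β' ⊗[k] H γ) (x : H γ) :
    LinearMap.mul' k (H β ⊗[k] H γ) (TensorProduct.comm k _ _ (TensorProduct.map
      ((TensorProduct.mk k (H β) (H γ)).flip 1)
      ((LinearMap.mulLeft k (g.inv β) ∘ₗ LinearMap.mulRight k (g.val β) ∘ₗ
        antipode (k := k) hβ').rTensor (H γ) ∘ₗ LinearMap.mulRight k w ∘ₗ
        (comul (k := k) h').toLinearMap) (comul (k := k) h x))) =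
      (1 ⊗ₜ x) * (LinearMap.mulLeft k (g.inv β) ∘ₗ LinearMap.mulRight k (g.val β) ∘ₗ
        antipode (k := k) hβ').rTensor (H γ) w := by
  induction w with
  | zero =>
    have : (LinearMap.mulRight k (0 : H β' ⊗[k] H γ)) = 0 := by ext; simp
    simp [this]
  | add w w' hw hw' =>
    have : (LinearMap.mulRight k (w + w')) = LinearMap.mulRight k w + LinearMap.mulRight k w' :=
      LinearMap.ext fun z => by simp [mul_add]
    simp only [this, LinearMap.add_comp, LinearMap.comp_add, TensorProduct.map_add_right,
      LinearMap.add_apply, map_add, hw, hw', mul_add]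
  | tmul d c =>
    have key := collapse_left h' h hβ
      (TensorProduct.map (LinearMap.mulLeft k (g.inv β * antipode (k := k) hβ' d) ∘ₗ
        LinearMap.mul' k (H β) ∘ₗ TensorProduct.map (antipode (k := k) hβ')
          (LinearMap.mulLeft k (g.val β)) ∘ₗ (TensorProduct.comm k _ _).toLinearMap)
        (LinearMap.mulRight k c) ∘ₗ (TensorProduct.assoc k _ _ _).symm.toLinearMap)
      (TensorProduct.mk k (H β) (H γ) (g.inv β * antipode (k := k) hβ' d * g.val β) ∘ₗ
        LinearMap.mulRight k c) ?_ x
    · simp only [LinearMap.rTensor_tmul, Algebra.TensorProduct.tmul_mul_tmul, one_mul]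
      simp only [LinearMap.comp_apply, TensorProduct.mk_apply, LinearMap.mulLeft_apply, LinearMap.mulRight_apply,
        ← mul_assoc] at key ⊢
      rw [← key]
      generalize comul (k := k) h x = w
      induction w with
      | zero =>
        simp only [map_zero, TensorProduct.zero_tmul, TensorProduct.tmul_zero, zero_mul, mul_zero,
          LinearMap.zero_apply]
      | add w w' hw hw' => simp only [map_add, hw, hw']
      | tmul a b =>
        simp only [TensorProduct.map_tmul, AlgHom.toLinearMap_apply, LinearMap.mul'_apply,
          LinearMap.lTensor_tmul, LinearMap.comp_apply, TensorProduct.mk_apply,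
          LinearMap.mulRight_apply, TensorProduct.comm_tmul, LinearMap.flip_apply]
        generalize comul (k := k) h' b = v
        induction v with
        | zero =>
          simp only [map_zero, TensorProduct.zero_tmul, TensorProduct.tmul_zero, zero_mul, mul_zero,
            LinearMap.zero_apply]
        | add w w' hw hw' => simp only [map_add, add_mul, TensorProduct.tmul_add, hw, hw']
        | tmul p q => simp [antipode_mul (k := k) hβ' hβ, mul_assoc]
    · intro y a
      have := g.antipode_val_mul hβ hβ' y
      simp only [LinearMap.comp_apply, LinearEquiv.coe_coe, LinearEquiv.symm_apply_apply,
        TensorProduct.map_tmul, this]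
      simp [TensorProduct.smul_tmul', mul_assoc]


/-! ### Actions, projectivity, partial traces of linear maps -/

/-- `(H_α ⊗ H_β)` acts on `V ⊗ W`. -/
def tensorEnd {A B V W : Type u} [Ring A] [Ring B] [Algebra k A] [Algebra k B]
    [AddCommGroup V] [Module k V] [AddCommGroup W] [Module k W]
    (ρ : A →ₐ[k] Module.End k V) (σ : B →ₐ[k] Module.End k W) :
    A ⊗[k] B →ₐ[k] Module.End k (V ⊗[k] W) :=
  Module.endTensorEndAlgHom.comp (Algebra.TensorProduct.map ρ σ)

@[simp] theorem tensorEnd_tmul {A B V W : Type u} [Ring A] [Ring B] [Algebra k A] [Algebra k B]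
    [AddCommGroup V] [Module k V] [AddCommGroup W] [Module k W]
    (ρ : A →ₐ[k] Module.End k V) (σ : B →ₐ[k] Module.End k W) (a : A) (b : B) :
    tensorEnd ρ σ (a ⊗ₜ b) = TensorProduct.map (ρ a) (σ b) := rfl

/-- The action of `H_γ`, `γ = αβ`, on the tensor product of an `H_α`-module and an `H_β`-module:
`x (v ⊗ w) = x₁ v ⊗ x₂ w`. -/
def tensorAct {V W : Type u} [AddCommGroup V] [Module k V] [AddCommGroup W] [Module k W]
    {α β γ : G} (h : α * β = γ) (ρ : H α →ₐ[k] Module.End k V) (σ : H β →ₐ[k] Module.End k W) :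
    H γ →ₐ[k] Module.End k (V ⊗[k] W) :=
  (tensorEnd ρ σ).comp (comul h)

/-- The module given by an action `ρ : A → End(V)` is projective. -/
def IsProjectiveAct {A V : Type u} [Ring A] [Algebra k A] [AddCommGroup V] [Module k V]
    (ρ : A →ₐ[k] Module.End k V) : Prop :=
  letI : Module A V := Module.compHom V ρ.toRingHom
  Module.Projective A V

theorem isProjectiveAct_iff {A V : Type u} [Ring A] [Algebra k A] [AddCommGroup V] [Module k V]
    (ρ : A →ₐ[k] Module.End k V) : IsProjectiveAct ρ ↔ ∃ s : V →ₗ[k] A ⊗[k] V,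
      (∀ a v, s (ρ a v) = (LinearMap.mulLeft k a).rTensor V (s v)) ∧
        ∀ v, TensorProduct.lift ρ.toLinearMap (s v) = v := by
  let _ : Module A V := Module.compHom V ρ.toRingHom
  have hsmul (a : A) (v : V) : a • v = ρ a v := rfl
  have : IsScalarTower k A V := ⟨fun c a v => by simp [hsmul]⟩
  have hl (a : A) (z : A ⊗[k] V) : a • z = (LinearMap.mulLeft k a).rTensor V z := by
    induction z with
    | zero => simp
    | add z z' hz hz' => simp only [smul_add, map_add, hz, hz']
    | tmul b v => simp [TensorProduct.smul_tmul']
  let m : A ⊗[k] V →ₗ[A] V :=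
    { toFun := TensorProduct.lift ρ.toLinearMap
      map_add' := map_add _
      map_smul' := fun a z => by
        rw [hl, hsmul, RingHom.id_apply]
        induction z with
        | zero =>
          simp only [map_zero, TensorProduct.zero_tmul, TensorProduct.tmul_zero, zero_mul, mul_zero,
            LinearMap.zero_apply]
        | add z z' hz hz' => simp only [map_add, hz, hz']
        | tmul b v => simp }
  have hm (z : A ⊗[k] V) : m z = TensorProduct.lift ρ.toLinearMap z := rfl
  constructor
  · intro hP
    have : Module.Projective A V := hP
    obtain ⟨s, hs⟩ := Module.projective_lifting_property m LinearMap.id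
      (fun v => ⟨1 ⊗ₜ v, by simp [hm]⟩)
    refine ⟨s.restrictScalars k, fun a v => ?_, fun v => ?_⟩
    · rw [← hl]; exact s.map_smul a v
    · rw [← hm]; exact LinearMap.congr_fun hs v
  · rintro ⟨s, hs, hs'⟩
    let s' : V →ₗ[A] A ⊗[k] V :=
      { toFun := s, map_add' := s.map_add, map_smul' := fun a v => by
          rw [hsmul, hs, ← hl]; rfl }
    exact Module.Projective.of_split s' m (LinearMap.ext fun v => by
      change m (s v) = v
      rw [hm, hs'])

theorem isProjectiveAct_tensor_right {V W : Type u} [AddCommGroup V] [Module k V] [AddCommGroup W]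
    [Module k W] {α β γ : G} (h : α * β = γ) (ρ : H α →ₐ[k] Module.End k V)
    (σ : H β →ₐ[k] Module.End k W) (hρ : IsProjectiveAct ρ) :
    IsProjectiveAct (tensorAct h ρ σ) := by
  obtain ⟨s, hs, hs'⟩ := (isProjectiveAct_iff ρ).1 hρ
  rw [isProjectiveAct_iff]
  have h' : γ * β⁻¹ = α := by rw [← h]; group
  have hβ := mul_inv_cancel β
  have hβ' := inv_mul_cancel β
  -- `K (c ⊗ b) (v ⊗ w) = c ⊗ (v ⊗ b w)`
  let K : H γ ⊗[k] H β →ₗ[k] (V ⊗[k] W →ₗ[k] H γ ⊗[k] (V ⊗[k] W)) :=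
    TensorProduct.lift (LinearMap.mk₂ k
      (fun c b => TensorProduct.mk k (H γ) (V ⊗[k] W) c ∘ₗ (σ b).lTensor V)
      (fun _ _ _ => by ext; simp) (fun _ _ _ => by ext; simp)
      (fun _ _ _ => by ext; simp [TensorProduct.tmul_add]) (fun _ _ _ => by ext; simp))
  have hK (c : H γ) (b : H β) (v : V) (w : W) : K (c ⊗ₜ b) (v ⊗ₜ w) = c ⊗ₜ (v ⊗ₜ σ b w) := rfl
  have hK₁ (z : H γ ⊗[k] H β) (b : H β) (v : V) (w : W) :
      K z (v ⊗ₜ σ b w) = K (z * (1 ⊗ₜ b)) (v ⊗ₜ w) := by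
    induction z with
    | zero =>
      simp only [map_zero, TensorProduct.zero_tmul, TensorProduct.tmul_zero, zero_mul, mul_zero,
        LinearMap.zero_apply]
    | add z z' hz hz' => simp only [map_add, add_mul, LinearMap.add_apply, hz, hz']
    | tmul c d => simp [hK]
  have hK₂ (x : H γ) (z : H γ ⊗[k] H β) (v : V) (w : W) :
      K ((x ⊗ₜ 1) * z) (v ⊗ₜ w) =
        (LinearMap.mulLeft k x).rTensor (V ⊗[k] W) (K z (v ⊗ₜ w)) := by
    induction z with
    | zero =>
      simp only [map_zero, TensorProduct.zero_tmul, TensorProduct.tmul_zero, zero_mul, mul_zero,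
        LinearMap.zero_apply]
    | add z z' hz hz' => simp only [map_add, mul_add, LinearMap.add_apply, hz, hz']
    | tmul c d => simp [hK]
  let Ψ : H α →ₗ[k] H γ ⊗[k] H β :=
    (antipode (k := k) hβ').lTensor (H γ) ∘ₗ (comul (k := k) h').toLinearMap
  let Ξ : H α ⊗[k] V →ₗ[k] W →ₗ[k] H γ ⊗[k] (V ⊗[k] W) :=
    TensorProduct.lift (LinearMap.mk₂ k (fun a v => K (Ψ a) ∘ₗ TensorProduct.mk k V W v)
      (fun _ _ _ => by ext; simp) (fun _ _ _ => by ext; simp)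
      (fun _ _ _ => by ext; simp) (fun _ _ _ => by ext; simp))
  have hΞ (a : H α) (v : V) (w : W) : Ξ (a ⊗ₜ v) w = K (Ψ a) (v ⊗ₜ w) := rfl
  refine ⟨TensorProduct.lift (Ξ ∘ₗ s), fun x z => ?_, fun z => ?_⟩
  · induction z with
    | zero =>
      simp only [map_zero, TensorProduct.zero_tmul, TensorProduct.tmul_zero, zero_mul, mul_zero,
        LinearMap.zero_apply]
    | add z z' hz hz' => simp only [map_add, hz, hz']
    | tmul v w =>
      obtain ⟨n, c, b, hx⟩ := TensorProduct.exists_sum_tmul_eq (comul (k := k) h x)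
      obtain ⟨m, a, v', hv⟩ := TensorProduct.exists_sum_tmul_eq (s v)
      have key (j : Fin m) : ∑ i, Ψ (c i * a j) * (1 ⊗ₜ b i) = (x ⊗ₜ 1) * Ψ (a j) := by
        have := antipode_comul_mul (k := k) h h' hβ hβ' (comul (k := k) h' (a j)) x
        rw [hx] at this
        simpa [Ψ] using this
      simp only [tensorAct, AlgHom.comp_apply, hx, map_sum, tensorEnd_tmul, LinearMap.sum_apply,
        TensorProduct.map_tmul, TensorProduct.lift.tmul, LinearMap.comp_apply, hs, hv,
        LinearMap.rTensor_tmul, LinearMap.mulLeft_apply, hΞ, hK₁]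
      rw [Finset.sum_comm]
      simp only [← LinearMap.sum_apply, ← map_sum, key, hK₂]
  · induction z with
    | zero =>
      simp only [map_zero, TensorProduct.zero_tmul, TensorProduct.tmul_zero, zero_mul, mul_zero,
        LinearMap.zero_apply]
    | add z z' hz hz' => simp only [map_add, hz, hz']
    | tmul v w =>
      have e : ∀ (q : H γ ⊗[k] H β⁻¹) (v : V) (w : W),
          TensorProduct.lift (tensorAct h ρ σ).toLinearMap
            (K ((antipode (k := k) hβ').lTensor (H γ) q) (v ⊗ₜ w)) =
          tensorEnd ρ σ (LinearMap.mul' k (H α ⊗[k] H β) (TensorProduct.map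
            (comul (k := k) h).toLinearMap
            (TensorProduct.mk k (H α) (H β) 1 ∘ₗ antipode (k := k) hβ') q)) (v ⊗ₜ w) := by
        intro q v w
        induction q with
        | zero =>
          simp only [map_zero, TensorProduct.zero_tmul, TensorProduct.tmul_zero, zero_mul, mul_zero,
            LinearMap.zero_apply]
        | add z z' hz hz' => simp only [map_add, LinearMap.add_apply, hz, hz']
        | tmul c d => simp [hK, tensorAct]
      have e' : ∀ (y : H α ⊗[k] V), TensorProduct.lift (tensorAct h ρ σ).toLinearMap (Ξ y w) =
          (TensorProduct.lift ρ.toLinearMap y) ⊗ₜ w := by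
        intro y
        induction y with
        | zero =>
          simp only [map_zero, TensorProduct.zero_tmul, TensorProduct.tmul_zero, zero_mul, mul_zero,
            LinearMap.zero_apply]
        | add z z' hz hz' =>
          simp only [map_add, LinearMap.add_apply, hz, hz', TensorProduct.add_tmul]
        | tmul a v =>
          simp only [hΞ, Ψ, LinearMap.comp_apply, e, AlgHom.toLinearMap_apply]
          rw [comul_mul_antipode h h' hβ hβ']
          simp
      simp [e', hs']

theorem Pivot.isProjectiveAct_tensor_left (g : Pivot k H) {V W : Type u} [AddCommGroup V]
    [Module k V] [AddCommGroup W] [Module k W] {α β γ : G} (h : β * α = γ)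
    (ρ : H α →ₐ[k] Module.End k V) (σ : H β →ₐ[k] Module.End k W) (hρ : IsProjectiveAct ρ) :
    IsProjectiveAct (tensorAct h σ ρ) := by
  obtain ⟨s, hs, hs'⟩ := (isProjectiveAct_iff ρ).1 hρ
  rw [isProjectiveAct_iff]
  have h' : β⁻¹ * γ = α := by rw [← h]; group
  have hβ := mul_inv_cancel β
  have hβ' := inv_mul_cancel β
  -- `K (b ⊗ c) (w ⊗ v) = c ⊗ (b w ⊗ v)`
  let K : H β ⊗[k] H γ →ₗ[k] (W ⊗[k] V →ₗ[k] H γ ⊗[k] (W ⊗[k] V)) :=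
    TensorProduct.lift (LinearMap.mk₂ k
      (fun b c => TensorProduct.mk k (H γ) (W ⊗[k] V) c ∘ₗ (σ b).rTensor V)
      (fun _ _ _ => by ext; simp [TensorProduct.tmul_add])
      (fun _ _ _ => by ext; simp)
      (fun _ _ _ => by ext; simp) (fun _ _ _ => by ext; simp))
  have hK (c : H γ) (b : H β) (v : V) (w : W) : K (b ⊗ₜ c) (w ⊗ₜ v) = c ⊗ₜ (σ b w ⊗ₜ v) := rfl
  have hK₁ (z : H β ⊗[k] H γ) (b : H β) (v : V) (w : W) :
      K z (σ b w ⊗ₜ v) = K (z * (b ⊗ₜ 1)) (w ⊗ₜ v) := by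
    induction z with
    | zero =>
      simp only [map_zero, TensorProduct.zero_tmul, TensorProduct.tmul_zero, zero_mul, mul_zero,
        LinearMap.zero_apply]
    | add z z' hz hz' => simp only [map_add, add_mul, LinearMap.add_apply, hz, hz']
    | tmul c d => simp [hK]
  have hK₂ (x : H γ) (z : H β ⊗[k] H γ) (v : V) (w : W) :
      K ((1 ⊗ₜ x) * z) (w ⊗ₜ v) =
        (LinearMap.mulLeft k x).rTensor (W ⊗[k] V) (K z (w ⊗ₜ v)) := by
    induction z with
    | zero =>
      simp only [map_zero, TensorProduct.zero_tmul, TensorProduct.tmul_zero, zero_mul, mul_zero,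
        LinearMap.zero_apply]
    | add z z' hz hz' => simp only [map_add, mul_add, LinearMap.add_apply, hz, hz']
    | tmul c d => simp [hK]
  let S' : H β⁻¹ →ₗ[k] H β := LinearMap.mulLeft k (g.inv β) ∘ₗ LinearMap.mulRight k (g.val β) ∘ₗ
    antipode (k := k) hβ'
  let Ψ : H α →ₗ[k] H β ⊗[k] H γ := S'.rTensor (H γ) ∘ₗ (comul (k := k) h').toLinearMap
  let Ξ : H α ⊗[k] V →ₗ[k] W →ₗ[k] H γ ⊗[k] (W ⊗[k] V) :=
    TensorProduct.lift (LinearMap.mk₂ k (fun a v => K (Ψ a) ∘ₗ (TensorProduct.mk k W V).flip v)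
      (fun _ _ _ => by ext; simp) (fun _ _ _ => by ext; simp)
      (fun _ _ _ => by ext; simp) (fun _ _ _ => by ext; simp))
  have hΞ (a : H α) (v : V) (w : W) : Ξ (a ⊗ₜ v) w = K (Ψ a) (w ⊗ₜ v) := rfl
  refine ⟨TensorProduct.lift (Ξ ∘ₗ s).flip, fun x z => ?_, fun z => ?_⟩
  · induction z with
    | zero =>
      simp only [map_zero, TensorProduct.zero_tmul, TensorProduct.tmul_zero, zero_mul, mul_zero,
        LinearMap.zero_apply]
    | add z z' hz hz' => simp only [map_add, hz, hz']
    | tmul w v =>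
      obtain ⟨n, b, c, hx⟩ := TensorProduct.exists_sum_tmul_eq (comul (k := k) h x)
      obtain ⟨m, a, v', hv⟩ := TensorProduct.exists_sum_tmul_eq (s v)
      have key (j : Fin m) : ∑ i, Ψ (c i * a j) * (b i ⊗ₜ 1) = (1 ⊗ₜ x) * Ψ (a j) := by
        have := g.antipode_comul_mul h h' hβ hβ' (comul (k := k) h' (a j)) x
        rw [hx] at this
        simpa [Ψ, S'] using this
      simp only [tensorAct, AlgHom.comp_apply, hx, map_sum, tensorEnd_tmul, LinearMap.sum_apply,
        TensorProduct.map_tmul, TensorProduct.lift.tmul, LinearMap.comp_apply, hs, hv,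
        LinearMap.rTensor_tmul, LinearMap.mulLeft_apply, LinearMap.flip_apply, hΞ, hK₁]
      rw [Finset.sum_comm]
      simp only [← LinearMap.sum_apply, ← map_sum, key, hK₂]
  · induction z with
    | zero =>
      simp only [map_zero, TensorProduct.zero_tmul, TensorProduct.tmul_zero, zero_mul, mul_zero,
        LinearMap.zero_apply]
    | add z z' hz hz' => simp only [map_add, hz, hz']
    | tmul w v =>
      have hg (c : H β⁻¹) (w : W) : σ (g.inv β) (σ (antipode (k := k) hβ' c) (σ (g.val β) w)) =
        σ (S' c) w := by simp [S']
      have e : ∀ (q : H β⁻¹ ⊗[k] H γ) (v : V) (w : W),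
          TensorProduct.lift (tensorAct h σ ρ).toLinearMap (K (S'.rTensor (H γ) q) (w ⊗ₜ v)) =
          tensorEnd σ ρ (LinearMap.mul' k (H β ⊗[k] H α) (TensorProduct.comm k _ _
            (TensorProduct.map
              ((TensorProduct.mk k (H β) (H α)).flip 1 ∘ₗ LinearMap.mulLeft k (g.inv β) ∘ₗ
                antipode (k := k) hβ') (comul (k := k) h).toLinearMap q)))
            (σ (g.val β) w ⊗ₜ v) := by
        intro q v w
        induction q with
        | zero =>
          simp only [map_zero, TensorProduct.zero_tmul, TensorProduct.tmul_zero, zero_mul, mul_zero,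
            LinearMap.zero_apply]
        | add z z' hz hz' => simp only [map_add, LinearMap.add_apply, hz, hz']
        | tmul c d => simp [hK, tensorAct, hg]
      have hgw (w : W) : σ (g.inv β) (σ (g.val β) w) = w := by
        rw [← Module.End.mul_apply, ← map_mul, g.inv_mul]; simp
      have e' : ∀ (y : H α ⊗[k] V), TensorProduct.lift (tensorAct h σ ρ).toLinearMap (Ξ y w) =
          w ⊗ₜ (TensorProduct.lift ρ.toLinearMap y) := by
        intro y
        induction y with
        | zero =>
          simp only [map_zero, TensorProduct.zero_tmul, TensorProduct.tmul_zero, zero_mul, mul_zero,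
            LinearMap.zero_apply]
        | add z z' hz hz' =>
          simp only [map_add, LinearMap.add_apply, hz, hz', TensorProduct.tmul_add]
        | tmul a v =>
          simp only [hΞ, Ψ, LinearMap.comp_apply, e, AlgHom.toLinearMap_apply]
          rw [g.comul_mul_inv_antipode h h' hβ' hβ]
          simp [hgw]
      simp [e', hs']

/-- For an endomorphism `a` of `W` (in use: the action of the pivot), the right partial trace of
`F : U ⊗ W → V ⊗ W`, that is `(id ⊗ ev) (F ⊗ id) (id ⊗ coev)` with `coev 1 = ∑ wⱼ ⊗ wʲ` and
`ev (w ⊗ f) = f (a w)`. -/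
def rightPartialTraceLin {U V W : Type u} [AddCommGroup U] [Module k U] [AddCommGroup V]
    [Module k V] [AddCommGroup W] [Module k W] [Module.Finite k W] (a : Module.End k W)
    (F : U ⊗[k] W →ₗ[k] V ⊗[k] W) : U →ₗ[k] V :=
  (TensorProduct.rid k V).toLinearMap ∘ₗ
    (contractRight k W ∘ₗ a.rTensor (Module.Dual k W)).lTensor V ∘ₗ
    (TensorProduct.assoc k V W (Module.Dual k W)).toLinearMap ∘ₗ
    F.rTensor (Module.Dual k W) ∘ₗ
    (TensorProduct.assoc k U W (Module.Dual k W)).symm.toLinearMap ∘ₗ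
    (coevaluation k W).lTensor U ∘ₗ
    (TensorProduct.rid k U).symm.toLinearMap

/-- For an endomorphism `a` of `W` (in use: the action of the inverse of the pivot), the left partial
trace of `F : W ⊗ U → W ⊗ V`, that is `(ev ⊗ id) (id ⊗ F) (coev ⊗ id)` with
`coev 1 = ∑ wʲ ⊗ a wⱼ` and `ev (f ⊗ w) = f w`. -/
def leftPartialTraceLin {U V W : Type u} [AddCommGroup U] [Module k U] [AddCommGroup V]
    [Module k V] [AddCommGroup W] [Module k W] [Module.Finite k W] (a : Module.End k W)
    (F : W ⊗[k] U →ₗ[k] W ⊗[k] V) : U →ₗ[k] V :=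
  (TensorProduct.lid k V).toLinearMap ∘ₗ
    (contractLeft k W).rTensor V ∘ₗ
    (TensorProduct.assoc k (Module.Dual k W) W V).symm.toLinearMap ∘ₗ
    F.lTensor (Module.Dual k W) ∘ₗ
    (TensorProduct.assoc k (Module.Dual k W) W U).toLinearMap ∘ₗ
    ((TensorProduct.comm k W (Module.Dual k W)).toLinearMap ∘ₗ
      a.rTensor (Module.Dual k W) ∘ₗ coevaluation k W).rTensor U ∘ₗ
    (TensorProduct.lid k U).symm.toLinearMap

theorem coevaluation_twist {W : Type u} [AddCommGroup W] [Module k W] [Module.Finite k W]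
    (b : Module.End k W) : b.rTensor (Module.Dual k W) (coevaluation k W 1) =
      (LinearMap.lTensor W (Module.Dual.transpose (R := k) b)) (coevaluation k W 1) := by
  let B := Module.Basis.ofVectorSpace k W
  rw [coevaluation_apply_one]
  simp only [map_sum, LinearMap.rTensor_tmul, LinearMap.lTensor_tmul]
  classical
  have h1 : ∀ i, b (B i) = ∑ j, B.coord j (b (B i)) • B j := fun i => (B.sum_repr _).symm
  have h2 : ∀ i, Module.Dual.transpose (R := k) b (B.coord i) =
      ∑ j, B.coord i (b (B j)) • B.coord j := fun i => B.ext fun l => by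
    simp [Module.Dual.transpose_apply, Finsupp.single_apply]
  have e1 : ∑ i, b (B i) ⊗ₜ[k] B.coord i =
      ∑ i, ∑ j, B.coord j (b (B i)) • (B j ⊗ₜ[k] B.coord i) :=
    Finset.sum_congr rfl fun i _ => by
      conv_lhs => rw [h1 i]
      simp only [TensorProduct.sum_tmul, TensorProduct.smul_tmul']
  have e2 : ∑ i, B i ⊗ₜ[k] (Module.Dual.transpose (R := k) b (B.coord i)) =
      ∑ i, ∑ j, B.coord i (b (B j)) • (B i ⊗ₜ[k] B.coord j) :=
    Finset.sum_congr rfl fun i _ => by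
      rw [h2 i]
      simp only [TensorProduct.tmul_sum, TensorProduct.tmul_smul]
  exact e1.trans (Finset.sum_comm.trans e2.symm)


section Lin

variable {U V W : Type u} [AddCommGroup U] [Module k U] [AddCommGroup V] [Module k V]
  [AddCommGroup W] [Module k W] [Module.Finite k W]

theorem rightPartialTraceLin_add (a : Module.End k W) (F F' : U ⊗[k] W →ₗ[k] V ⊗[k] W) :
    rightPartialTraceLin a (F + F') = rightPartialTraceLin a F + rightPartialTraceLin a F' := by
  simp only [rightPartialTraceLin, LinearMap.rTensor_add, LinearMap.add_comp, LinearMap.comp_add]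

theorem leftPartialTraceLin_add (a : Module.End k W) (F F' : W ⊗[k] U →ₗ[k] W ⊗[k] V) :
    leftPartialTraceLin a (F + F') = leftPartialTraceLin a F + leftPartialTraceLin a F' := by
  simp only [leftPartialTraceLin, LinearMap.lTensor_add, LinearMap.add_comp, LinearMap.comp_add]

theorem rightPartialTraceLin_eq_one (a : Module.End k W) (F : U ⊗[k] W →ₗ[k] V ⊗[k] W) :
    rightPartialTraceLin a F = rightPartialTraceLin 1 (a.lTensor V ∘ₗ F) := by
  simp only [rightPartialTraceLin, LinearMap.rTensor_comp]
  have : (contractRight k W ∘ₗ a.rTensor (Module.Dual k W)).lTensor V ∘ₗ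
      (TensorProduct.assoc k V W (Module.Dual k W)).toLinearMap =
      (contractRight k W ∘ₗ (1 : Module.End k W).rTensor (Module.Dual k W)).lTensor V ∘ₗ
      (TensorProduct.assoc k V W (Module.Dual k W)).toLinearMap ∘ₗ
        (a.lTensor V).rTensor (Module.Dual k W) := by
    ext; simp
  exact LinearMap.ext fun u => congrArg (TensorProduct.rid k V) (LinearMap.congr_fun this _)

theorem leftPartialTraceLin_eq_one (a : Module.End k W) (F : W ⊗[k] U →ₗ[k] W ⊗[k] V) :
    leftPartialTraceLin a F = leftPartialTraceLin 1 (F ∘ₗ a.rTensor U) := by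
  refine LinearMap.ext fun u => ?_
  simp only [leftPartialTraceLin, LinearMap.comp_apply, LinearEquiv.coe_coe,
    TensorProduct.lid_symm_apply, LinearMap.rTensor_tmul]
  generalize coevaluation k W 1 = z
  induction z with
  | zero =>
    simp only [map_zero, TensorProduct.zero_tmul, TensorProduct.tmul_zero, zero_mul, mul_zero,
      LinearMap.zero_apply]
  | add z z' hz hz' => simp only [map_add, TensorProduct.add_tmul, hz, hz']
  | tmul w f => simp

theorem rightPartialTraceLin_cyclic (b : Module.End k W) (F : U ⊗[k] W →ₗ[k] V ⊗[k] W) :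
    rightPartialTraceLin 1 (F ∘ₗ b.lTensor U) = rightPartialTraceLin 1 (b.lTensor V ∘ₗ F) := by
  refine LinearMap.ext fun u => ?_
  have key (z : W ⊗[k] Module.Dual k W) :
      (TensorProduct.assoc k U W (Module.Dual k W)).symm (u ⊗ₜ (b.rTensor _ z)) =
      (b.lTensor U).rTensor _ ((TensorProduct.assoc k U W (Module.Dual k W)).symm (u ⊗ₜ z)) := by
    induction z with
    | zero =>
      simp only [map_zero, TensorProduct.zero_tmul, TensorProduct.tmul_zero, zero_mul, mul_zero,
        LinearMap.zero_apply]
    | add z z' hz hz' => simp only [map_add, TensorProduct.tmul_add, hz, hz']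
    | tmul w f => simp
  have key₂ (y : V ⊗[k] W) (f : Module.Dual k W) :
      (LinearMap.lTensor V (contractRight k W)) ((TensorProduct.assoc k V W (Module.Dual k W))
        (y ⊗ₜ Module.Dual.transpose (R := k) b f)) =
      (LinearMap.lTensor V (contractRight k W)) ((TensorProduct.assoc k V W (Module.Dual k W))
        (b.lTensor V y ⊗ₜ f)) := by
    induction y with
    | zero =>
      simp only [map_zero, TensorProduct.zero_tmul, TensorProduct.tmul_zero, zero_mul, mul_zero,
        LinearMap.zero_apply]
    | add z z' hz hz' => simp only [map_add, TensorProduct.add_tmul, hz, hz']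
    | tmul w f => simp [Module.Dual.transpose_apply]
  have h1 : (LinearMap.rTensor (Module.Dual k W) (1 : Module.End k W)) = LinearMap.id :=
    LinearMap.rTensor_id _ _
  simp only [rightPartialTraceLin, LinearMap.comp_apply, LinearEquiv.coe_coe,
    TensorProduct.rid_symm_apply, LinearMap.lTensor_tmul, LinearMap.rTensor_comp, ← key,
    coevaluation_twist, h1, LinearMap.comp_id]
  congr 1
  generalize coevaluation k W 1 = z
  induction z with
  | zero =>
    simp only [map_zero, TensorProduct.zero_tmul, TensorProduct.tmul_zero, zero_mul, mul_zero,
      LinearMap.zero_apply]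
  | add z z' hz hz' => simp only [map_add, TensorProduct.tmul_add, hz, hz']
  | tmul w f => simp [key₂]

theorem leftPartialTraceLin_cyclic (b : Module.End k W) (F : W ⊗[k] U →ₗ[k] W ⊗[k] V) :
    leftPartialTraceLin 1 (F ∘ₗ b.rTensor U) = leftPartialTraceLin 1 (b.rTensor V ∘ₗ F) := by
  refine LinearMap.ext fun u => ?_
  have key (z : W ⊗[k] Module.Dual k W) :
      TensorProduct.assoc k (Module.Dual k W) W U
        (TensorProduct.comm k W (Module.Dual k W) (b.rTensor _ z) ⊗ₜ u) =
      (b.rTensor U).lTensor _ (TensorProduct.assoc k (Module.Dual k W) W U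
        (TensorProduct.comm k W (Module.Dual k W) z ⊗ₜ u)) := by
    induction z with
    | zero =>
      simp only [map_zero, TensorProduct.zero_tmul, TensorProduct.tmul_zero, zero_mul, mul_zero,
        LinearMap.zero_apply]
    | add z z' hz hz' => simp only [map_add, TensorProduct.add_tmul, hz, hz']
    | tmul w f => simp
  have key₂ (y : W ⊗[k] V) (f : Module.Dual k W) :
      (LinearMap.rTensor V (contractLeft k W)) ((TensorProduct.assoc k (Module.Dual k W) W V).symm
        (Module.Dual.transpose (R := k) b f ⊗ₜ y)) =
      (LinearMap.rTensor V (contractLeft k W)) ((TensorProduct.assoc k (Module.Dual k W) W V).symm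
        (f ⊗ₜ b.rTensor V y)) := by
    induction y with
    | zero =>
      simp only [map_zero, TensorProduct.zero_tmul, TensorProduct.tmul_zero, zero_mul, mul_zero,
        LinearMap.zero_apply]
    | add z z' hz hz' => simp only [map_add, TensorProduct.tmul_add, hz, hz']
    | tmul w f => simp [Module.Dual.transpose_apply]
  have h1 : (LinearMap.rTensor (Module.Dual k W) (1 : Module.End k W)) = LinearMap.id :=
    LinearMap.rTensor_id _ _
  simp only [leftPartialTraceLin, LinearMap.comp_apply, LinearEquiv.coe_coe,
    TensorProduct.lid_symm_apply, LinearMap.rTensor_tmul, LinearMap.lTensor_comp, ← key,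
    coevaluation_twist, h1, LinearMap.id_apply]
  congr 1
  generalize coevaluation k W 1 = z
  induction z with
  | zero =>
    simp only [map_zero, TensorProduct.zero_tmul, TensorProduct.tmul_zero, zero_mul, mul_zero,
      LinearMap.zero_apply]
  | add z z' hz hz' => simp only [map_add, TensorProduct.add_tmul, hz, hz']
  | tmul w f => simp [key₂]

theorem rightPartialTraceLin_comp (a : Module.End k W) (F : U ⊗[k] W →ₗ[k] V ⊗[k] W)
    (b : Module.End k U) :
    rightPartialTraceLin a (F ∘ₗ b.rTensor W) = rightPartialTraceLin a F ∘ₗ b := by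
  refine LinearMap.ext fun u => ?_
  simp only [rightPartialTraceLin, LinearMap.comp_apply, LinearEquiv.coe_coe,
    TensorProduct.rid_symm_apply, LinearMap.lTensor_tmul]
  generalize coevaluation k W 1 = z
  induction z with
  | zero =>
    simp only [map_zero, TensorProduct.zero_tmul, TensorProduct.tmul_zero, zero_mul, mul_zero,
      LinearMap.zero_apply]
  | add z z' hz hz' => simp only [map_add, TensorProduct.tmul_add, hz, hz']
  | tmul w f => simp

theorem leftPartialTraceLin_comp (a : Module.End k W) (F : W ⊗[k] U →ₗ[k] W ⊗[k] V)
    (b : Module.End k U) :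
    leftPartialTraceLin a (F ∘ₗ b.lTensor W) = leftPartialTraceLin a F ∘ₗ b := by
  refine LinearMap.ext fun u => ?_
  simp only [leftPartialTraceLin, LinearMap.comp_apply, LinearEquiv.coe_coe,
    TensorProduct.lid_symm_apply, LinearMap.rTensor_tmul]
  generalize coevaluation k W 1 = z
  induction z with
  | zero =>
    simp only [map_zero, TensorProduct.zero_tmul, TensorProduct.tmul_zero, zero_mul, mul_zero,
      LinearMap.zero_apply]
  | add z z' hz hz' => simp only [map_add, TensorProduct.add_tmul, hz, hz']
  | tmul w f => simp

theorem comp_rightPartialTraceLin (a : Module.End k W) (F : U ⊗[k] W →ₗ[k] V ⊗[k] W)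
    (b : Module.End k V) :
    rightPartialTraceLin a (b.rTensor W ∘ₗ F) = b ∘ₗ rightPartialTraceLin a F := by
  have key (z : (V ⊗[k] W) ⊗[k] Module.Dual k W) :
      TensorProduct.rid k V ((contractRight k W ∘ₗ a.rTensor (Module.Dual k W)).lTensor V
        (TensorProduct.assoc k V W (Module.Dual k W) ((b.rTensor W).rTensor _ z))) =
      b (TensorProduct.rid k V ((contractRight k W ∘ₗ a.rTensor (Module.Dual k W)).lTensor V
        (TensorProduct.assoc k V W (Module.Dual k W) z))) := by
    induction z with
    | zero =>
      simp only [map_zero, TensorProduct.zero_tmul, TensorProduct.tmul_zero, zero_mul, mul_zero,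
        LinearMap.zero_apply]
    | add z z' hz hz' => simp only [map_add, hz, hz']
    | tmul y f =>
      induction y with
      | zero =>
        simp only [map_zero, TensorProduct.zero_tmul, TensorProduct.tmul_zero, zero_mul, mul_zero,
          LinearMap.zero_apply]
      | add z z' hz hz' => simp only [map_add, TensorProduct.add_tmul, hz, hz']
      | tmul v w => simp
  refine LinearMap.ext fun u => ?_
  simp only [rightPartialTraceLin, LinearMap.comp_apply, LinearEquiv.coe_coe,
    LinearMap.rTensor_comp] at key ⊢
  exact key _

theorem comp_leftPartialTraceLin (a : Module.End k W) (F : W ⊗[k] U →ₗ[k] W ⊗[k] V)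
    (b : Module.End k V) :
    leftPartialTraceLin a (b.lTensor W ∘ₗ F) = b ∘ₗ leftPartialTraceLin a F := by
  have key (z : Module.Dual k W ⊗[k] (W ⊗[k] V)) :
      TensorProduct.lid k V ((contractLeft k W).rTensor V
        ((TensorProduct.assoc k (Module.Dual k W) W V).symm ((b.lTensor W).lTensor _ z))) =
      b (TensorProduct.lid k V ((contractLeft k W).rTensor V
        ((TensorProduct.assoc k (Module.Dual k W) W V).symm z))) := by
    induction z with
    | zero =>
      simp only [map_zero, TensorProduct.zero_tmul, TensorProduct.tmul_zero, zero_mul, mul_zero,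
        LinearMap.zero_apply]
    | add z z' hz hz' => simp only [map_add, hz, hz']
    | tmul f y =>
      induction y with
      | zero =>
        simp only [map_zero, TensorProduct.zero_tmul, TensorProduct.tmul_zero, zero_mul, mul_zero,
          LinearMap.zero_apply]
      | add z z' hz hz' => simp only [map_add, TensorProduct.tmul_add, hz, hz']
      | tmul v w => simp
  refine LinearMap.ext fun u => ?_
  simp only [leftPartialTraceLin, LinearMap.comp_apply, LinearEquiv.coe_coe,
    LinearMap.lTensor_comp] at key ⊢
  exact key _

/-- The right partial trace of a morphism of modules is a morphism of modules. -/
theorem Pivot.rightPartialTraceLin_equivariant (g : Pivot k H) {α β γ : G} (h : α * β = γ)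
    (ρ : H α →ₐ[k] Module.End k U) (ρ' : H α →ₐ[k] Module.End k V)
    (σ : H β →ₐ[k] Module.End k W) (F : U ⊗[k] W →ₗ[k] V ⊗[k] W)
    (hF : ∀ x, F ∘ₗ tensorAct h ρ σ x = tensorAct h ρ' σ x ∘ₗ F) (x : H α) :
    rightPartialTraceLin (σ (g.val β)) F ∘ₗ ρ x =
      ρ' x ∘ₗ rightPartialTraceLin (σ (g.val β)) F := by
  have h' : γ * β⁻¹ = α := by rw [← h]; group
  have hβ := mul_inv_cancel β
  have hβ' := inv_mul_cancel β
  have key : ∀ q : H γ ⊗[k] H β⁻¹, rightPartialTraceLin (σ (g.val β)) (F ∘ₗ tensorEnd ρ σ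
      (LinearMap.mul' k (H α ⊗[k] H β) (TensorProduct.map (comul (k := k) h).toLinearMap
        (TensorProduct.mk k (H α) (H β) 1 ∘ₗ antipode (k := k) hβ') q))) =
      rightPartialTraceLin 1 (tensorEnd ρ' σ
        (LinearMap.mul' k (H α ⊗[k] H β) (TensorProduct.comm k _ _ (TensorProduct.map
      (comul (k := k) h).toLinearMap (TensorProduct.mk k (H α) (H β) 1 ∘ₗ
        LinearMap.mulRight k (g.val β) ∘ₗ antipode (k := k) hβ') q))) ∘ₗ F) := by
    intro q
    induction q with
    | zero => simp [rightPartialTraceLin]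
    | add q q' hq hq' =>
      simp only [map_add, LinearMap.add_comp, LinearMap.comp_add, rightPartialTraceLin_add, hq, hq']
    | tmul p q =>
      have e1 : tensorEnd ρ σ (1 ⊗ₜ antipode (k := k) hβ' q) =
          (σ (antipode (k := k) hβ' q)).lTensor U := by
        rw [tensorEnd_tmul, map_one]; rfl
      have e2 : tensorEnd ρ' σ (1 ⊗ₜ (antipode (k := k) hβ' q * g.val β)) =
          (σ (antipode (k := k) hβ' q)).lTensor V ∘ₗ (σ (g.val β)).lTensor V := by
        rw [tensorEnd_tmul, map_one, map_mul, ← LinearMap.lTensor_comp]; rfl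
      simp only [TensorProduct.map_tmul, LinearMap.mul'_apply, TensorProduct.comm_tmul,
        LinearMap.comp_apply, AlgHom.toLinearMap_apply, TensorProduct.mk_apply,
        LinearMap.mulRight_apply, map_mul, e1, e2, Module.End.mul_eq_comp]
      rw [rightPartialTraceLin_eq_one]
      have hp : F ∘ₗ tensorEnd ρ σ (comul h p) = tensorEnd ρ' σ (comul h p) ∘ₗ F := hF p
      rw [← LinearMap.comp_assoc (LinearMap.lTensor U _), hp, ← LinearMap.comp_assoc,
        rightPartialTraceLin_cyclic]
      rfl
  have := key (comul (k := k) h' x)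
  rw [comul_mul_antipode h h' hβ hβ', g.antipode_val_mul_comul h h' hβ hβ', tensorEnd_tmul,
    tensorEnd_tmul, map_one] at this
  have e3 : TensorProduct.map (ρ' x) (σ (g.val β)) = (ρ' x).rTensor W ∘ₗ (σ (g.val β)).lTensor V :=
    (LinearMap.rTensor_comp_lTensor _ _ _).symm
  rw [e3, LinearMap.comp_assoc, comp_rightPartialTraceLin, ← rightPartialTraceLin_eq_one,
    show TensorProduct.map (ρ x) (1 : Module.End k W) = (ρ x).rTensor W from rfl,
    rightPartialTraceLin_comp] at this
  exact this

/-- The left partial trace of a morphism of modules is a morphism of modules. -/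
theorem Pivot.leftPartialTraceLin_equivariant (g : Pivot k H) {α β γ : G} (h : β * α = γ)
    (ρ : H α →ₐ[k] Module.End k U) (ρ' : H α →ₐ[k] Module.End k V)
    (σ : H β →ₐ[k] Module.End k W) (F : W ⊗[k] U →ₗ[k] W ⊗[k] V)
    (hF : ∀ x, F ∘ₗ tensorAct h σ ρ x = tensorAct h σ ρ' x ∘ₗ F) (x : H α) :
    leftPartialTraceLin (σ (g.inv β)) F ∘ₗ ρ x =
      ρ' x ∘ₗ leftPartialTraceLin (σ (g.inv β)) F := by
  have h' : β⁻¹ * γ = α := by rw [← h]; group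
  have hβ := mul_inv_cancel β
  have hβ' := inv_mul_cancel β
  have key : ∀ q : H β⁻¹ ⊗[k] H γ, leftPartialTraceLin 1 (F ∘ₗ tensorEnd σ ρ
      (LinearMap.mul' k (H β ⊗[k] H α) (TensorProduct.comm k _ _ (TensorProduct.map
      ((TensorProduct.mk k (H β) (H α)).flip 1 ∘ₗ LinearMap.mulLeft k (g.inv β) ∘ₗ
        antipode (k := k) hβ') (comul (k := k) h).toLinearMap q)))) =
      leftPartialTraceLin 1 (tensorEnd σ ρ'
        (LinearMap.mul' k (H β ⊗[k] H α) (TensorProduct.map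
      ((TensorProduct.mk k (H β) (H α)).flip 1 ∘ₗ LinearMap.mulLeft k (g.inv β) ∘ₗ
        antipode (k := k) hβ') (comul (k := k) h).toLinearMap q)) ∘ₗ F) := by
    intro q
    induction q with
    | zero => simp [leftPartialTraceLin]
    | add q q' hq hq' =>
      simp only [map_add, LinearMap.add_comp, LinearMap.comp_add, leftPartialTraceLin_add, hq, hq']
    | tmul q p =>
      have e1 : tensorEnd σ ρ ((g.inv β * antipode (k := k) hβ' q) ⊗ₜ 1) =
          (σ (g.inv β * antipode (k := k) hβ' q)).rTensor U := by
        rw [tensorEnd_tmul, map_one ρ]; rfl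
      have e2 : tensorEnd σ ρ' ((g.inv β * antipode (k := k) hβ' q) ⊗ₜ 1) =
          (σ (g.inv β * antipode (k := k) hβ' q)).rTensor V := by
        rw [tensorEnd_tmul, map_one ρ']; rfl
      have hp : F ∘ₗ tensorEnd σ ρ (comul h p) = tensorEnd σ ρ' (comul h p) ∘ₗ F := hF p
      simp only [TensorProduct.map_tmul, LinearMap.mul'_apply, TensorProduct.comm_tmul,
        LinearMap.comp_apply, AlgHom.toLinearMap_apply, TensorProduct.mk_apply,
        LinearMap.flip_apply, LinearMap.mulLeft_apply]
      rw [map_mul (tensorEnd σ ρ), map_mul (tensorEnd σ ρ'), e1, e2, Module.End.mul_eq_comp,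
        Module.End.mul_eq_comp, ← LinearMap.comp_assoc, hp, leftPartialTraceLin_cyclic]
      rfl
  have := key (comul (k := k) h' x)
  rw [g.comul_mul_inv_antipode h h' hβ' hβ, g.inv_antipode_mul_comul h h' hβ', tensorEnd_tmul,
    tensorEnd_tmul] at this
  have e3 : TensorProduct.map (σ (g.inv β)) (ρ x) = (σ (g.inv β)).rTensor U ∘ₗ (ρ x).lTensor W :=
    (LinearMap.rTensor_comp_lTensor _ _ _).symm
  have e3' : TensorProduct.map (σ (g.inv β)) (ρ x) = (ρ x).lTensor W ∘ₗ (σ (g.inv β)).rTensor U :=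
    (LinearMap.lTensor_comp_rTensor _ _ _).symm
  have e4 : TensorProduct.map (σ (g.inv β)) (ρ' x) =
      (σ (g.inv β)).rTensor V ∘ₗ (ρ' x).lTensor W :=
    (LinearMap.rTensor_comp_lTensor _ _ _).symm
  rw [e3, e4, ← LinearMap.comp_assoc, leftPartialTraceLin_comp, ← leftPartialTraceLin_eq_one,
    LinearMap.comp_assoc, ← leftPartialTraceLin_cyclic, LinearMap.comp_assoc,
    comp_leftPartialTraceLin, ← leftPartialTraceLin_eq_one] at this
  exact this

end Lin


/-! ### The category of `H`-modules -/

variable (k H) in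
/-- An object `V = ⨁_α V_α` of the category `H`-mod `= ⨁_α (H_α`-mod`)`: a family of
finite-dimensional `H_α`-modules `V_α`, all but finitely many of which vanish. -/
structure HMod where
  carrier (α : G) : Type u
  [addCommGroup (α : G) : AddCommGroup (carrier α)]
  [module (α : G) : Module k (carrier α)]
  [finite (α : G) : Module.Finite k (carrier α)]
  /-- the action of `H_α` on `V_α` -/
  act (α : G) : H α →ₐ[k] Module.End k (carrier α)
  finite_support : {α : G | Nontrivial (carrier α)}.Finite

attribute [instance] HMod.addCommGroup HMod.module HMod.finite

/-- The (finite) set of degrees of an object. -/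
def HMod.support (V : HMod k H) : Finset G := V.finite_support.toFinset

/-- Morphisms: families of `H_α`-linear maps (there are no nonzero morphisms between modules in
different degrees). -/
def HMod.Hom (V W : HMod k H) : Submodule k (∀ α, V.carrier α →ₗ[k] W.carrier α) where
  carrier := {f | ∀ α x, f α ∘ₗ V.act α x = W.act α x ∘ₗ f α}
  add_mem' hf hg α x := by simp only [Pi.add_apply, LinearMap.add_comp, LinearMap.comp_add,
    hf α x, hg α x]
  zero_mem' α x := by simp
  smul_mem' c f hf α x := by
    simp only [Pi.smul_apply, LinearMap.smul_comp, LinearMap.comp_smul, hf α x]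

/-- Composition of morphisms. -/
def HMod.comp {U V W : HMod k H} (f : HMod.Hom V W) (f' : HMod.Hom U V) : HMod.Hom U W :=
  ⟨fun α => f.1 α ∘ₗ f'.1 α, fun α x => by
    rw [LinearMap.comp_assoc, f'.2 α x, ← LinearMap.comp_assoc, f.2 α x, LinearMap.comp_assoc]⟩

/-- Projective objects: all components are projective modules. -/
def HMod.IsProjective (V : HMod k H) : Prop := ∀ α, IsProjectiveAct (V.act α)

theorem HMod.subsingleton_tensor (V W : HMod k H) {α β : G}
    (h : ¬ (α ∈ V.support ∧ β ∈ W.support)) :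
    Subsingleton (V.carrier α ⊗[k] W.carrier β) := by
  rw [not_and_or] at h
  simp only [HMod.support, Set.Finite.mem_toFinset, Set.mem_ofPred_eq,
    not_nontrivial_iff_subsingleton] at h
  refine subsingleton_of_forall_eq 0 fun z => ?_
  induction z with
  | zero => rfl
  | add z z' hz hz' => rw [hz, hz', add_zero]
  | tmul v w =>
    rcases h with h | h
    · rw [Subsingleton.elim v 0, TensorProduct.zero_tmul]
    · rw [Subsingleton.elim w 0, TensorProduct.tmul_zero]

open Classical in
/-- The tensor product of objects, `(V ⊗ W)_γ = ⨁_{αβ = γ} V_α ⊗ W_β`. -/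
@[reducible] def HMod.tensor (V W : HMod k H) : HMod k H where
  carrier γ := ⨁ p : {p : G × G // p.1 * p.2 = γ}, V.carrier p.1.1 ⊗[k] W.carrier p.1.2
  finite γ := by
    let s : Set {p : G × G // p.1 * p.2 = γ} := {p | p.1 ∈ V.support ×ˢ W.support}
    have hs : s.Finite := (Finset.finite_toSet _).preimage Subtype.val_injective.injOn
    have := hs.to_subtype
    refine Module.Finite.of_injective (LinearMap.pi fun p : s =>
      DirectSum.component k _ (fun p : {p : G × G // p.1 * p.2 = γ} =>
        V.carrier p.1.1 ⊗[k] W.carrier p.1.2) p.1) fun x y hxy => ?_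
    refine DFinsupp.ext fun p => ?_
    by_cases hp : p ∈ s
    · exact congrFun hxy ⟨p, hp⟩
    · have := V.subsingleton_tensor W (fun h => hp (Finset.mem_product.2 h))
      exact Subsingleton.elim _ _
  act γ :=
    { toFun := fun x => DirectSum.lmap fun p => tensorAct p.2 (V.act p.1.1) (W.act p.1.2) x
      map_one' := by ext; simp
      map_mul' := fun x y => by ext; simp
      map_zero' := by ext; simp
      map_add' := fun x y => by ext; simp
      commutes' := fun c => by
        ext
        simp [Module.algebraMap_end_eq_smul_id, AlgHom.commutes] }
  finite_support := by
    refine ((V.support ×ˢ W.support).image fun p => p.1 * p.2).finite_toSet.subset fun γ hγ => ?_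
    by_contra hc
    refine not_subsingleton_iff_nontrivial.2 hγ ⟨fun x y => DFinsupp.ext fun p => ?_⟩
    have := V.subsingleton_tensor W (α := p.1.1) (β := p.1.2) fun h => hc (by
      rw [← p.2]
      exact Finset.mem_image_of_mem _ (Finset.mem_product.2 h))
    exact Subsingleton.elim _ _

open Classical in
theorem isProjectiveAct_directSum {A ι : Type u} [Ring A] [Algebra k A] {M : ι → Type u}
    [∀ i, AddCommGroup (M i)] [∀ i, Module k (M i)] (ρ : ∀ i, A →ₐ[k] Module.End k (M i))
    (σ : A →ₐ[k] Module.End k (⨁ i, M i)) (hσ : ∀ a, σ a = DirectSum.lmap fun i => ρ i a)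
    (h : ∀ i, IsProjectiveAct (ρ i)) : IsProjectiveAct σ := by
  let _ (i : ι) : Module A (M i) := Module.compHom (M i) (ρ i).toRingHom
  have (i : ι) : Module.Projective A (M i) := h i
  have : Module.Projective A (⨁ i, M i) := inferInstance
  have e : Module.compHom (⨁ i, M i) σ.toRingHom =
      (inferInstance : Module A (⨁ i, M i)) :=
    Module.ext' _ _ fun a x => DFinsupp.ext fun i => by
      change (σ a x) i = ρ i a (x i)
      rw [hσ]
      rfl
  change @Module.Projective A _ (⨁ i, M i) _ (Module.compHom (⨁ i, M i) σ.toRingHom)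
  rw [e]
  exact this

theorem HMod.IsProjective.tensor_right {P : HMod k H} (hP : P.IsProjective) (W : HMod k H) :
    (P.tensor W).IsProjective := fun γ =>
  isProjectiveAct_directSum (fun p : {p : G × G // p.1 * p.2 = γ} =>
    tensorAct p.2 (P.act p.1.1) (W.act p.1.2)) _ (fun _ => rfl)
    fun p => isProjectiveAct_tensor_right p.2 _ _ (hP _)

theorem HMod.IsProjective.tensor_left (g : Pivot k H) {P : HMod k H} (hP : P.IsProjective)
    (W : HMod k H) : (W.tensor P).IsProjective := fun γ =>
  isProjectiveAct_directSum (fun p : {p : G × G // p.1 * p.2 = γ} =>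
    tensorAct p.2 (W.act p.1.1) (P.act p.1.2)) _ (fun _ => rfl)
    fun p => g.isProjectiveAct_tensor_left p.2 _ _ (hP _)

open Classical in
/-- The component `U_α ⊗ W_β → V_α ⊗ X_β` of a morphism `U ⊗ W → V ⊗ X`. -/
def HMod.block {U V W X : HMod k H} (f : HMod.Hom (U.tensor W) (V.tensor X)) (α β : G) :
    U.carrier α ⊗[k] W.carrier β →ₗ[k] V.carrier α ⊗[k] X.carrier β :=
  DirectSum.component k {p : G × G // p.1 * p.2 = α * β}
      (fun p => V.carrier p.1.1 ⊗[k] X.carrier p.1.2) ⟨(α, β), rfl⟩ ∘ₗ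
    f.1 (α * β) ∘ₗ
    DirectSum.lof k {p : G × G // p.1 * p.2 = α * β}
      (fun p => U.carrier p.1.1 ⊗[k] W.carrier p.1.2) ⟨(α, β), rfl⟩

theorem HMod.block_equivariant {U V W X : HMod k H}
    (f : HMod.Hom (U.tensor W) (V.tensor X)) (α β : G) (x : H (α * β)) :
    HMod.block f α β ∘ₗ tensorAct rfl (U.act α) (W.act β) x =
      tensorAct rfl (V.act α) (X.act β) x ∘ₗ HMod.block f α β := by
  classical
  refine LinearMap.ext fun z => ?_
  have h := LinearMap.congr_fun (f.2 (α * β) x) (DirectSum.lof k {p : G × G // p.1 * p.2 = α * β}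
      (fun p => U.carrier p.1.1 ⊗[k] W.carrier p.1.2) ⟨(α, β), rfl⟩ z)
  have h' := congrArg (DirectSum.component k {p : G × G // p.1 * p.2 = α * β}
      (fun p => V.carrier p.1.1 ⊗[k] X.carrier p.1.2) ⟨(α, β), rfl⟩) h
  have e1 : (U.tensor W).act (α * β) x (DirectSum.lof k {p : G × G // p.1 * p.2 = α * β}
      (fun p => U.carrier p.1.1 ⊗[k] W.carrier p.1.2) ⟨(α, β), rfl⟩ z) =
      DirectSum.lof k {p : G × G // p.1 * p.2 = α * β}
      (fun p => U.carrier p.1.1 ⊗[k] W.carrier p.1.2) ⟨(α, β), rfl⟩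
        (tensorAct rfl (U.act α) (W.act β) x z) := by
    exact DirectSum.lmap_lof _ _ _
  rw [LinearMap.comp_apply, e1] at h'
  exact h'

/-- The right partial trace `tr_W^r : Hom(U ⊗ W, V ⊗ W) → Hom(U, V)`; in degree `α` it is the sum
over `β` of the partial traces of the components `U_α ⊗ W_β → V_α ⊗ W_β`. -/
def rightPartialTrace (g : Pivot k H) {U V W : HMod k H}
    (f : HMod.Hom (U.tensor W) (V.tensor W)) : HMod.Hom U V :=
  ⟨fun α => ∑ β ∈ W.support, rightPartialTraceLin (W.act β (g.val β)) (HMod.block f α β),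
    fun α x => by
      refine LinearMap.ext fun u => ?_
      simp only [LinearMap.comp_apply, LinearMap.sum_apply, map_sum]
      exact Finset.sum_congr rfl fun β _ => LinearMap.congr_fun (g.rightPartialTraceLin_equivariant rfl _ _ _ _
        (HMod.block_equivariant f α β) x) u⟩

/-- The left partial trace `tr_W^l : Hom(W ⊗ U, W ⊗ V) → Hom(U, V)`. -/
def leftPartialTrace (g : Pivot k H) {U V W : HMod k H}
    (f : HMod.Hom (W.tensor U) (W.tensor V)) : HMod.Hom U V :=
  ⟨fun α => ∑ β ∈ W.support, leftPartialTraceLin (W.act β (g.inv β)) (HMod.block f β α),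
    fun α x => by
      refine LinearMap.ext fun u => ?_
      simp only [LinearMap.comp_apply, LinearMap.sum_apply, map_sum]
      exact Finset.sum_congr rfl fun β _ => LinearMap.congr_fun (g.leftPartialTraceLin_equivariant rfl _ _ _ _
        (HMod.block_equivariant f β α) x) u⟩

/-! ### Modified traces -/

variable (k H) in
/-- The projective objects of `H`-mod. -/
abbrev PMod := {P : HMod k H // P.IsProjective}

variable (k H) in
/-- Families of linear forms `t_P : End(P) → k`, indexed by the projective objects. -/
abbrev TraceFamily := ∀ P : PMod k H, HMod.Hom P.1 P.1 →ₗ[k] k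

/-- Cyclicity: `t_V (f f') = t_U (f' f)` for `f : U → V` and `f' : V → U`. -/
def IsCyclicTrace (t : TraceFamily k H) : Prop :=
  ∀ (U V : PMod k H) (f : HMod.Hom U.1 V.1) (f' : HMod.Hom V.1 U.1),
    t V (HMod.comp f f') = t U (HMod.comp f' f)

/-- Right modified traces on `H`-pmod. -/
def IsRightModifiedTrace (g : Pivot k H) (t : TraceFamily k H) : Prop :=
  IsCyclicTrace t ∧ ∀ (P : PMod k H) (W : HMod k H)
    (f : HMod.Hom (P.1.tensor W) (P.1.tensor W)),
    t ⟨P.1.tensor W, P.2.tensor_right W⟩ f = t P (rightPartialTrace g f)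

/-- Left modified traces on `H`-pmod. -/
def IsLeftModifiedTrace (g : Pivot k H) (t : TraceFamily k H) : Prop :=
  IsCyclicTrace t ∧ ∀ (P : PMod k H) (W : HMod k H)
    (f : HMod.Hom (W.tensor P.1) (W.tensor P.1)),
    t ⟨W.tensor P.1, P.2.tensor_left g W⟩ f = t P (leftPartialTrace g f)

variable (k) in
/-- The left regular module `H_α`, an object concentrated in degree `α`: its component in degree
`β` consists of the functions from the proofs of `β = α` to `H β`, so it is `H α` for `β = α` and
zero otherwise. -/
@[reducible] def regular [∀ α, Module.Finite k (H α)] (α : G) : HMod k H where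
  carrier β := PLift (β = α) → H β
  act β :=
    { toFun := fun x => LinearMap.pi fun p => LinearMap.mulLeft k x ∘ₗ LinearMap.proj p
      map_one' := by ext; simp
      map_mul' := fun x y => by ext; simp
      map_zero' := by ext; simp
      map_add' := fun x y => by ext; simp [add_mul]
      commutes' := fun c => by ext; simp [Algebra.smul_def] }
  finite_support := (Set.finite_singleton α).subset fun β hβ => by
    by_contra h
    have : IsEmpty (PLift (β = α)) := ⟨fun p => h p.down⟩
    exact not_subsingleton_iff_nontrivial.2 hβ inferInstance

theorem isProjective_regular [∀ α, Module.Finite k (H α)] (α : G) :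
    (regular k (H := H) α).IsProjective := fun β => by
  have : Module.Projective (H β) (PLift (β = α) → H β) := inferInstance
  exact this

open Classical in
/-- Right multiplication `R_h`, `h ∈ H_α`, as an endomorphism of the regular module `H_α`. (The
family `Pi.single α h` has the component `h` in degree `α`.) It depends linearly on `h`. -/
def rightMul [∀ α, Module.Finite k (H α)] (α : G) :
    H α →ₗ[k] HMod.Hom (regular k (H := H) α) (regular k (H := H) α) where
  toFun h := ⟨fun β => LinearMap.pi fun p =>
      LinearMap.mulRight k ((Pi.single α h : ∀ β, H β) β) ∘ₗ LinearMap.proj p, fun β x => by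
    refine LinearMap.ext fun z => funext fun p => ?_
    exact mul_assoc _ _ _⟩
  map_add' h h' := by
    refine Subtype.ext (funext fun β => LinearMap.ext fun z => funext fun p => ?_)
    change z p * (Pi.single α (h + h') : ∀ β, H β) β =
      z p * (Pi.single α h : ∀ β, H β) β + z p * (Pi.single α h' : ∀ β, H β) β
    rw [Pi.single_add, Pi.add_apply, mul_add]
  map_smul' c h := by
    refine Subtype.ext (funext fun β => LinearMap.ext fun z => funext fun p => ?_)
    change z p * (Pi.single α (c • h) : ∀ β, H β) β = c • (z p * (Pi.single α h : ∀ β, H β) β)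
    rw [Pi.single_smul, Pi.smul_apply, mul_smul_comm]

/-- The family of linear forms `λ^t_α(h) = t_{H_α}(R_h)`. -/
def traceForm [∀ α, Module.Finite k (H α)] (t : TraceFamily k H) (α : G) : H α →ₗ[k] k :=
  t ⟨regular k α, isProjective_regular α⟩ ∘ₗ rightMul α

end

end HopfGCoalgebra

end

/-!
Modified traces and integrals are compared through the linear forms `l_α` on the algebras `H_α`.

**Cyclic traces are symmetric forms.** If `v = ∑ φᵢ(v) vᵢ` is a dual basis of a projective
`H_α`-module, an endomorphism `f` is the sum of the composites `(x ↦ x vᵢ) ∘ φᵢ ∘ f` through `H_α`,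
so a cyclic trace is `t(f) = ∑ λ^t_α(φᵢ(f vᵢ))` (`IsCyclicTrace.eq_formTrace`). Conversely, this
formula (`formTrace`) defines a cyclic trace with form `l` as soon as every `l_α` is symmetric
(`isCyclicTrace_formTrace`, `traceForm_formTrace`).

**The partial trace property is the integral equation.** In terms of the symmetrised form, the
equation of a right `G`-integral reads `l_α(x₁) g_β x₂ = l_{αβ}(x) 1`
(`isSymmetrisedRightIntegral_iff`). The map `a ↦ a₁ ⊗ S(a₂)` turns a dual basis of an `H_α`-module
`P` and a vector space basis of an `H_β`-module `W` into a dual basis of `P ⊗ W`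
(`DualBasis.tensor`). Applying `S` to the integral equation gives `l_{αβ}(a₁) S(a₂) = l_α(a) g_β`,
and with this the trace of an endomorphism of `P ⊗ W`, computed in that dual basis, is the trace of
its partial trace (`DualBasis.trace_tensor`, `isRightModifiedTrace_formTrace`). Conversely, the
partial trace property for the endomorphisms of `H_α ⊗ H_β` that factor through `H_{αβ}` is the
integral equation tested against the linear forms on `H_β` (`IsRightModifiedTrace.traceForm_eq`).

**Symmetrised integrals are symmetric.** This is where unimodularity enters. By
`μ(x₁ y) x₂ = μ(x y₁) S(y₂)` the radical of a nonzero right integral on `H_1` is a subcomodule, and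
therefore zero (`IsRightIntegral.eq_zero_of_mul`). So `ε = μ(- c)` for some `c`, which is a left
cointegral, hence also a right one. The same identity, used for `x = c` and for `y = c`, gives
`z = μ_α(z c₁) S(c₂)` and `S²(y) = μ_α(c₁ y) S(c₂)`, whence `μ_α(x y) = μ_α(S²(y) x)`
(`IsRightIntegral.mul_comm_antipode`), and `S²` is the conjugation by the pivot.

The left versions are the mirror images, with `S⁻¹ = g⁻¹ S g` in the place of `S`. The statement on
unibalanced pivots follows since a cyclic trace is determined by its form.
-/

noncomputable section

namespace HopfGCoalgebra

/-! ### Nondegeneracy of integrals -/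

section Integrals

variable {k G : Type u} [Field k] [Group G] {H : G → Type u}
  [∀ α, Ring (H α)] [∀ α, Algebra k (H α)] [HopfGCoalgebra k H]

theorem lid_rTensor_mul_one_tmul {A B : Type u} [Ring A] [Ring B] [Algebra k A] [Algebra k B]
    (f : A →ₗ[k] k) (z : A ⊗[k] B) (b : B) :
    TensorProduct.lid k B (f.rTensor B (z * (1 ⊗ₜ b))) =
      TensorProduct.lid k B (f.rTensor B z) * b := by
  induction z with
  | zero => simp
  | add z z' hz hz' => simp only [add_mul, map_add, hz, hz']
  | tmul c d => simp

/-- `μ(x₁ y) x₂ = μ(x y₁) S(y₂)` for a right integral `μ`. -/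
theorem IsRightIntegral.apply_comul_mul {μ : ∀ α, H α →ₗ[k] k} (hμ : IsRightIntegral μ)
    {α β β' γ : G} (h : α * β = γ) (h' : γ * β' = α) (hβ : β * β' = 1) (hβ' : β' * β = 1)
    (x : H γ) (y : H α) :
    TensorProduct.lid k (H β) ((μ α).rTensor (H β) (comul h x * (y ⊗ₜ 1))) =
      TensorProduct.lid k (H β) (TensorProduct.map (μ γ ∘ₗ LinearMap.mulLeft k x)
        (antipode (k := k) hβ') (comul h' y)) := by
  rw [← comul_mul_antipode h h' hβ hβ' y]
  generalize comul (k := k) h' y = w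
  induction w with
  | zero => simp only [map_zero, mul_zero]
  | add z z' hz hz' => simp only [mul_add, map_add, hz, hz']
  | tmul a b =>
    simp only [TensorProduct.map_tmul, LinearMap.mul'_apply, AlgHom.toLinearMap_apply,
      LinearMap.comp_apply, TensorProduct.mk_apply, ← mul_assoc, ← map_mul,
      lid_rTensor_mul_one_tmul, hμ h, TensorProduct.lid_tmul, LinearMap.mulLeft_apply,
      smul_mul_assoc, one_mul]

/-- A nonzero right integral on `H₁` is a nondegenerate form: by `apply_comul_mul` its radical `N`
satisfies `Δ(N) ⊆ N ⊗ H₁`, and `ε(y) g = S(y₂) g y₁` lies in the left ideal `N` for `y ∈ N`. -/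
theorem IsRightIntegral.eq_zero_of_mul (g : Pivot k H) {μ : ∀ α, H α →ₗ[k] k}
    (hμ : IsRightIntegral μ) (h0 : μ 1 ≠ 0) {y : H 1} (hy : ∀ x, μ 1 (x * y) = 0) : y = 0 := by
  have h1 : (1 : G) * 1 = 1 := one_mul 1
  let e := Module.Basis.ofVectorSpace k (H 1)
  -- The left legs of `Δ(y)` along a basis of the right leg lie in the radical again.
  have hΔ : ∀ {y : H 1}, (∀ x, μ 1 (x * y) = 0) →
      ∀ {c : _ →₀ H 1}, (c.sum fun i a => a ⊗ₜ[k] e i) = comul h1 y →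
      ∀ i x, μ 1 (x * c i) = 0 := by
    intro y hy c hc i x
    have hx := hμ.apply_comul_mul h1 h1 h1 h1 x y
    have hr : TensorProduct.lid k (H 1) ((μ 1).rTensor (H 1) (comul h1 x * (y ⊗ₜ 1))) = 0 := by
      generalize comul (k := k) h1 x = z
      induction z with
      | zero => simp
      | add z z' hz hz' => simp only [add_mul, map_add, hz, hz', add_zero]
      | tmul a b => simp [hy]
    rw [hr, ← hc] at hx
    have hx' : antipode (k := k) h1 (c.sum fun i a => μ 1 (x * a) • e i) =
        antipode (k := k) h1 0 := by
      rw [map_zero, hx]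
      simp [Finsupp.sum, map_sum]
    rcases eq_or_ne (c i) 0 with hi | hi
    · simp [hi]
    have := congrArg (fun z => e.repr z i) (g.antipode_injective h1 h1 hx')
    classical
    simpa [hi, Finsupp.sum, map_sum, Finsupp.single_apply] using this
  -- `ε(y) g = S(y₂) g y₁` lies in the radical; as `g` is invertible and `μ ≠ 0`, `ε(y) = 0`.
  have hε : ∀ {y : H 1}, (∀ x, μ 1 (x * y) = 0) → counit (k := k) y = 0 := by
    intro y hy
    obtain ⟨c, hc⟩ := TensorProduct.eq_repr_basis_right e (comul (k := k) h1 y)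
    by_contra hne
    refine h0 (LinearMap.ext fun x => ?_)
    have hg := congrArg (fun z => μ 1 (x * g.inv 1 * z)) (g.antipode_val_mul h1 h1 y)
    rw [← hc] at hg
    have hz : counit (k := k) y * μ 1 x = 0 := by
      simp only [mul_smul_comm, mul_assoc, g.inv_mul, mul_one, map_smul, smul_eq_mul] at hg
      rw [← hg]
      simp only [Finsupp.sum, map_sum, TensorProduct.comm_tmul, TensorProduct.map_tmul,
        LinearMap.mul'_apply, LinearMap.mulLeft_apply, Finset.mul_sum]
      refine Finset.sum_eq_zero fun i _ => ?_
      simp only [← mul_assoc]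
      exact hΔ hy hc i _
    exact (mul_eq_zero.1 hz).resolve_left hne
  obtain ⟨c, hc⟩ := TensorProduct.eq_repr_basis_right e (comul (k := k) h1 y)
  rw [← counit_left (k := k) 1 y, ← hc]
  simp only [Finsupp.sum, map_sum, LinearMap.rTensor_tmul, TensorProduct.lid_tmul,
    AlgHom.toLinearMap_apply]
  exact Finset.sum_eq_zero fun i _ => by rw [hε (hΔ hy hc i), zero_smul]

theorem exists_forall_eq_mul_right_apply {A : Type u} [Ring A] [Algebra k A] [Module.Finite k A]
    {m : A →ₗ[k] k} (hm : ∀ y, (∀ x, m (x * y) = 0) → y = 0) (f : A →ₗ[k] k) :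
    ∃ z, ∀ x, f x = m (x * z) := by
  let T : A →ₗ[k] Module.Dual k A := (LinearMap.mul k A).flip.compr₂ m
  have hT : Function.Injective T := (injective_iff_map_eq_zero T).2 fun y hy =>
    hm y fun x => LinearMap.congr_fun hy x
  obtain ⟨z, hz⟩ := (LinearMap.injective_iff_surjective_of_finrank_eq_finrank
    Subspace.dual_finrank_eq.symm).1 hT f
  exact ⟨z, fun x => (LinearMap.congr_fun hz x).symm⟩

theorem exists_forall_eq_mul_left_apply {A : Type u} [Ring A] [Algebra k A] [Module.Finite k A]
    {m : A →ₗ[k] k} (hm : ∀ y, (∀ x, m (y * x) = 0) → y = 0) (f : A →ₗ[k] k) :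
    ∃ z, ∀ x, f x = m (z * x) := by
  let T : A →ₗ[k] Module.Dual k A := (LinearMap.mul k A).compr₂ m
  have hT : Function.Injective T := (injective_iff_map_eq_zero T).2 fun y hy =>
    hm y fun x => LinearMap.congr_fun hy x
  obtain ⟨z, hz⟩ := (LinearMap.injective_iff_surjective_of_finrank_eq_finrank
    Subspace.dual_finrank_eq.symm).1 hT f
  exact ⟨z, fun x => (LinearMap.congr_fun hz x).symm⟩

theorem IsRightIntegral.eq_zero {μ : ∀ α, H α →ₗ[k] k} (hμ : IsRightIntegral μ)
    (h0 : μ 1 = 0) (α : G) : μ α = 0 := by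
  refine LinearMap.ext fun x => ?_
  have hx := hμ (one_mul α) x
  rw [h0, LinearMap.rTensor_zero, LinearMap.zero_apply, map_zero] at hx
  rcases smul_eq_zero.1 hx.symm with h | h
  · exact h
  · rw [← one_mul x, h, zero_mul, map_zero]; rfl

/-- On a unimodular Hopf `G`-coalgebra the Nakayama automorphism of a right integral is `S²`. -/
theorem IsRightIntegral.mul_comm_antipode [∀ α, Module.Finite k (H α)] (g : Pivot k H)
    (hH : IsUnimodular k H) {μ : ∀ α, H α →ₗ[k] k} (hμ : IsRightIntegral μ) {α β : G}
    (h : α * β = 1) (h' : β * α = 1) (x y : H α) :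
    μ α (x * y) = μ α (antipode (k := k) h' (antipode (k := k) h y) * x) := by
  by_cases h0 : μ 1 = 0
  · simp [hμ.eq_zero h0 α]
  -- The element `c` representing `ε` is a left cointegral.
  obtain ⟨c, hc⟩ := exists_forall_eq_mul_right_apply (fun _ hy => hμ.eq_zero_of_mul g h0 hy)
    (counit (k := k) (H := H)).toLinearMap
  have hc1 : μ 1 c = 1 := by have := hc 1; simpa using this.symm
  have hl (x : H 1) : x * c = counit (k := k) x • c :=
    sub_eq_zero.1 <| hμ.eq_zero_of_mul g h0 fun y => by
      have h1 := hc (y * x)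
      have h2 := hc y
      simp only [AlgHom.toLinearMap_apply, map_mul] at h1 h2
      rw [mul_sub, map_sub, ← mul_assoc, ← h1, mul_smul_comm, map_smul, ← h2, smul_eq_mul, mul_comm,
        sub_self]
  have hr := (hH c).1 hl
  -- `z = μ(z c₁) S(c₂)`
  have hz (z : H α) : TensorProduct.lid k (H α) (TensorProduct.map (μ α ∘ₗ LinearMap.mulLeft k z)
      (antipode (k := k) h') (comul h c)) = z := by
    rw [← hμ.apply_comul_mul (one_mul α) h h h' z c]
    conv_rhs => rw [← counit_left (k := k) α z]
    generalize comul (k := k) (one_mul α) z = w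
    induction w with
    | zero => simp
    | add z z' hz hz' => simp only [add_mul, map_add, hz, hz']
    | tmul a b => simp [hl, hc1]
  -- `S²(y) = μ(c₁ y) S(c₂)`
  have hS : TensorProduct.lid k (H α) (TensorProduct.map (μ α ∘ₗ LinearMap.mulRight k y)
      (antipode (k := k) h') (comul h c)) = antipode (k := k) h' (antipode (k := k) h y) := by
    have hy := hμ.apply_comul_mul h (one_mul α) h' h c y
    have e1 : TensorProduct.lid k (H β) (TensorProduct.map (μ 1 ∘ₗ LinearMap.mulLeft k c)
        (antipode (k := k) h) (comul (one_mul α) y)) = antipode (k := k) h y := by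
      conv_rhs => rw [← counit_left (k := k) α y]
      generalize comul (k := k) (one_mul α) y = w
      induction w with
      | zero => simp
      | add z z' hz hz' => simp only [map_add, hz, hz']
      | tmul a b => simp [hr, hc1]
    rw [← e1, ← hy]
    generalize comul (k := k) h c = w
    induction w with
    | zero => simp
    | add z z' hz hz' => simp only [add_mul, map_add, hz, hz']
    | tmul a b => simp
  -- By `hz` the form `μ_α` is nondegenerate, so `μ(- y) = μ(z -)` for some `z`, and then
  -- `z = μ(z c₁) S(c₂) = μ(c₁ y) S(c₂) = S²(y)`.
  have hnd (z : H α) (hz0 : ∀ x, μ α (z * x) = 0) : z = 0 := by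
    have : μ α ∘ₗ LinearMap.mulLeft k z = 0 := LinearMap.ext hz0
    rw [← hz z, this, TensorProduct.map_zero_left, LinearMap.zero_apply, map_zero]
  obtain ⟨z, hzy⟩ := exists_forall_eq_mul_left_apply hnd (μ α ∘ₗ LinearMap.mulRight k y)
  have : μ α ∘ₗ LinearMap.mulRight k y = μ α ∘ₗ LinearMap.mulLeft k z := LinearMap.ext hzy
  rw [← hS, this, hz]
  exact hzy x

theorem IsSymmetrisedRightIntegral.mul_comm [∀ α, Module.Finite k (H α)] {g : Pivot k H}
    (hH : IsUnimodular k H) {l : ∀ α, H α →ₗ[k] k} (hl : IsSymmetrisedRightIntegral g l)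
    (α : G) (x y : H α) : l α (x * y) = l α (y * x) := by
  obtain ⟨μ, hμ, hl⟩ := hl
  rw [hl, hl, ← mul_assoc,
    hμ.mul_comm_antipode g hH (mul_inv_cancel α) (inv_mul_cancel α), ← mul_assoc,
    g.antipode_antipode_mul_val, mul_assoc]

theorem rid_lTensor_tmul_one_mul {A B : Type u} [Ring A] [Ring B] [Algebra k A] [Algebra k B]
    (f : B →ₗ[k] k) (z : A ⊗[k] B) (a : A) :
    TensorProduct.rid k A (f.lTensor A ((a ⊗ₜ 1) * z)) =
      a * TensorProduct.rid k A (f.lTensor A z) := by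
  induction z with
  | zero => simp
  | add z z' hz hz' => simp only [mul_add, map_add, hz, hz']
  | tmul c d => simp

/-- `x₁ μ(y x₂) = S(y₁) μ(y₂ x)` for a left integral `μ`. -/
theorem IsLeftIntegral.apply_mul_comul (g : Pivot k H) {μ : ∀ α, H α →ₗ[k] k}
    (hμ : IsLeftIntegral μ) {α β β' γ : G} (h : β * α = γ) (h' : β' * γ = α) (hβ : β' * β = 1)
    (x : H γ) (y : H α) :
    TensorProduct.rid k (H β) ((μ α).lTensor (H β) ((1 ⊗ₜ y) * comul h x)) =
      TensorProduct.rid k (H β) (TensorProduct.map (antipode (k := k) hβ)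
        (μ γ ∘ₗ LinearMap.mulRight k x) (comul h' y)) := by
  have e : (1 : H β) ⊗ₜ[k] y = (g.val β ⊗ₜ 1) * (g.inv β ⊗ₜ y) := by simp [g.mul_inv]
  rw [e, ← g.inv_antipode_mul_comul h h' hβ y]
  generalize comul (k := k) h' y = w
  induction w with
  | zero => simp only [map_zero, mul_zero, zero_mul]
  | add z z' hz hz' => simp only [mul_add, add_mul, map_add, hz, hz']
  | tmul a b =>
    simp only [TensorProduct.map_tmul, LinearMap.mul'_apply, AlgHom.toLinearMap_apply,
      LinearMap.comp_apply, TensorProduct.mk_apply, LinearMap.flip_apply, mul_assoc, ← map_mul,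
      rid_lTensor_tmul_one_mul, hμ h, TensorProduct.rid_tmul, LinearMap.mulLeft_apply,
      LinearMap.mulRight_apply, mul_smul_comm, mul_one]
    rw [← mul_assoc, g.mul_inv, one_mul]

/-- A nonzero left integral on `H₁` is a nondegenerate form; here `ε(y) g⁻¹ = y₂ g⁻¹ S(y₁)`. -/
theorem IsLeftIntegral.eq_zero_of_mul (g : Pivot k H) {μ : ∀ α, H α →ₗ[k] k}
    (hμ : IsLeftIntegral μ) (h0 : μ 1 ≠ 0) {y : H 1} (hy : ∀ x, μ 1 (y * x) = 0) : y = 0 := by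
  have h1 : (1 : G) * 1 = 1 := one_mul 1
  let e := Module.Basis.ofVectorSpace k (H 1)
  have hΔ : ∀ {y : H 1}, (∀ x, μ 1 (y * x) = 0) →
      ∀ {c : _ →₀ H 1}, (c.sum fun i a => e i ⊗ₜ[k] a) = comul h1 y →
      ∀ i x, μ 1 (c i * x) = 0 := by
    intro y hy c hc i x
    have hx := hμ.apply_mul_comul g h1 h1 h1 x y
    have hr : TensorProduct.rid k (H 1) ((μ 1).lTensor (H 1) ((1 ⊗ₜ y) * comul h1 x)) = 0 := by
      generalize comul (k := k) h1 x = z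
      induction z with
      | zero => simp
      | add z z' hz hz' => simp only [mul_add, map_add, hz, hz', add_zero]
      | tmul a b => simp [hy]
    rw [hr, ← hc] at hx
    have hx' : antipode (k := k) h1 (c.sum fun i a => μ 1 (a * x) • e i) =
        antipode (k := k) h1 0 := by
      rw [map_zero, hx]
      simp [Finsupp.sum, map_sum]
    rcases eq_or_ne (c i) 0 with hi | hi
    · simp [hi]
    have := congrArg (fun z => e.repr z i) (g.antipode_injective h1 h1 hx')
    classical
    simpa [hi, Finsupp.sum, map_sum, Finsupp.single_apply] using this
  have hε : ∀ {y : H 1}, (∀ x, μ 1 (y * x) = 0) → counit (k := k) y = 0 := by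
    intro y hy
    obtain ⟨c, hc⟩ := TensorProduct.eq_repr_basis_left e (comul (k := k) h1 y)
    by_contra hne
    refine h0 (LinearMap.ext fun x => ?_)
    have hg := congrArg (fun z => μ 1 (z * (g.val 1 * x))) (g.mul_inv_antipode h1 h1 y)
    rw [← hc] at hg
    have hz : counit (k := k) y * μ 1 x = 0 := by
      simp only [smul_mul_assoc, ← mul_assoc, g.inv_mul, one_mul, map_smul, smul_eq_mul] at hg
      rw [← hg]
      simp only [Finsupp.sum, map_sum, TensorProduct.comm_tmul, TensorProduct.map_tmul,
        LinearMap.mul'_apply, LinearMap.comp_apply, LinearMap.mulLeft_apply, Finset.sum_mul,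
        LinearMap.id_apply]
      refine Finset.sum_eq_zero fun i _ => ?_
      simp only [mul_assoc]
      exact hΔ hy hc i _
    exact (mul_eq_zero.1 hz).resolve_left hne
  obtain ⟨c, hc⟩ := TensorProduct.eq_repr_basis_left e (comul (k := k) h1 y)
  rw [← counit_right (k := k) 1 y, ← hc]
  simp only [Finsupp.sum, map_sum, LinearMap.lTensor_tmul, TensorProduct.rid_tmul,
    AlgHom.toLinearMap_apply]
  exact Finset.sum_eq_zero fun i _ => by rw [hε (hΔ hy hc i), zero_smul]

theorem IsLeftIntegral.eq_zero {μ : ∀ α, H α →ₗ[k] k} (hμ : IsLeftIntegral μ)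
    (h0 : μ 1 = 0) (α : G) : μ α = 0 := by
  refine LinearMap.ext fun x => ?_
  have hx := hμ (mul_one α) x
  rw [h0, LinearMap.lTensor_zero, LinearMap.zero_apply, map_zero] at hx
  rcases smul_eq_zero.1 hx.symm with h | h
  · exact h
  · rw [← one_mul x, h, zero_mul, map_zero]; rfl

/-- On a unimodular Hopf `G`-coalgebra the Nakayama automorphism of a left integral is `S⁻²`. -/
theorem IsLeftIntegral.mul_comm_antipode [∀ α, Module.Finite k (H α)] (g : Pivot k H)
    (hH : IsUnimodular k H) {μ : ∀ α, H α →ₗ[k] k} (hμ : IsLeftIntegral μ) {α β : G}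
    (h : α * β = 1) (h' : β * α = 1) (x y : H α) :
    μ α (y * x) = μ α (x * antipode (k := k) h' (antipode (k := k) h y)) := by
  by_cases h0 : μ 1 = 0
  · simp [hμ.eq_zero h0 α]
  -- The element `c` representing `ε` is a right cointegral.
  obtain ⟨c, hc⟩ := exists_forall_eq_mul_left_apply (fun _ hy => hμ.eq_zero_of_mul g h0 hy)
    (counit (k := k) (H := H)).toLinearMap
  have hc1 : μ 1 c = 1 := by have := hc 1; simpa using this.symm
  have hr (x : H 1) : c * x = counit (k := k) x • c :=
    sub_eq_zero.1 <| hμ.eq_zero_of_mul g h0 fun y => by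
      have h1 := hc (x * y)
      have h2 := hc y
      simp only [AlgHom.toLinearMap_apply, map_mul] at h1 h2
      rw [sub_mul, map_sub, mul_assoc, ← h1, smul_mul_assoc, map_smul, ← h2, smul_eq_mul, sub_self]
  have hl := (hH c).2 hr
  -- `z = S(c₁) μ(c₂ z)`
  have hz (z : H α) : TensorProduct.rid k (H α) (TensorProduct.map (antipode (k := k) h')
      (μ α ∘ₗ LinearMap.mulRight k z) (comul h' c)) = z := by
    rw [← hμ.apply_mul_comul g (mul_one α) h' h' z c]
    conv_rhs => rw [← counit_right (k := k) α z]
    generalize comul (k := k) (mul_one α) z = w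
    induction w with
    | zero => simp
    | add z z' hz hz' => simp only [mul_add, map_add, hz, hz']
    | tmul a b => simp [hr, hc1]
  -- `S²(y) = S(c₁) μ(y c₂)`
  have hS : TensorProduct.rid k (H α) (TensorProduct.map (antipode (k := k) h')
      (μ α ∘ₗ LinearMap.mulLeft k y) (comul h' c)) =
      antipode (k := k) h' (antipode (k := k) h y) := by
    have hy := hμ.apply_mul_comul g h' (mul_one α) h c y
    have e1 : TensorProduct.rid k (H β) (TensorProduct.map (antipode (k := k) h)
        (μ 1 ∘ₗ LinearMap.mulRight k c) (comul (mul_one α) y)) = antipode (k := k) h y := by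
      conv_rhs => rw [← counit_right (k := k) α y]
      generalize comul (k := k) (mul_one α) y = w
      induction w with
      | zero => simp
      | add z z' hz hz' => simp only [map_add, hz, hz']
      | tmul a b => simp [hl, hc1]
    rw [← e1, ← hy]
    generalize comul (k := k) h' c = w
    induction w with
    | zero => simp
    | add z z' hz hz' => simp only [mul_add, map_add, hz, hz']
    | tmul a b => simp
  have hnd (z : H α) (hz0 : ∀ x, μ α (x * z) = 0) : z = 0 := by
    have : μ α ∘ₗ LinearMap.mulRight k z = 0 := LinearMap.ext hz0
    rw [← hz z, this, TensorProduct.map_zero_right, LinearMap.zero_apply, map_zero]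
  obtain ⟨z, hzy⟩ := exists_forall_eq_mul_right_apply hnd (μ α ∘ₗ LinearMap.mulLeft k y)
  have : μ α ∘ₗ LinearMap.mulLeft k y = μ α ∘ₗ LinearMap.mulRight k z := LinearMap.ext hzy
  rw [← hS, this, hz]
  exact hzy x

theorem IsSymmetrisedLeftIntegral.mul_comm [∀ α, Module.Finite k (H α)] {g : Pivot k H}
    (hH : IsUnimodular k H) {l : ∀ α, H α →ₗ[k] k} (hl : IsSymmetrisedLeftIntegral g l)
    (α : G) (x y : H α) : l α (x * y) = l α (y * x) := by
  obtain ⟨μ, hμ, hl⟩ := hl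
  have key (x y : H α) : μ α (y * x) = μ α (x * (g.val α * y * g.inv α)) := by
    rw [hμ.mul_comm_antipode g hH (mul_inv_cancel α) (inv_mul_cancel α), g.antipode_antipode,
      g.antipode_val]
  rw [hl, hl, ← mul_assoc, key, key (y * x)]
  simp only [mul_assoc]
  rw [← mul_assoc (g.val α), ← mul_assoc (g.val α), g.mul_inv, one_mul, one_mul]

end Integrals

/-! ### Dual bases and the trace attached to a linear form -/

section DualBasis

variable {k : Type u} [Field k]

/-- A finite dual basis of the module given by `ρ : A → End(V)`: vectors `vᵢ` and `A`-linear maps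
`φᵢ : V → A` with `v = ∑ φᵢ(v) vᵢ`. -/
structure DualBasis {A V : Type u} [Ring A] [Algebra k A] [AddCommGroup V] [Module k V]
    (ρ : A →ₐ[k] Module.End k V) (ι : Type*) [Fintype ι] where
  vec : ι → V
  coord : ι → V →ₗ[k] A
  coord_act (i : ι) (a : A) (v : V) : coord i (ρ a v) = a * coord i v
  sum_coord (v : V) : ∑ i, ρ (coord i v) (vec i) = v

variable {A V W : Type u} [Ring A] [Algebra k A] [AddCommGroup V] [Module k V]
  [AddCommGroup W] [Module k W] {ρ : A →ₐ[k] Module.End k V} {σ : A →ₐ[k] Module.End k W}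

/-- The Hattori–Stallings trace `F ↦ ∑ l(φᵢ(F vᵢ))` composed with a linear form `l` on `A`. -/
def DualBasis.trace {ι : Type*} [Fintype ι] (B : DualBasis ρ ι) (l : A →ₗ[k] k) :
    Module.End k V →ₗ[k] k where
  toFun F := ∑ i, l (B.coord i (F (B.vec i)))
  map_add' F F' := by simp [Finset.sum_add_distrib]
  map_smul' c F := by simp [Finset.mul_sum]

theorem DualBasis.trace_apply {ι : Type*} [Fintype ι] (B : DualBasis ρ ι) (l : A →ₗ[k] k)
    (F : Module.End k V) : B.trace l F = ∑ i, l (B.coord i (F (B.vec i))) := rfl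

theorem DualBasis.trace_comp_comm {ι κ : Type*} [Fintype ι] [Fintype κ] (B : DualBasis ρ ι)
    (C : DualBasis σ κ) {l : A →ₗ[k] k} (hl : ∀ x y, l (x * y) = l (y * x))
    (f : V →ₗ[k] W) (f' : W →ₗ[k] V) (hf : ∀ a, f ∘ₗ ρ a = σ a ∘ₗ f)
    (hf' : ∀ a, f' ∘ₗ σ a = ρ a ∘ₗ f') : C.trace l (f ∘ₗ f') = B.trace l (f' ∘ₗ f) := by
  have h1 (j : κ) : l (C.coord j (f (f' (C.vec j)))) =
      ∑ i, l (B.coord i (f' (C.vec j)) * C.coord j (f (B.vec i))) := by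
    conv_lhs => rw [← B.sum_coord (f' (C.vec j))]
    simp only [map_sum]
    refine Finset.sum_congr rfl fun i _ => ?_
    rw [← C.coord_act]
    exact congrArg (fun z => l (C.coord j z)) (LinearMap.congr_fun (hf _) _)
  have h2 (i : ι) : l (B.coord i (f' (f (B.vec i)))) =
      ∑ j, l (C.coord j (f (B.vec i)) * B.coord i (f' (C.vec j))) := by
    conv_lhs => rw [← C.sum_coord (f (B.vec i))]
    simp only [map_sum]
    refine Finset.sum_congr rfl fun j _ => ?_
    rw [← B.coord_act]
    exact congrArg (fun z => l (B.coord i z)) (LinearMap.congr_fun (hf' _) _)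
  simp only [DualBasis.trace_apply, LinearMap.comp_apply, h1, h2]
  rw [Finset.sum_comm]
  exact Finset.sum_congr rfl fun i _ => Finset.sum_congr rfl fun j _ => hl _ _

theorem nonempty_dualBasis [Module.Finite k V] (h : IsProjectiveAct ρ) :
    Nonempty (DualBasis ρ (Fin (Module.finrank k V))) := by
  obtain ⟨s, hs, hs'⟩ := (isProjectiveAct_iff ρ).1 h
  let b := Module.finBasis k V
  have h1 (i) (a : A) (z : A ⊗[k] V) : TensorProduct.rid k A ((b.coord i).lTensor A
      ((LinearMap.mulLeft k a).rTensor V z)) =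
      a * TensorProduct.rid k A ((b.coord i).lTensor A z) := by
    induction z with
    | zero => simp
    | add z z' hz hz' => simp only [mul_add, map_add, hz, hz']
    | tmul c d => simp
  have h2 (z : A ⊗[k] V) : ∑ i, ρ (TensorProduct.rid k A ((b.coord i).lTensor A z)) (b i) =
      TensorProduct.lift ρ.toLinearMap z := by
    induction z with
    | zero => simp
    | add z z' hz hz' => simp only [map_add, LinearMap.add_apply, Finset.sum_add_distrib, hz, hz']
    | tmul c d =>
      simp only [LinearMap.lTensor_tmul, TensorProduct.rid_tmul, map_smul, LinearMap.smul_apply,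
        TensorProduct.lift.tmul, AlgHom.toLinearMap_apply]
      have hd := congrArg (ρ c) (b.sum_repr d)
      simp only [map_sum, map_smul] at hd
      exact hd
  exact ⟨{ vec := b
           coord := fun i =>
            (TensorProduct.rid k A).toLinearMap ∘ₗ (b.coord i).lTensor A ∘ₗ s
           coord_act := fun i a v => by simp only [LinearMap.comp_apply, hs]; exact h1 i a _
           sum_coord := fun v => (h2 _).trans (hs' v) }⟩

/-- The trace on the endomorphisms of a finite-dimensional projective module attached to a linear
form `l` on the algebra, computed by some dual basis; it does not depend on it if `l` is symmetric
(`projTrace_eq`). -/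
def projTrace [Module.Finite k V] (l : A →ₗ[k] k) (h : IsProjectiveAct ρ) :
    Module.End k V →ₗ[k] k :=
  (nonempty_dualBasis h).some.trace l

theorem projTrace_eq [Module.Finite k V] {l : A →ₗ[k] k} (hl : ∀ x y, l (x * y) = l (y * x))
    (h : IsProjectiveAct ρ) {ι : Type*} [Fintype ι] (B : DualBasis ρ ι) (F : Module.End k V)
    (hF : ∀ a, F ∘ₗ ρ a = ρ a ∘ₗ F) : projTrace l h F = B.trace l F :=
  B.trace_comp_comm (nonempty_dualBasis h).some hl F LinearMap.id hF fun _ => rfl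

theorem projTrace_comp_comm [Module.Finite k V] [Module.Finite k W] {l : A →ₗ[k] k}
    (hl : ∀ x y, l (x * y) = l (y * x)) (h : IsProjectiveAct ρ) (h' : IsProjectiveAct σ)
    (f : V →ₗ[k] W) (f' : W →ₗ[k] V) (hf : ∀ a, f ∘ₗ ρ a = σ a ∘ₗ f)
    (hf' : ∀ a, f' ∘ₗ σ a = ρ a ∘ₗ f') : projTrace l h' (f ∘ₗ f') = projTrace l h (f' ∘ₗ f) :=
  DualBasis.trace_comp_comm _ _ hl f f' hf hf'

/-- If a module is a direct sum, the trace of an endomorphism is the sum of the traces of its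
diagonal blocks. -/
theorem projTrace_eq_sum [Module.Finite k V] {l : A →ₗ[k] k} (hl : ∀ x y, l (x * y) = l (y * x))
    (h : IsProjectiveAct ρ) {ι : Type*} {M : ι → Type u} [∀ i, AddCommGroup (M i)]
    [∀ i, Module k (M i)] [∀ i, Module.Finite k (M i)] {τ : ∀ i, A →ₐ[k] Module.End k (M i)}
    (hτ : ∀ i, IsProjectiveAct (τ i)) {S : Finset ι} {incl : ∀ i, M i →ₗ[k] V}
    {proj : ∀ i, V →ₗ[k] M i} (hincl : ∀ i a, incl i ∘ₗ τ i a = ρ a ∘ₗ incl i)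
    (hproj : ∀ i a, proj i ∘ₗ ρ a = τ i a ∘ₗ proj i)
    (hS : ∑ i ∈ S, incl i ∘ₗ proj i = LinearMap.id) (F : Module.End k V)
    (hF : ∀ a, F ∘ₗ ρ a = ρ a ∘ₗ F) :
    projTrace l h F = ∑ i ∈ S, projTrace l (hτ i) (proj i ∘ₗ F ∘ₗ incl i) := by
  have hf : F = ∑ i ∈ S, incl i ∘ₗ (proj i ∘ₗ F) := by
    refine LinearMap.ext fun v => ?_
    have := LinearMap.congr_fun hS (F v)
    simp only [LinearMap.sum_apply] at this ⊢
    exact this.symm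
  conv_lhs => rw [hf, map_sum]
  refine Finset.sum_congr rfl fun i _ => ?_
  refine projTrace_comp_comm hl (hτ i) h (incl i) (proj i ∘ₗ F) (hincl i) fun a => ?_
  rw [LinearMap.comp_assoc, hF, ← LinearMap.comp_assoc, hproj, LinearMap.comp_assoc]

end DualBasis

/-! ### Cyclic traces and symmetric forms -/

section CyclicTrace

variable {k G : Type u} [Field k] [Group G] {H : G → Type u}
  [∀ α, Ring (H α)] [∀ α, Algebra k (H α)] [HopfGCoalgebra k H]

/-- The family of linear forms on endomorphisms of projective objects attached to a family of linear
forms on the algebras `H_α`: the sum over the degrees of the traces `projTrace`. -/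
def formTrace (l : ∀ α, H α →ₗ[k] k) : TraceFamily k H := fun P =>
  ∑ α ∈ P.1.support, projTrace (l α) (P.2 α) ∘ₗ LinearMap.proj α ∘ₗ (HMod.Hom P.1 P.1).subtype

theorem HMod.subsingleton_of_notMem_support {V : HMod k H} {α : G} (h : α ∉ V.support) :
    Subsingleton (V.carrier α) := by
  simpa [HMod.support, not_nontrivial_iff_subsingleton] using h

theorem formTrace_apply {l : ∀ α, H α →ₗ[k] k} {P : PMod k H} {T : Finset G}
    (hT : P.1.support ⊆ T) (f : HMod.Hom P.1 P.1) :
    formTrace l P f = ∑ α ∈ T, projTrace (l α) (P.2 α) (f.1 α) := by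
  have : formTrace l P f = ∑ α ∈ P.1.support, projTrace (l α) (P.2 α) (f.1 α) := by
    simp [formTrace]
  rw [this]
  refine Finset.sum_subset hT fun α _ hα => ?_
  have := HMod.subsingleton_of_notMem_support hα
  rw [Subsingleton.elim (f.1 α) 0, map_zero]

theorem isCyclicTrace_formTrace {l : ∀ α, H α →ₗ[k] k}
    (hl : ∀ α x y, l α (x * y) = l α (y * x)) : IsCyclicTrace (formTrace l) := by
  classical
  intro U V f f'
  rw [formTrace_apply (Finset.subset_union_right (s₁ := U.1.support)),
    formTrace_apply (Finset.subset_union_left (s₂ := V.1.support))]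
  exact Finset.sum_congr rfl fun α _ =>
    projTrace_comp_comm (hl α) (U.2 α) (V.2 α) (f.1 α) (f'.1 α) (f.2 α) (f'.2 α)

variable [∀ α, Module.Finite k (H α)]

open Classical in
/-- The morphism `H_α → V`, `x ↦ x v`, for `v ∈ V_α`. -/
def orbitHom (V : HMod k H) {α : G} (v : V.carrier α) : HMod.Hom (regular k α) V :=
  ⟨fun β => if h : β = α then
      ((V.act β).toLinearMap.flip (h.symm ▸ v)) ∘ₗ LinearMap.proj (⟨h⟩ : PLift (β = α)) else 0,
    fun β x => by
      refine LinearMap.ext fun z => ?_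
      dsimp only
      split_ifs with h
      · simp
      · simp⟩

theorem orbitHom_apply (V : HMod k H) {α : G} (v : V.carrier α) (z : PLift (α = α) → H α) :
    (orbitHom V v).1 α z = V.act α (z ⟨rfl⟩) v := by
  simp [orbitHom]

theorem orbitHom_of_ne (V : HMod k H) {α β : G} (v : V.carrier α) (h : β ≠ α) :
    (orbitHom V v).1 β = 0 := by
  simp [orbitHom, h]

/-- The morphism `V → H_α` given by an `H_α`-linear map on the component `V_α`. -/
def toRegular (V : HMod k H) {α : G} (φ : V.carrier α →ₗ[k] H α)
    (hφ : ∀ a v, φ (V.act α a v) = a * φ v) : HMod.Hom V (regular k α) :=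
  ⟨fun β => LinearMap.pi fun p : PLift (β = α) => p.down.symm ▸ φ, fun β x => by
    refine LinearMap.ext fun v => funext fun p => ?_
    obtain ⟨rfl⟩ := p
    exact hφ x v⟩

theorem hom_regular_ext {V : HMod k H} {α : G} {f f' : HMod.Hom V (regular k α)}
    (h : ∀ v, f.1 α v ⟨rfl⟩ = f'.1 α v ⟨rfl⟩) : f = f' := by
  refine Subtype.ext (funext fun β => LinearMap.ext fun v => funext fun p => ?_)
  obtain ⟨rfl⟩ := p
  exact h v

theorem rightMul_apply {α : G} (h : H α) (z : PLift (α = α) → H α) (p : PLift (α = α)) :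
    (rightMul (k := k) α h).1 α z p = z p * h := by
  simp [rightMul]

theorem toRegular_comp_orbitHom (V : HMod k H) {α : G} (φ : V.carrier α →ₗ[k] H α)
    (hφ : ∀ a v, φ (V.act α a v) = a * φ v) (v : V.carrier α) :
    HMod.comp (toRegular V φ hφ) (orbitHom V v) = rightMul α (φ v) := by
  refine hom_regular_ext fun z => ?_
  rw [rightMul_apply]
  change φ ((orbitHom V v).1 α z) = _
  rw [orbitHom_apply, hφ]

/-- For a cyclic trace `t`, `t(f) = t(∑ (x ↦ x vᵢ) ∘ φᵢ ∘ f) = ∑ t(R_{φᵢ(f vᵢ)})`. -/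
theorem IsCyclicTrace.eq_formTrace {t : TraceFamily k H} (ht : IsCyclicTrace t) :
    t = formTrace (traceForm t) := by
  classical
  refine funext fun P => LinearMap.ext fun f => ?_
  let B (α : G) := (nonempty_dualBasis (P.2 α)).some
  let c (α : G) (i) : HMod.Hom P.1 (regular k α) :=
    HMod.comp (toRegular P.1 ((B α).coord i) ((B α).coord_act i)) f
  have hf : f = ∑ α ∈ P.1.support, ∑ i, HMod.comp (orbitHom P.1 ((B α).vec i)) (c α i) := by
    refine Subtype.ext (funext fun β => LinearMap.ext fun v => ?_)
    by_cases hβ : β ∈ P.1.support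
    · simp only [Submodule.coe_sum, Finset.sum_apply, LinearMap.sum_apply]
      rw [Finset.sum_eq_single_of_mem β hβ]
      · conv_lhs => rw [← (B β).sum_coord (f.1 β v)]
        refine Finset.sum_congr rfl fun i _ => ?_
        exact (orbitHom_apply P.1 ((B β).vec i) ((c β i).1 β v)).symm
      · intro α _ hα
        refine Finset.sum_eq_zero fun i _ => ?_
        change (orbitHom P.1 ((B α).vec i)).1 β _ = 0
        rw [orbitHom_of_ne _ _ hα.symm, LinearMap.zero_apply]
    · have := HMod.subsingleton_of_notMem_support hβ
      exact Subsingleton.elim _ _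
  have hc (α : G) (i) : HMod.comp (c α i) (orbitHom P.1 ((B α).vec i)) =
      rightMul α ((B α).coord i (f.1 α ((B α).vec i))) := by
    have he (a : H α) (v : P.1.carrier α) : ((B α).coord i ∘ₗ f.1 α) (P.1.act α a v) =
        a * ((B α).coord i ∘ₗ f.1 α) v := by
      rw [LinearMap.comp_apply, LinearMap.comp_apply, ← (B α).coord_act]
      exact congrArg ((B α).coord i) (LinearMap.congr_fun (f.2 α a) v)
    have e : c α i = toRegular P.1 ((B α).coord i ∘ₗ f.1 α) he := hom_regular_ext fun _ => rfl
    rw [e, toRegular_comp_orbitHom]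
    rfl
  rw [formTrace_apply subset_rfl]
  conv_lhs => rw [hf]
  simp only [map_sum]
  refine Finset.sum_congr rfl fun α _ => Finset.sum_congr rfl fun i _ => ?_
  rw [ht ⟨regular k α, isProjective_regular α⟩ P, hc]
  rfl

/-- The regular module has the dual basis `1`, `id`. -/
def regularDualBasis (α : G) : DualBasis ((regular k (H := H) α).act α) Unit where
  vec _ _ := 1
  coord _ := LinearMap.proj ⟨rfl⟩
  coord_act _ _ _ := rfl
  sum_coord v := by
    ext p
    simp

theorem support_regular_subset (α : G) : (regular k (H := H) α).support ⊆ {α} := fun β hβ => by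
  by_contra hne
  have : IsEmpty (PLift (β = α)) := ⟨fun p => hne (Finset.mem_singleton.2 p.down)⟩
  exact not_subsingleton_iff_nontrivial.2
    ((Set.Finite.mem_toFinset (regular k α).finite_support).1 hβ :
      Nontrivial (PLift (β = α) → H β)) inferInstance

theorem traceForm_formTrace {l : ∀ α, H α →ₗ[k] k} (hl : ∀ α x y, l α (x * y) = l α (y * x)) :
    traceForm (formTrace l) = l := by
  refine funext fun α => LinearMap.ext fun h => ?_
  change formTrace l ⟨regular k α, isProjective_regular α⟩ (rightMul α h) = _
  rw [formTrace_apply (P := ⟨regular k α, isProjective_regular α⟩) (support_regular_subset α),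
    Finset.sum_singleton, projTrace_eq (hl α) _ (regularDualBasis α) _ ((rightMul α h).2 α),
    DualBasis.trace_apply, Fintype.sum_unique]
  change l α ((rightMul (k := k) α h).1 α (fun _ => 1) ⟨rfl⟩) = _
  rw [rightMul_apply, one_mul]

end CyclicTrace

/-! ### Dual bases of tensor products -/

section TensorDualBasis

variable {k : Type u} [Field k] {A B C V W : Type u} [Ring A] [Algebra k A] [Ring B] [Algebra k B]
  [Ring C] [Algebra k C] [AddCommGroup V] [Module k V] [AddCommGroup W] [Module k W]
  {ρ : A →ₐ[k] Module.End k V} (σ : B →ₐ[k] Module.End k W)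

/-- For `z = ∑ c ⊗ b ∈ C ⊗ B` and a linear form `ω` on the `B`-module `W`, the map
`w ↦ ∑ ω(b w) c`. -/
def contractAct (ω : Module.Dual k W) : C ⊗[k] B →ₗ[k] W →ₗ[k] C :=
  LinearMap.mk₂ k
    (fun z w => TensorProduct.rid k C ((ω ∘ₗ σ.toLinearMap.flip w).lTensor C z))
    (fun _ _ _ => by simp) (fun _ _ _ => by simp)
    (fun _ _ _ => by simp [LinearMap.comp_add, LinearMap.lTensor_add])
    (fun _ _ _ => by simp [LinearMap.comp_smul, LinearMap.lTensor_smul])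

@[simp] theorem contractAct_tmul (ω : Module.Dual k W) (c : C) (b : B) (w : W) :
    contractAct σ ω (c ⊗ₜ b) w = ω (σ b w) • c := by
  simp [contractAct]

theorem contractAct_act (ω : Module.Dual k W) (z : C ⊗[k] B) (b : B) (w : W) :
    contractAct σ ω z (σ b w) = contractAct σ ω (z * (1 ⊗ₜ b)) w := by
  induction z with
  | zero => simp
  | add z z' hz hz' => simp only [map_add, add_mul, LinearMap.add_apply, hz, hz']
  | tmul c d => simp

theorem contractAct_mul (ω : Module.Dual k W) (x : C) (z : C ⊗[k] B) (w : W) :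
    contractAct σ ω ((x ⊗ₜ 1) * z) w = x * contractAct σ ω z w := by
  induction z with
  | zero => simp
  | add z z' hz hz' => simp only [map_add, mul_add, LinearMap.add_apply, hz, hz']
  | tmul c d => simp

theorem apply_contractAct (l : C →ₗ[k] k) (ω : Module.Dual k W) (z : C ⊗[k] B) (w : W) :
    l (contractAct σ ω z w) = ω (σ (TensorProduct.lid k B (l.rTensor B z)) w) := by
  induction z with
  | zero => simp
  | add z z' hz hz' => simp only [map_add, LinearMap.add_apply, hz, hz']
  | tmul c d => simp [mul_comm]

/-- The map `V ⊗ W → C`, `v ⊗ w ↦ ∑ ω(b w) c`, where `Ψ(φ(v)) = ∑ c ⊗ b`. -/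
def tensorCoord (Ψ : A →ₗ[k] C ⊗[k] B) (φ : V →ₗ[k] A) (ω : Module.Dual k W) :
    V ⊗[k] W →ₗ[k] C :=
  TensorProduct.lift (contractAct σ ω ∘ₗ Ψ ∘ₗ φ)

@[simp] theorem tensorCoord_tmul (Ψ : A →ₗ[k] C ⊗[k] B) (φ : V →ₗ[k] A) (ω : Module.Dual k W)
    (v : V) (w : W) : tensorCoord σ Ψ φ ω (v ⊗ₜ w) = contractAct σ ω (Ψ (φ v)) w := rfl

theorem tensorCoord_act {Δ : C →ₐ[k] A ⊗[k] B} {Ψ : A →ₗ[k] C ⊗[k] B}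
    (hΨ : ∀ x a, LinearMap.mul' k (C ⊗[k] B) (TensorProduct.map (Ψ ∘ₗ LinearMap.mulRight k a)
      (TensorProduct.mk k C B 1) (Δ x)) = (x ⊗ₜ 1) * Ψ a)
    {φ : V →ₗ[k] A} (hφ : ∀ a v, φ (ρ a v) = a * φ v) (ω : Module.Dual k W) (x : C)
    (z : V ⊗[k] W) : tensorCoord σ Ψ φ ω ((tensorEnd ρ σ).comp Δ x z) =
      x * tensorCoord σ Ψ φ ω z := by
  have key (q : A ⊗[k] B) (v : V) (w : W) :
      tensorCoord σ Ψ φ ω (tensorEnd ρ σ q (v ⊗ₜ w)) = contractAct σ ω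
        (LinearMap.mul' k (C ⊗[k] B) (TensorProduct.map (Ψ ∘ₗ LinearMap.mulRight k (φ v))
          (TensorProduct.mk k C B 1) q)) w := by
    induction q with
    | zero => simp
    | add z z' hz hz' => simp only [map_add, LinearMap.add_apply, hz, hz']
    | tmul c d => simp [hφ, contractAct_act]
  induction z with
  | zero => simp
  | add z z' hz hz' => simp only [map_add, mul_add, hz, hz']
  | tmul v w => rw [AlgHom.comp_apply, key, hΨ, contractAct_mul, tensorCoord_tmul]

/-- Let `C` act on `V ⊗ W` through `Δ : C → A ⊗ B`, and let `Ψ : A → C ⊗ B` be an inverse of the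
Galois map `c ⊗ b ↦ Δ(c) (1 ⊗ b)` in the sense of `hΨ` and `hΔ`. Then a dual basis `(vᵢ, φᵢ)` of the
`A`-module `V` and a basis `(wⱼ)` of the vector space `W` give the dual basis of `V ⊗ W` with the
vectors `vᵢ ⊗ wⱼ` and the coordinates `v ⊗ w ↦ ∑ wʲ(b w) c`, where `Ψ(φᵢ(v)) = ∑ c ⊗ b`. -/
def DualBasis.tensor {ι κ : Type*} [Fintype ι] [Fintype κ] (D : DualBasis ρ ι)
    (b : Module.Basis κ k W) (Δ : C →ₐ[k] A ⊗[k] B) (Ψ : A →ₗ[k] C ⊗[k] B)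
    (hΨ : ∀ x a, LinearMap.mul' k (C ⊗[k] B) (TensorProduct.map (Ψ ∘ₗ LinearMap.mulRight k a)
      (TensorProduct.mk k C B 1) (Δ x)) = (x ⊗ₜ 1) * Ψ a)
    (hΔ : ∀ a, LinearMap.mul' k (A ⊗[k] B) (TensorProduct.map Δ.toLinearMap
      (TensorProduct.mk k A B 1) (Ψ a)) = a ⊗ₜ 1) :
    DualBasis ((tensorEnd ρ σ).comp Δ) (ι × κ) where
  vec p := D.vec p.1 ⊗ₜ b p.2
  coord p := tensorCoord σ Ψ (D.coord p.1) (b.coord p.2)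
  coord_act p := tensorCoord_act σ hΨ (D.coord_act p.1) _
  sum_coord z := by
    have key (q : C ⊗[k] B) (v : V) (w : W) :
        ∑ j, tensorEnd ρ σ (Δ (contractAct σ (b.coord j) q w)) (v ⊗ₜ b j) =
          tensorEnd ρ σ (LinearMap.mul' k (A ⊗[k] B) (TensorProduct.map Δ.toLinearMap
            (TensorProduct.mk k A B 1) q)) (v ⊗ₜ w) := by
      induction q with
      | zero => simp
      | add z z' hz hz' =>
        simp only [map_add, LinearMap.add_apply, Finset.sum_add_distrib, hz, hz']
      | tmul c d =>
        simp only [contractAct_tmul, TensorProduct.map_tmul, LinearMap.mul'_apply,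
          AlgHom.toLinearMap_apply, TensorProduct.mk_apply, map_mul, Module.End.mul_apply,
          tensorEnd_tmul, map_one, map_smul, LinearMap.smul_apply, Module.End.one_apply]
        have hd := congrArg (fun w => tensorEnd ρ σ (Δ c) (v ⊗ₜ w)) (b.sum_repr (σ d w))
        simp only [TensorProduct.tmul_sum, TensorProduct.tmul_smul, map_sum, map_smul] at hd
        exact hd
    induction z with
    | zero => simp
    | add z z' hz hz' => simp only [map_add, LinearMap.add_apply, Finset.sum_add_distrib, hz, hz']
    | tmul v w =>
      rw [Fintype.sum_prod_type]
      simp only [tensorCoord_tmul, AlgHom.comp_apply, key, hΔ,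
        tensorEnd_tmul, TensorProduct.map_tmul, map_one, Module.End.one_apply,
        ← TensorProduct.sum_tmul, D.sum_coord]

theorem rightPartialTraceLin_apply {U : Type u} [AddCommGroup U] [Module k U] [Module.Finite k W]
    (a : Module.End k W) (F : U ⊗[k] W →ₗ[k] V ⊗[k] W) (u : U) :
    rightPartialTraceLin a F u = ∑ j, TensorProduct.rid k V
      (((Module.Basis.ofVectorSpace k W).coord j ∘ₗ a).lTensor V
        (F (u ⊗ₜ Module.Basis.ofVectorSpace k W j))) := by
  have key (z : V ⊗[k] W) (f : Module.Dual k W) :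
      (contractRight k W ∘ₗ a.rTensor (Module.Dual k W)).lTensor V
        (TensorProduct.assoc k V W (Module.Dual k W) (z ⊗ₜ f)) = (f ∘ₗ a).lTensor V z := by
    induction z with
    | zero => simp
    | add z z' hz hz' => simp only [map_add, TensorProduct.add_tmul, hz, hz']
    | tmul v w => simp
  simp only [rightPartialTraceLin, LinearMap.comp_apply, LinearEquiv.coe_coe,
    TensorProduct.rid_symm_apply, LinearMap.lTensor_tmul, coevaluation_apply_one,
    TensorProduct.tmul_sum, map_sum, TensorProduct.assoc_symm_tmul, LinearMap.rTensor_tmul]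
  exact Finset.sum_congr rfl fun j _ => congrArg _ (key _ _)

theorem rightPartialTraceLin_apply_of_forall {U : Type u} [AddCommGroup U] [Module k U]
    [Module.Finite k W] (a : Module.End k W) {F : U ⊗[k] W →ₗ[k] V ⊗[k] W} {u : U}
    {ω : Module.Dual k W} {z : V ⊗[k] W} (hF : ∀ w, F (u ⊗ₜ w) = ω w • z) :
    rightPartialTraceLin a F u = TensorProduct.rid k V ((ω ∘ₗ a).lTensor V z) := by
  let b := Module.Basis.ofVectorSpace k W
  have hω : ω = ∑ j, ω (b j) • b.coord j := b.ext fun i => by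
    classical
    simp [Finsupp.single_apply]
  rw [rightPartialTraceLin_apply]
  simp only [hF, map_smul]
  clear hF
  induction z with
  | zero => simp
  | add z z' hz hz' => simp only [map_add, smul_add, Finset.sum_add_distrib, hz, hz']
  | tmul v w =>
    simp only [LinearMap.lTensor_tmul, TensorProduct.rid_tmul, LinearMap.comp_apply, smul_smul,
      ← Finset.sum_smul]
    congr 1
    conv_rhs => rw [hω]
    simp [b]

theorem leftPartialTraceLin_eq_right {U : Type u} [AddCommGroup U] [Module k U] [Module.Finite k W]
    (a : Module.End k W) (F : W ⊗[k] U →ₗ[k] W ⊗[k] V) :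
    leftPartialTraceLin a F = rightPartialTraceLin a ((TensorProduct.comm k W V).toLinearMap ∘ₗ
      F ∘ₗ (TensorProduct.comm k U W).toLinearMap) := by
  have key (z : W ⊗[k] V) (f : Module.Dual k W) :
      TensorProduct.lid k V ((contractLeft k W).rTensor V
        ((TensorProduct.assoc k (Module.Dual k W) W V).symm (f ⊗ₜ z))) =
      TensorProduct.rid k V (f.lTensor V (TensorProduct.comm k W V z)) := by
    induction z with
    | zero => simp
    | add z z' hz hz' => simp only [map_add, TensorProduct.tmul_add, hz, hz']
    | tmul v w => simp
  rw [rightPartialTraceLin_eq_one, ← rightPartialTraceLin_cyclic]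
  refine LinearMap.ext fun u => ?_
  rw [rightPartialTraceLin_apply]
  simp only [leftPartialTraceLin, LinearMap.comp_apply, LinearEquiv.coe_coe,
    TensorProduct.lid_symm_apply, LinearMap.rTensor_tmul, coevaluation_apply_one,
    TensorProduct.sum_tmul, map_sum, TensorProduct.assoc_tmul, LinearMap.lTensor_tmul,
    TensorProduct.comm_tmul, key]
  rfl

/-- If `(l_C ⊗ id) Ψ(a) = l_A(a) u`, then the trace attached to `l_C` of an endomorphism of `V ⊗ W`
is the trace attached to `l_A` of its partial trace with respect to the action of `u`. -/
theorem DualBasis.trace_tensor {ι : Type*} [Fintype ι] [Module.Finite k W] (D : DualBasis ρ ι)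
    (Δ : C →ₐ[k] A ⊗[k] B) (Ψ : A →ₗ[k] C ⊗[k] B)
    (hΨ : ∀ x a, LinearMap.mul' k (C ⊗[k] B) (TensorProduct.map (Ψ ∘ₗ LinearMap.mulRight k a)
      (TensorProduct.mk k C B 1) (Δ x)) = (x ⊗ₜ 1) * Ψ a)
    (hΔ : ∀ a, LinearMap.mul' k (A ⊗[k] B) (TensorProduct.map Δ.toLinearMap
      (TensorProduct.mk k A B 1) (Ψ a)) = a ⊗ₜ 1)
    {lA : A →ₗ[k] k} {lC : C →ₗ[k] k} {u : B}
    (hl : ∀ a, TensorProduct.lid k B (lC.rTensor B (Ψ a)) = lA a • u)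
    (F : Module.End k (V ⊗[k] W)) :
    (D.tensor σ (Module.Basis.ofVectorSpace k W) Δ Ψ hΨ hΔ).trace lC F =
      D.trace lA (rightPartialTraceLin (σ u) F) := by
  rw [DualBasis.trace_apply, DualBasis.trace_apply, Fintype.sum_prod_type]
  refine Finset.sum_congr rfl fun i _ => ?_
  rw [rightPartialTraceLin_apply, map_sum, map_sum]
  refine Finset.sum_congr rfl fun j _ => ?_
  simp only [DualBasis.tensor]
  generalize F (D.vec i ⊗ₜ Module.Basis.ofVectorSpace k W j) = z
  induction z with
  | zero => simp
  | add z z' hz hz' => simp only [map_add, hz, hz']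
  | tmul v w => simp [apply_contractAct, hl, mul_comm]

end TensorDualBasis

/-! ### Integrals and traces on tensor products -/

section Integrals

variable {k G : Type u} [Field k] [Group G] {H : G → Type u}
  [∀ α, Ring (H α)] [∀ α, Algebra k (H α)] [HopfGCoalgebra k H]

theorem Pivot.comul_inv (g : Pivot k H) {α β γ : G} (h : α * β = γ) :
    comul (k := k) h (g.inv γ) = g.inv α ⊗ₜ g.inv β := by
  have h1 : comul (k := k) h (g.inv γ) * (g.val α ⊗ₜ g.val β) = 1 := by
    rw [← g.comul_val h, ← map_mul, g.inv_mul, map_one]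
  have h2 : (g.val α ⊗ₜ[k] g.val β) * (g.inv α ⊗ₜ g.inv β) = 1 := by
    simp [g.mul_inv, Algebra.TensorProduct.one_def]
  exact left_inv_eq_right_inv h1 h2

theorem lid_rTensor_tmul_mul {A B : Type u} [Ring A] [Ring B] [Algebra k A] [Algebra k B]
    (f : A →ₗ[k] k) (a : A) (b : B) (z : A ⊗[k] B) :
    TensorProduct.lid k B (f.rTensor B ((a ⊗ₜ b) * z)) =
      b * TensorProduct.lid k B ((f ∘ₗ LinearMap.mulLeft k a).rTensor B z) := by
  induction z with
  | zero => simp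
  | add z z' hz hz' => simp only [mul_add, map_add, hz, hz']
  | tmul c d => simp

theorem rid_lTensor_tmul_mul {A B : Type u} [Ring A] [Ring B] [Algebra k A] [Algebra k B]
    (f : B →ₗ[k] k) (a : A) (b : B) (z : A ⊗[k] B) :
    TensorProduct.rid k A (f.lTensor A ((a ⊗ₜ b) * z)) =
      a * TensorProduct.rid k A ((f ∘ₗ LinearMap.mulLeft k b).lTensor A z) := by
  induction z with
  | zero => simp
  | add z z' hz hz' => simp only [mul_add, map_add, hz, hz']
  | tmul c d => simp

/-- A family `l` is a symmetrised right integral if and only if `l_α(x₁) g_β x₂ = l_{αβ}(x) 1`. -/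
theorem isSymmetrisedRightIntegral_iff (g : Pivot k H) (l : ∀ α, H α →ₗ[k] k) :
    IsSymmetrisedRightIntegral g l ↔ ∀ {α β γ : G} (h : α * β = γ) (x : H γ),
      g.val β * TensorProduct.lid k (H β) ((l α).rTensor (H β) (comul h x)) =
        l γ x • (1 : H β) := by
  constructor
  · rintro ⟨μ, hμ, hl⟩ α β γ h x
    have hl' (α : G) : l α = μ α ∘ₗ LinearMap.mulLeft k (g.val α) := LinearMap.ext (hl α)
    rw [hl' α, ← lid_rTensor_tmul_mul, ← g.comul_val h, ← map_mul, hμ h, hl]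
  · intro hl
    refine ⟨fun α => l α ∘ₗ LinearMap.mulLeft k (g.inv α), fun {α β γ} h x => ?_, fun α x => ?_⟩
    · have := hl h (g.inv γ * x)
      rw [map_mul, g.comul_inv h, lid_rTensor_tmul_mul, ← mul_assoc, g.mul_inv, one_mul] at this
      exact this
    · simp [← mul_assoc, g.inv_mul]

/-- A family `l` is a symmetrised left integral if and only if
`l_β(x₂) g_α⁻¹ x₁ = l_{αβ}(x) 1`. -/
theorem isSymmetrisedLeftIntegral_iff (g : Pivot k H) (l : ∀ α, H α →ₗ[k] k) :
    IsSymmetrisedLeftIntegral g l ↔ ∀ {α β γ : G} (h : α * β = γ) (x : H γ),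
      g.inv α * TensorProduct.rid k (H α) ((l β).lTensor (H α) (comul h x)) =
        l γ x • (1 : H α) := by
  constructor
  · rintro ⟨μ, hμ, hl⟩ α β γ h x
    have hl' (α : G) : l α = μ α ∘ₗ LinearMap.mulLeft k (g.inv α) := LinearMap.ext (hl α)
    rw [hl' β, ← rid_lTensor_tmul_mul, ← g.comul_inv h, ← map_mul, hμ h, hl]
  · intro hl
    refine ⟨fun α => l α ∘ₗ LinearMap.mulLeft k (g.val α), fun {α β γ} h x => ?_, fun α x => ?_⟩
    · have := hl h (g.val γ * x)
      rw [map_mul, g.comul_val h, rid_lTensor_tmul_mul, ← mul_assoc, g.inv_mul, one_mul] at this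
      exact this
    · simp [← mul_assoc, g.mul_inv]

/-- `a ↦ a₁ ⊗ S(a₂)`, an inverse of the Galois map for `Δ`. -/
def rightGaloisInv {α β β' γ : G} (h' : γ * β' = α) (hβ' : β' * β = 1) :
    H α →ₗ[k] H γ ⊗[k] H β :=
  (antipode (k := k) hβ').lTensor (H γ) ∘ₗ (comul (k := k) h').toLinearMap

theorem rightGaloisInv_mul {α β β' γ : G} (h : α * β = γ) (h' : γ * β' = α) (hβ : β * β' = 1)
    (hβ' : β' * β = 1) (x : H γ) (a : H α) :
    LinearMap.mul' k (H γ ⊗[k] H β) (TensorProduct.map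
      (rightGaloisInv (k := k) h' hβ' ∘ₗ LinearMap.mulRight k a)
      (TensorProduct.mk k (H γ) (H β) 1) (comul h x)) =
      (x ⊗ₜ 1) * rightGaloisInv (k := k) h' hβ' a := by
  have e : rightGaloisInv (k := k) h' hβ' ∘ₗ LinearMap.mulRight k a =
      (antipode (k := k) hβ').lTensor (H γ) ∘ₗ LinearMap.mulRight k (comul (k := k) h' a) ∘ₗ
        (comul (k := k) h').toLinearMap := by
    ext; simp [rightGaloisInv]
  rw [e]
  exact antipode_comul_mul h h' hβ hβ' _ x

theorem comul_rightGaloisInv {α β β' γ : G} (h : α * β = γ) (h' : γ * β' = α) (hβ : β * β' = 1)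
    (hβ' : β' * β = 1) (a : H α) :
    LinearMap.mul' k (H α ⊗[k] H β) (TensorProduct.map (comul (k := k) h).toLinearMap
      (TensorProduct.mk k (H α) (H β) 1) (rightGaloisInv (k := k) h' hβ' a)) = a ⊗ₜ 1 := by
  rw [← comul_mul_antipode h h' hβ hβ' a, rightGaloisInv, LinearMap.comp_apply,
    AlgHom.toLinearMap_apply]
  generalize comul (k := k) h' a = w
  induction w with
  | zero => simp
  | add z z' hz hz' => simp only [map_add, hz, hz']
  | tmul c d => simp

theorem IsSymmetrisedRightIntegral.rightGaloisInv {g : Pivot k H} {l : ∀ α, H α →ₗ[k] k}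
    (hl : IsSymmetrisedRightIntegral g l) {α β β' γ : G} (h' : γ * β' = α) (hβ : β * β' = 1)
    (hβ' : β' * β = 1) (a : H α) :
    TensorProduct.lid k (H β) ((l γ).rTensor (H β) (rightGaloisInv (k := k) h' hβ' a)) =
      l α a • g.val β := by
  have e (z : H γ ⊗[k] H β') : TensorProduct.lid k (H β) ((l γ).rTensor (H β)
      ((antipode (k := k) hβ').lTensor (H γ) z)) =
      antipode (k := k) hβ' (TensorProduct.lid k (H β') ((l γ).rTensor (H β') z)) := by
    induction z with
    | zero => simp
    | add z z' hz hz' => simp only [map_add, hz, hz']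
    | tmul c d => simp
  have h1 := congrArg (fun z => g.inv β' * z) ((isSymmetrisedRightIntegral_iff g l).1 hl h' a)
  rw [← mul_assoc, g.inv_mul, one_mul, mul_smul_comm, mul_one] at h1
  rw [HopfGCoalgebra.rightGaloisInv, LinearMap.comp_apply, e, AlgHom.toLinearMap_apply, h1,
    map_smul, g.antipode_inv hβ' hβ]

/-- The opposite coproduct `x ↦ x₂ ⊗ x₁`. -/
def comulOp {α β γ : G} (h : β * α = γ) : H γ →ₐ[k] H α ⊗[k] H β :=
  (Algebra.TensorProduct.comm k (H β) (H α)).toAlgHom.comp (comul h)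

/-- `a ↦ a₂ ⊗ S⁻¹(a₁)`, an inverse of the Galois map for the opposite coproduct; the inverse of the
antipode is `b ↦ g⁻¹ S(b) g`. -/
def Pivot.leftGaloisInv (g : Pivot k H) {α β β' γ : G} (h' : β' * γ = α) (hβ' : β' * β = 1) :
    H α →ₗ[k] H γ ⊗[k] H β :=
  (TensorProduct.comm k (H β) (H γ)).toLinearMap ∘ₗ
    (LinearMap.mulLeft k (g.inv β) ∘ₗ LinearMap.mulRight k (g.val β) ∘ₗ
      antipode (k := k) hβ').rTensor (H γ) ∘ₗ (comul (k := k) h').toLinearMap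

theorem comm_mul {A B : Type u} [Ring A] [Ring B] [Algebra k A] [Algebra k B] (z w : A ⊗[k] B) :
    TensorProduct.comm k A B (z * w) = TensorProduct.comm k A B z * TensorProduct.comm k A B w :=
  map_mul (Algebra.TensorProduct.comm k A B) z w

theorem Pivot.leftGaloisInv_mul (g : Pivot k H) {α β β' γ : G} (h : β * α = γ) (h' : β' * γ = α)
    (hβ : β * β' = 1) (hβ' : β' * β = 1) (x : H γ) (a : H α) :
    LinearMap.mul' k (H γ ⊗[k] H β) (TensorProduct.map
      (g.leftGaloisInv h' hβ' ∘ₗ LinearMap.mulRight k a)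
      (TensorProduct.mk k (H γ) (H β) 1) (comulOp h x)) =
      (x ⊗ₜ 1) * g.leftGaloisInv h' hβ' a := by
  have h1 := congrArg (TensorProduct.comm k (H β) (H γ))
    (g.antipode_comul_mul h h' hβ hβ' (comul (k := k) h' a) x)
  rw [comm_mul, TensorProduct.comm_tmul] at h1
  refine Eq.trans ?_ h1
  change LinearMap.mul' k (H γ ⊗[k] H β) (TensorProduct.map
      (g.leftGaloisInv h' hβ' ∘ₗ LinearMap.mulRight k a)
      (TensorProduct.mk k (H γ) (H β) 1) (TensorProduct.comm k _ _ (comul h x))) = _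
  generalize comul (k := k) h x = w
  induction w with
  | zero => simp only [map_zero]
  | add z z' hz hz' => simp only [map_add, hz, hz']
  | tmul c d =>
    simp only [TensorProduct.comm_tmul, TensorProduct.map_tmul, LinearMap.mul'_apply, comm_mul,
      LinearMap.comp_apply, LinearMap.flip_apply, TensorProduct.mk_apply, leftGaloisInv,
      LinearMap.mulRight_apply, AlgHom.toLinearMap_apply, map_mul, LinearEquiv.coe_coe]

theorem Pivot.comul_leftGaloisInv (g : Pivot k H) {α β β' γ : G} (h : β * α = γ)
    (h' : β' * γ = α) (hβ : β * β' = 1) (hβ' : β' * β = 1) (a : H α) :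
    LinearMap.mul' k (H α ⊗[k] H β) (TensorProduct.map (comulOp (k := k) h).toLinearMap
      (TensorProduct.mk k (H α) (H β) 1) (g.leftGaloisInv h' hβ' a)) = a ⊗ₜ 1 := by
  have h1 := congrArg (fun z => TensorProduct.comm k (H β) (H α) (z * (g.val β ⊗ₜ 1)))
    (g.comul_mul_inv_antipode h h' hβ' hβ a)
  simp only [Algebra.TensorProduct.tmul_mul_tmul, g.inv_mul, mul_one,
    TensorProduct.comm_tmul] at h1
  rw [← h1, leftGaloisInv, LinearMap.comp_apply, LinearMap.comp_apply, AlgHom.toLinearMap_apply]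
  generalize comul (k := k) h' a = w
  induction w with
  | zero => simp
  | add z z' hz hz' => simp only [map_add, add_mul, hz, hz']
  | tmul c d =>
    simp only [TensorProduct.comm_tmul, TensorProduct.map_tmul, LinearMap.mul'_apply, comm_mul,
      LinearMap.comp_apply, LinearMap.flip_apply, TensorProduct.mk_apply, LinearMap.rTensor_tmul,
      LinearMap.mulRight_apply, LinearMap.mulLeft_apply, AlgHom.toLinearMap_apply,
      LinearEquiv.coe_coe, mul_assoc, Algebra.TensorProduct.tmul_mul_tmul, mul_one]
    rfl

theorem IsSymmetrisedLeftIntegral.leftGaloisInv {g : Pivot k H} {l : ∀ α, H α →ₗ[k] k}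
    (hl : IsSymmetrisedLeftIntegral g l) {α β β' γ : G} (h' : β' * γ = α)
    (hβ' : β' * β = 1) (a : H α) :
    TensorProduct.lid k (H β) ((l γ).rTensor (H β) (g.leftGaloisInv h' hβ' a)) =
      l α a • g.inv β := by
  have e (z : H β' ⊗[k] H γ) (S : H β' →ₗ[k] H β) : TensorProduct.lid k (H β)
      ((l γ).rTensor (H β) (TensorProduct.comm k (H β) (H γ) (S.rTensor (H γ) z))) =
      S (TensorProduct.rid k (H β') ((l γ).lTensor (H β') z)) := by
    induction z with
    | zero => simp
    | add z z' hz hz' => simp only [map_add, hz, hz']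
    | tmul c d => simp
  have h1 := congrArg (fun z => g.val β' * z) ((isSymmetrisedLeftIntegral_iff g l).1 hl h' a)
  rw [← mul_assoc, g.mul_inv, one_mul, mul_smul_comm, mul_one] at h1
  rw [Pivot.leftGaloisInv, LinearMap.comp_apply, LinearMap.comp_apply, LinearEquiv.coe_coe, e,
    AlgHom.toLinearMap_apply, h1, map_smul]
  simp only [LinearMap.comp_apply, LinearMap.mulLeft_apply, LinearMap.mulRight_apply,
    g.antipode_val hβ', g.inv_mul, mul_one]

variable {V W : Type u} [AddCommGroup V] [Module k V] [Module.Finite k V] [AddCommGroup W]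
  [Module k W] [Module.Finite k W]

theorem projTrace_tensorAct_right {g : Pivot k H} {l : ∀ α, H α →ₗ[k] k}
    (hl : IsSymmetrisedRightIntegral g l) (hs : ∀ α x y, l α (x * y) = l α (y * x)) {α β γ : G}
    (h : α * β = γ) {ρ : H α →ₐ[k] Module.End k V} {σ : H β →ₐ[k] Module.End k W}
    (hρ : IsProjectiveAct ρ) (hτ : IsProjectiveAct (tensorAct h ρ σ))
    (F : Module.End k (V ⊗[k] W)) (hF : ∀ a, F ∘ₗ tensorAct h ρ σ a = tensorAct h ρ σ a ∘ₗ F) :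
    projTrace (l γ) hτ F = projTrace (l α) hρ (rightPartialTraceLin (σ (g.val β)) F) := by
  have h' : γ * β⁻¹ = α := by rw [← h]; group
  have hβ := mul_inv_cancel β
  have hβ' := inv_mul_cancel β
  rw [projTrace_eq (hs γ) hτ ((nonempty_dualBasis hρ).some.tensor σ
    (Module.Basis.ofVectorSpace k W) (comul h) (rightGaloisInv h' hβ')
    (rightGaloisInv_mul h h' hβ hβ') (comul_rightGaloisInv h h' hβ hβ')) F hF]
  exact DualBasis.trace_tensor σ _ _ _ _ _ (hl.rightGaloisInv h' hβ hβ') F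

theorem comm_comp_tensorEnd {A B V W : Type u} [Ring A] [Ring B] [Algebra k A] [Algebra k B]
    [AddCommGroup V] [Module k V] [AddCommGroup W] [Module k W] (ρ : A →ₐ[k] Module.End k V)
    (σ : B →ₐ[k] Module.End k W) (z : A ⊗[k] B) :
    (TensorProduct.comm k V W).toLinearMap ∘ₗ tensorEnd ρ σ z =
      tensorEnd σ ρ (Algebra.TensorProduct.comm k A B z) ∘ₗ
        (TensorProduct.comm k V W).toLinearMap := by
  induction z with
  | zero => simp
  | add z z' hz hz' => simp only [map_add, LinearMap.add_comp, LinearMap.comp_add, hz, hz']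
  | tmul c d => ext; simp

theorem comm_comp_tensorAct {α β γ : G} (h : β * α = γ) (ρ : H α →ₐ[k] Module.End k V)
    (σ : H β →ₐ[k] Module.End k W) (x : H γ) :
    (TensorProduct.comm k W V).toLinearMap ∘ₗ tensorAct h σ ρ x =
      (tensorEnd ρ σ).comp (comulOp h) x ∘ₗ (TensorProduct.comm k W V).toLinearMap :=
  comm_comp_tensorEnd σ ρ _

theorem comm_comp_tensorEnd_comulOp {α β γ : G} (h : β * α = γ) (ρ : H α →ₐ[k] Module.End k V)
    (σ : H β →ₐ[k] Module.End k W) (x : H γ) :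
    (TensorProduct.comm k V W).toLinearMap ∘ₗ (tensorEnd ρ σ).comp (comulOp h) x =
      tensorAct h σ ρ x ∘ₗ (TensorProduct.comm k V W).toLinearMap := by
  have e : comul h x = Algebra.TensorProduct.comm k (H α) (H β) (comulOp h x) :=
    ((Algebra.TensorProduct.comm k (H β) (H α)).symm_apply_apply (comul h x)).symm
  rw [tensorAct, AlgHom.comp_apply, AlgHom.comp_apply, e]
  exact comm_comp_tensorEnd ρ σ _

theorem projTrace_tensorAct_left {g : Pivot k H} {l : ∀ α, H α →ₗ[k] k}
    (hl : IsSymmetrisedLeftIntegral g l) (hs : ∀ α x y, l α (x * y) = l α (y * x)) {α β γ : G}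
    (h : β * α = γ) {ρ : H α →ₐ[k] Module.End k V} {σ : H β →ₐ[k] Module.End k W}
    (hρ : IsProjectiveAct ρ) (hτ : IsProjectiveAct (tensorAct h σ ρ))
    (F : Module.End k (W ⊗[k] V)) (hF : ∀ a, F ∘ₗ tensorAct h σ ρ a = tensorAct h σ ρ a ∘ₗ F) :
    projTrace (l γ) hτ F = projTrace (l α) hρ (leftPartialTraceLin (σ (g.inv β)) F) := by
  have h' : β⁻¹ * γ = α := by rw [← h]; group
  have hβ := mul_inv_cancel β
  have hβ' := inv_mul_cancel β
  let D := (nonempty_dualBasis hρ).some.tensor σ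
    (Module.Basis.ofVectorSpace k W) (comulOp h) (g.leftGaloisInv h' hβ')
    (g.leftGaloisInv_mul h h' hβ hβ') (g.comul_leftGaloisInv h h' hβ hβ')
  have e : F = (TensorProduct.comm k V W).toLinearMap ∘ₗ
      ((TensorProduct.comm k W V).toLinearMap ∘ₗ F) := by
    ext; simp
  rw [leftPartialTraceLin_eq_right]
  conv_lhs => rw [e]
  refine (D.trace_comp_comm (nonempty_dualBasis hτ).some (hs γ) _ _
    (comm_comp_tensorEnd_comulOp h ρ σ) fun a => ?_).trans
    (DualBasis.trace_tensor σ _ _ _ _ _ (hl.leftGaloisInv h' hβ') _)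
  rw [LinearMap.comp_assoc, hF, ← LinearMap.comp_assoc, comm_comp_tensorAct, LinearMap.comp_assoc]

end Integrals

/-! ### Modified traces and integrals -/

section ModifiedTrace

variable {k G : Type u} [Field k] [Group G] {H : G → Type u}
  [∀ α, Ring (H α)] [∀ α, Algebra k (H α)] [HopfGCoalgebra k H]

open Classical in
/-- The inclusion of the summand `V_α ⊗ W_β`, `αβ = γ`, of the component of `V ⊗ W` in
degree `γ`. -/
def tensorIncl (V W : HMod k H) {α β γ : G} (h : α * β = γ) :
    V.carrier α ⊗[k] W.carrier β →ₗ[k] (V.tensor W).carrier γ :=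
  DirectSum.lof k {p : G × G // p.1 * p.2 = γ} (fun p => V.carrier p.1.1 ⊗[k] W.carrier p.1.2)
    ⟨(α, β), h⟩

/-- The projection onto the summand `V_α ⊗ W_β`, `αβ = γ`, of the component of `V ⊗ W` in
degree `γ`. -/
def tensorProj (V W : HMod k H) {α β γ : G} (h : α * β = γ) :
    (V.tensor W).carrier γ →ₗ[k] V.carrier α ⊗[k] W.carrier β :=
  DirectSum.component k {p : G × G // p.1 * p.2 = γ}
    (fun p => V.carrier p.1.1 ⊗[k] W.carrier p.1.2) ⟨(α, β), h⟩

theorem block_eq {U V W X : HMod k H} (f : HMod.Hom (U.tensor W) (V.tensor X)) (α β : G) :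
    HMod.block f α β = tensorProj V X rfl ∘ₗ f.1 (α * β) ∘ₗ tensorIncl U W rfl := rfl

theorem tensorProj_incl (V W : HMod k H) {α β γ : G} (h : α * β = γ)
    (z : V.carrier α ⊗[k] W.carrier β) : tensorProj V W h (tensorIncl V W h z) = z := by
  classical
  exact DirectSum.component.lof_self k _ _

theorem tensorProj_incl_of_ne (V W : HMod k H) {α β α' β' γ : G} (h : α * β = γ)
    (h' : α' * β' = γ) (hne : (α, β) ≠ (α', β')) (z : V.carrier α ⊗[k] W.carrier β) :
    tensorProj V W h' (tensorIncl V W h z) = 0 := by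
  classical
  exact DFinsupp.single_eq_of_ne fun e => hne (Subtype.ext_iff.1 e).symm

theorem tensorIncl_comp_tensorAct (V W : HMod k H) {α β γ : G} (h : α * β = γ) (x : H γ) :
    tensorIncl V W h ∘ₗ tensorAct h (V.act α) (W.act β) x =
      (V.tensor W).act γ x ∘ₗ tensorIncl V W h := by
  refine LinearMap.ext fun z => ?_
  refine Eq.symm ?_
  classical
  exact DirectSum.lmap_lof (fun p : {p : G × G // p.1 * p.2 = γ} =>
    tensorAct p.2 (V.act p.1.1) (W.act p.1.2) x) ⟨(α, β), h⟩ z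

theorem tensorProj_comp_act (V W : HMod k H) {α β γ : G} (h : α * β = γ) (x : H γ) :
    tensorProj V W h ∘ₗ (V.tensor W).act γ x =
      tensorAct h (V.act α) (W.act β) x ∘ₗ tensorProj V W h := rfl

theorem tensor_carrier_ext {V W : HMod k H} {γ : G} {z z' : (V.tensor W).carrier γ}
    (h : ∀ α β (h : α * β = γ), tensorProj V W h z = tensorProj V W h z') : z = z' :=
  DFinsupp.ext fun p => h p.1.1 p.1.2 p.2

theorem sum_tensorIncl_tensorProj (V W : HMod k H) {γ : G} {S : Finset {p : G × G // p.1 * p.2 = γ}}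
    (hS : ∀ p, p ∉ S → Subsingleton (V.carrier p.1.1 ⊗[k] W.carrier p.1.2)) :
    ∑ p ∈ S, tensorIncl V W p.2 ∘ₗ tensorProj V W p.2 = LinearMap.id := by
  refine LinearMap.ext fun z => tensor_carrier_ext fun α β h => ?_
  by_cases hq : ⟨(α, β), h⟩ ∈ S
  · rw [LinearMap.sum_apply, map_sum, Finset.sum_eq_single_of_mem _ hq]
    · exact tensorProj_incl V W h _
    · intro p _ hp
      exact tensorProj_incl_of_ne V W p.2 h (fun e => hp (Subtype.ext e)) _
  · have := hS _ hq
    exact Subsingleton.elim _ _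

/-- The trace of an endomorphism of `V ⊗ W` is the sum of the traces of its diagonal blocks. -/
theorem formTrace_tensor {l : ∀ α, H α →ₗ[k] k} (hs : ∀ α x y, l α (x * y) = l α (y * x))
    {V W : HMod k H} (hVW : (V.tensor W).IsProjective)
    (hp : ∀ {α β γ} (h : α * β = γ), IsProjectiveAct (tensorAct h (V.act α) (W.act β)))
    (f : HMod.Hom (V.tensor W) (V.tensor W)) :
    formTrace l ⟨V.tensor W, hVW⟩ f = ∑ p ∈ V.support ×ˢ W.support,
      projTrace (l (p.1 * p.2)) (hp (α := p.1) (β := p.2) rfl) (HMod.block f p.1 p.2) := by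
  classical
  let S := V.support ×ˢ W.support
  have hss {p : G × G} (h : p ∉ S) : Subsingleton (V.carrier p.1 ⊗[k] W.carrier p.2) :=
    V.subsingleton_tensor W fun h' => h (Finset.mem_product.2 h')
  have hT : (V.tensor W).support ⊆ S.image fun p => p.1 * p.2 := fun γ hγ => by
    by_contra hc
    refine not_subsingleton_iff_nontrivial.2
      ((Set.Finite.mem_toFinset (V.tensor W).finite_support).1 hγ)
      ⟨fun x y => tensor_carrier_ext fun α β h => ?_⟩
    have := hss (p := (α, β)) fun h' => hc (by
      rw [← h]
      exact Finset.mem_image_of_mem (fun p : G × G => p.1 * p.2) h')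
    exact Subsingleton.elim _ _
  rw [formTrace_apply (P := ⟨V.tensor W, hVW⟩) hT f, ← Finset.sum_fiberwise_of_maps_to
    fun p hp => Finset.mem_image_of_mem (fun p : G × G => p.1 * p.2) hp]
  refine Finset.sum_congr rfl fun γ _ => ?_
  rw [← Finset.sum_subtype_eq_sum_filter]
  have : Module.Finite k ((V.tensor W).carrier γ) := (V.tensor W).finite γ
  refine (projTrace_eq_sum (hs γ) (hVW γ) (fun p : {p : G × G // p.1 * p.2 = γ} => hp p.2)
    (fun p => tensorIncl_comp_tensorAct V W p.2) (fun p => tensorProj_comp_act V W p.2)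
    (sum_tensorIncl_tensorProj V W
      fun p hpS => hss fun h => hpS (Finset.mem_subtype.2 h)) (f.1 γ) (f.2 γ)).trans ?_
  refine Finset.sum_congr rfl fun p _ => ?_
  obtain ⟨⟨α, β⟩, rfl⟩ := p
  rfl

theorem isRightModifiedTrace_formTrace {g : Pivot k H} {l : ∀ α, H α →ₗ[k] k}
    (hl : IsSymmetrisedRightIntegral g l) (hs : ∀ α x y, l α (x * y) = l α (y * x)) :
    IsRightModifiedTrace g (formTrace l) := by
  refine ⟨isCyclicTrace_formTrace hs, fun P W f => ?_⟩
  rw [formTrace_tensor hs _ fun h => isProjectiveAct_tensor_right h _ _ (P.2 _), Finset.sum_product,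
    formTrace_apply subset_rfl]
  refine Finset.sum_congr rfl fun α _ => ?_
  rw [rightPartialTrace, map_sum]
  exact Finset.sum_congr rfl fun β _ =>
    projTrace_tensorAct_right hl hs rfl (P.2 α) _ _ (HMod.block_equivariant f α β)

theorem isLeftModifiedTrace_formTrace {g : Pivot k H} {l : ∀ α, H α →ₗ[k] k}
    (hl : IsSymmetrisedLeftIntegral g l) (hs : ∀ α x y, l α (x * y) = l α (y * x)) :
    IsLeftModifiedTrace g (formTrace l) := by
  refine ⟨isCyclicTrace_formTrace hs, fun P W f => ?_⟩
  rw [formTrace_tensor hs _ fun h => g.isProjectiveAct_tensor_left h _ _ (P.2 _),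
    Finset.sum_product_right, formTrace_apply subset_rfl]
  refine Finset.sum_congr rfl fun α _ => ?_
  rw [leftPartialTrace, map_sum]
  exact Finset.sum_congr rfl fun β _ =>
    projTrace_tensorAct_left hl hs rfl (P.2 α) _ _ (HMod.block_equivariant f β α)

variable [∀ α, Module.Finite k (H α)]

theorem hom_regular_eq_rightMul {α : G} (F : HMod.Hom (regular k (H := H) α) (regular k α)) :
    F = rightMul α (F.1 α (fun _ => 1) ⟨rfl⟩) := by
  refine hom_regular_ext fun z => ?_
  rw [rightMul_apply]
  have h := congrFun (LinearMap.congr_fun (F.2 α (z ⟨rfl⟩)) fun _ => 1) ⟨rfl⟩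
  refine Eq.trans ?_ h
  refine congrArg (fun y => F.1 α y ⟨rfl⟩) (funext fun p => ?_)
  exact (mul_one (z p)).symm

/-- The endomorphism of `V ⊗ W` with the value `ψ(z) v` at `z ∈ V_α ⊗ W_β` (and zero on the other
components), for an `H_{αβ}`-linear map `ψ` and `v ∈ V_α ⊗ W_β`. -/
def blockHom (V W : HMod k H) {α β : G} (ψ : V.carrier α ⊗[k] W.carrier β →ₗ[k] H (α * β))
    (hψ : ∀ x z, ψ (tensorAct rfl (V.act α) (W.act β) x z) = x * ψ z)
    (v : V.carrier α ⊗[k] W.carrier β) : HMod.Hom (V.tensor W) (V.tensor W) :=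
  HMod.comp (orbitHom (V.tensor W) (tensorIncl V W rfl v))
    (toRegular (V.tensor W) (ψ ∘ₗ tensorProj V W rfl) fun x z => (congrArg ψ
      (LinearMap.congr_fun (tensorProj_comp_act V W rfl x) z)).trans (hψ x _))

theorem block_blockHom (V W : HMod k H) {α β : G}
    (ψ : V.carrier α ⊗[k] W.carrier β →ₗ[k] H (α * β))
    (hψ : ∀ x z, ψ (tensorAct rfl (V.act α) (W.act β) x z) = x * ψ z)
    (v z : V.carrier α ⊗[k] W.carrier β) :
    HMod.block (blockHom V W ψ hψ v) α β z = tensorAct rfl (V.act α) (W.act β) (ψ z) v := by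
  rw [block_eq]
  change tensorProj V W rfl ((orbitHom (V.tensor W) (tensorIncl V W rfl v)).1 (α * β) fun _ =>
    ψ (tensorProj V W rfl (tensorIncl V W rfl z))) = _
  rw [orbitHom_apply, tensorProj_incl]
  refine (LinearMap.congr_fun (tensorProj_comp_act V W rfl _) _).trans ?_
  rw [LinearMap.comp_apply, tensorProj_incl]

theorem IsCyclicTrace.apply_blockHom {t : TraceFamily k H} (ht : IsCyclicTrace t) (V W : HMod k H)
    (hVW : (V.tensor W).IsProjective) {α β : G}
    (ψ : V.carrier α ⊗[k] W.carrier β →ₗ[k] H (α * β))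
    (hψ : ∀ x z, ψ (tensorAct rfl (V.act α) (W.act β) x z) = x * ψ z)
    (v : V.carrier α ⊗[k] W.carrier β) :
    t ⟨V.tensor W, hVW⟩ (blockHom V W ψ hψ v) = traceForm t (α * β) (ψ v) := by
  rw [blockHom, ht ⟨regular k (α * β), isProjective_regular _⟩ ⟨V.tensor W, hVW⟩,
    toRegular_comp_orbitHom, LinearMap.comp_apply, tensorProj_incl]
  rfl

theorem rightGaloisInv_one {α β β' γ : G} (h' : γ * β' = α) (hβ' : β' * β = 1) :
    rightGaloisInv (k := k) h' hβ' (1 : H α) = 1 ⊗ₜ 1 := by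
  simp [rightGaloisInv, Algebra.TensorProduct.one_def, antipode_one]

theorem rightPartialTrace_blockHom (g : Pivot k H) (V W : HMod k H) {α β : G}
    (hW : W.support ⊆ {β}) (ψ : V.carrier α ⊗[k] W.carrier β →ₗ[k] H (α * β))
    (hψ : ∀ x z, ψ (tensorAct rfl (V.act α) (W.act β) x z) = x * ψ z)
    (v : V.carrier α ⊗[k] W.carrier β) {u : V.carrier α} {ω : Module.Dual k (W.carrier β)}
    (hu : ∀ w, ψ (u ⊗ₜ w) = ω w • 1) :
    (rightPartialTrace g (blockHom V W ψ hψ v)).1 α u =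
      TensorProduct.rid k (V.carrier α) ((ω ∘ₗ W.act β (g.val β)).lTensor (V.carrier α) v) := by
  have h1 : (rightPartialTrace g (blockHom V W ψ hψ v)).1 α =
      ∑ β' ∈ W.support, rightPartialTraceLin (W.act β' (g.val β'))
        (HMod.block (blockHom V W ψ hψ v) α β') := rfl
  rw [h1, Finset.sum_subset hW fun β' _ hβ' => ?_, Finset.sum_singleton]
  · refine rightPartialTraceLin_apply_of_forall _ fun w => ?_
    rw [block_blockHom, hu, map_smul, map_one]
    rfl
  · have := HMod.subsingleton_of_notMem_support hβ'
    refine LinearMap.ext fun u => ?_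
    rw [rightPartialTraceLin_apply]
    refine Finset.sum_eq_zero fun j _ => ?_
    rw [Subsingleton.elim (Module.Basis.ofVectorSpace k (W.carrier β') j) 0,
      TensorProduct.tmul_zero, map_zero, map_zero, map_zero]

theorem leftPartialTrace_blockHom (g : Pivot k H) (V W : HMod k H) {α β : G}
    (hW : W.support ⊆ {β}) (ψ : W.carrier β ⊗[k] V.carrier α →ₗ[k] H (β * α))
    (hψ : ∀ x z, ψ (tensorAct rfl (W.act β) (V.act α) x z) = x * ψ z)
    (v : W.carrier β ⊗[k] V.carrier α) {u : V.carrier α} {ω : Module.Dual k (W.carrier β)}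
    (hu : ∀ w, ψ (w ⊗ₜ u) = ω w • 1) :
    (leftPartialTrace g (blockHom W V ψ hψ v)).1 α u =
      TensorProduct.lid k (V.carrier α) ((ω ∘ₗ W.act β (g.inv β)).rTensor (V.carrier α) v) := by
  have h1 : (leftPartialTrace g (blockHom W V ψ hψ v)).1 α =
      ∑ β' ∈ W.support, leftPartialTraceLin (W.act β' (g.inv β'))
        (HMod.block (blockHom W V ψ hψ v) β' α) := rfl
  rw [h1, Finset.sum_subset hW fun β' _ hβ' => ?_, Finset.sum_singleton,
    leftPartialTraceLin_eq_right]
  · refine (rightPartialTraceLin_apply_of_forall (ω := ω) (z := TensorProduct.comm k _ _ v) _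
      fun w => ?_).trans ?_
    · rw [LinearMap.comp_apply, LinearMap.comp_apply, LinearEquiv.coe_coe, LinearEquiv.coe_coe,
        TensorProduct.comm_tmul, block_blockHom, hu, map_smul, map_one, LinearMap.smul_apply,
        map_smul]
      rfl
    · clear h1
      induction v with
      | zero => simp
      | add z z' hz hz' => simp only [map_add, hz, hz']
      | tmul a b => simp
  · have := HMod.subsingleton_of_notMem_support hβ'
    rw [leftPartialTraceLin_eq_right]
    refine LinearMap.ext fun u => ?_
    rw [rightPartialTraceLin_apply]
    refine Finset.sum_eq_zero fun j _ => ?_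
    rw [Subsingleton.elim (Module.Basis.ofVectorSpace k (W.carrier β') j) 0,
      TensorProduct.tmul_zero, map_zero, map_zero, map_zero]

theorem apply_rid_lTensor_tensorEnd {A B V W : Type u} [Ring A] [Ring B] [Algebra k A]
    [Algebra k B] [AddCommGroup V] [Module k V] [AddCommGroup W] [Module k W]
    {ρ : A →ₐ[k] Module.End k V} (σ : B →ₐ[k] Module.End k W) {φ : V →ₗ[k] A}
    (hφ : ∀ a v, φ (ρ a v) = a * φ v) {u : V} (hu : φ u = 1) (f : A →ₗ[k] k)
    (ω : Module.Dual k W) (b : B) (w : W) (z : A ⊗[k] B) :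
    f (φ (TensorProduct.rid k V ((ω ∘ₗ σ b).lTensor V (tensorEnd ρ σ z (u ⊗ₜ w))))) =
      ω (σ (b * TensorProduct.lid k B (f.rTensor B z)) w) := by
  induction z with
  | zero => simp
  | add z z' hz hz' => simp only [map_add, mul_add, LinearMap.add_apply, hz, hz']
  | tmul c d => simp [hφ, hu, mul_comm]

theorem apply_lid_rTensor_tensorEnd {A B V W : Type u} [Ring A] [Ring B] [Algebra k A]
    [Algebra k B] [AddCommGroup V] [Module k V] [AddCommGroup W] [Module k W]
    {ρ : A →ₐ[k] Module.End k V} (σ : B →ₐ[k] Module.End k W) {φ : V →ₗ[k] A}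
    (hφ : ∀ a v, φ (ρ a v) = a * φ v) {u : V} (hu : φ u = 1) (f : A →ₗ[k] k)
    (ω : Module.Dual k W) (b : B) (w : W) (z : B ⊗[k] A) :
    f (φ (TensorProduct.lid k V ((ω ∘ₗ σ b).rTensor V (tensorEnd σ ρ z (w ⊗ₜ u))))) =
      ω (σ (b * TensorProduct.rid k B (f.lTensor B z)) w) := by
  induction z with
  | zero => simp
  | add z z' hz hz' => simp only [map_add, mul_add, LinearMap.add_apply, hz, hz']
  | tmul c d => simp [hφ, hu, mul_comm]

/-- The integral equation tested against a linear form `ω` on an `H_β`-module `W`. It is the partial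
trace property for the endomorphism `F : z ↦ ψ(z) x (u ⊗ w)` of `H_α ⊗ W`, where `u = 1` generates
`H_α` and `ψ : H_α ⊗ W → H_{αβ}` is the linear map with `ψ(u ⊗ w') = ω(w') 1`: cyclicity gives
`t(F) = ω(w) λ^t_{αβ}(x)`, and the partial trace of `F` is a right multiplication. -/
theorem IsRightModifiedTrace.traceForm_eq {g : Pivot k H} {t : TraceFamily k H}
    (ht : IsRightModifiedTrace g t) (W : HMod k H) {α β : G} (hW : W.support ⊆ {β})
    (ω : Module.Dual k (W.carrier β)) (w : W.carrier β) (x : H (α * β)) :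
    ω w • traceForm t (α * β) x = ω (W.act β (g.val β * TensorProduct.lid k (H β)
      ((traceForm t α).rTensor (H β) (comul rfl x))) w) := by
  let P : PMod k H := ⟨regular k α, isProjective_regular α⟩
  let φ : P.1.carrier α →ₗ[k] H α := LinearMap.proj ⟨rfl⟩
  have hφ : ∀ a v, φ (P.1.act α a v) = a * φ v := fun _ _ => rfl
  let u : P.1.carrier α := fun _ => 1
  have hu : φ u = 1 := rfl
  let ψ := tensorCoord (W.act β)
    (rightGaloisInv (k := k) (mul_inv_cancel_right α β) (inv_mul_cancel β)) φ ω
  have hψ : ∀ x z, ψ (tensorAct rfl (P.1.act α) (W.act β) x z) = x * ψ z :=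
    tensorCoord_act (W.act β) (rightGaloisInv_mul rfl (mul_inv_cancel_right α β)
      (mul_inv_cancel β) (inv_mul_cancel β)) hφ ω
  have hψu (w : W.carrier β) : ψ (u ⊗ₜ w) = ω w • 1 := by
    rw [tensorCoord_tmul, hu, rightGaloisInv_one, contractAct_tmul, map_one, Module.End.one_apply]
  let v := tensorAct rfl (P.1.act α) (W.act β) x (u ⊗ₜ w)
  have key := ht.2 P W (blockHom P.1 W ψ hψ v)
  rw [ht.1.apply_blockHom P.1 W _ ψ hψ v, hψ, hψu, mul_smul_comm, mul_one, map_smul] at key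
  rw [key, hom_regular_eq_rightMul (rightPartialTrace g (blockHom P.1 W ψ hψ v))]
  have hv := rightPartialTrace_blockHom g P.1 W hW ψ hψ v hψu
  change traceForm t α ((rightPartialTrace g (blockHom P.1 W ψ hψ v)).1 α u ⟨rfl⟩) = _
  rw [hv]
  exact apply_rid_lTensor_tensorEnd (W.act β) hφ hu _ ω _ w _

theorem Pivot.leftGaloisInv_one (g : Pivot k H) {α β β' γ : G} (h' : β' * γ = α)
    (hβ' : β' * β = 1) : g.leftGaloisInv h' hβ' (1 : H α) = 1 ⊗ₜ 1 := by
  simp [leftGaloisInv, Algebra.TensorProduct.one_def, antipode_one, g.inv_mul]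

/-- The mirror image of `IsRightModifiedTrace.traceForm_eq`, with `F : z ↦ ψ(z) x (w ⊗ u)`. -/
theorem IsLeftModifiedTrace.traceForm_eq {g : Pivot k H} {t : TraceFamily k H}
    (ht : IsLeftModifiedTrace g t) (W : HMod k H) {α β : G} (hW : W.support ⊆ {β})
    (ω : Module.Dual k (W.carrier β)) (w : W.carrier β) (x : H (β * α)) :
    ω w • traceForm t (β * α) x = ω (W.act β (g.inv β * TensorProduct.rid k (H β)
      ((traceForm t α).lTensor (H β) (comul rfl x))) w) := by
  let P : PMod k H := ⟨regular k α, isProjective_regular α⟩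
  let φ : P.1.carrier α →ₗ[k] H α := LinearMap.proj ⟨rfl⟩
  have hφ : ∀ a v, φ (P.1.act α a v) = a * φ v := fun _ _ => rfl
  let u : P.1.carrier α := fun _ => 1
  have hu : φ u = 1 := rfl
  let ψ' := tensorCoord (W.act β)
    (g.leftGaloisInv (inv_mul_cancel_left β α) (inv_mul_cancel β)) φ ω
  let ψ := ψ' ∘ₗ (TensorProduct.comm k (W.carrier β) (P.1.carrier α)).toLinearMap
  have hψ : ∀ x z, ψ (tensorAct rfl (W.act β) (P.1.act α) x z) = x * ψ z := fun x z =>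
    (congrArg ψ' (LinearMap.congr_fun (comm_comp_tensorAct rfl (P.1.act α) (W.act β) x) z)).trans
      (tensorCoord_act (W.act β) (g.leftGaloisInv_mul rfl (inv_mul_cancel_left β α)
        (mul_inv_cancel β) (inv_mul_cancel β)) hφ ω x _)
  have hψu (w : W.carrier β) : ψ (w ⊗ₜ u) = ω w • 1 := by
    change ψ' (u ⊗ₜ w) = _
    rw [tensorCoord_tmul, hu, g.leftGaloisInv_one, contractAct_tmul, map_one, Module.End.one_apply]
  let v := tensorAct rfl (W.act β) (P.1.act α) x (w ⊗ₜ u)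
  have key := ht.2 P W (blockHom W P.1 ψ hψ v)
  rw [ht.1.apply_blockHom W P.1 _ ψ hψ v, hψ, hψu, mul_smul_comm, mul_one, map_smul] at key
  rw [key, hom_regular_eq_rightMul (leftPartialTrace g (blockHom W P.1 ψ hψ v))]
  have hv := leftPartialTrace_blockHom g P.1 W hW ψ hψ v hψu
  change traceForm t α ((leftPartialTrace g (blockHom W P.1 ψ hψ v)).1 α u ⟨rfl⟩) = _
  rw [hv]
  exact apply_lid_rTensor_tensorEnd (W.act β) hφ hu _ ω _ w _

theorem IsRightModifiedTrace.isSymmetrisedRightIntegral {g : Pivot k H} {t : TraceFamily k H}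
    (ht : IsRightModifiedTrace g t) : IsSymmetrisedRightIntegral g (traceForm t) := by
  rw [isSymmetrisedRightIntegral_iff]
  rintro α β _ rfl x
  rw [← sub_eq_zero, ← Module.forall_dual_apply_eq_zero_iff k]
  intro ω
  have h := ht.traceForm_eq (regular k β) (support_regular_subset β) (ω ∘ₗ LinearMap.proj ⟨rfl⟩)
    (fun _ => 1) x
  rw [map_sub, sub_eq_zero, map_smul, smul_eq_mul, mul_comm]
  refine Eq.trans ?_ h.symm
  exact congrArg ω (mul_one _).symm

theorem IsLeftModifiedTrace.isSymmetrisedLeftIntegral {g : Pivot k H} {t : TraceFamily k H}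
    (ht : IsLeftModifiedTrace g t) : IsSymmetrisedLeftIntegral g (traceForm t) := by
  rw [isSymmetrisedLeftIntegral_iff]
  rintro α β _ rfl x
  rw [← sub_eq_zero, ← Module.forall_dual_apply_eq_zero_iff k]
  intro ω
  have h := ht.traceForm_eq (regular k α) (support_regular_subset α) (ω ∘ₗ LinearMap.proj ⟨rfl⟩)
    (fun _ => 1) x
  rw [map_sub, sub_eq_zero, map_smul, smul_eq_mul, mul_comm]
  refine Eq.trans ?_ h.symm
  exact congrArg ω (mul_one _).symm

theorem bijOn_traceForm {T : Set (TraceFamily k H)} {L : Set (∀ α, H α →ₗ[k] k)}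
    (hT : ∀ t ∈ T, IsCyclicTrace t) (hTL : ∀ t ∈ T, traceForm t ∈ L)
    (hL : ∀ l ∈ L, ∀ α x y, l α (x * y) = l α (y * x)) (hLT : ∀ l ∈ L, formTrace l ∈ T) :
    Set.BijOn traceForm T L :=
  Set.InvOn.bijOn (f' := formTrace)
    ⟨fun t ht => (hT t ht).eq_formTrace.symm, fun l hl => traceForm_formTrace (hL l hl)⟩ hTL hLT

end ModifiedTrace

end HopfGCoalgebra

end

open HopfGCoalgebra in
theorem theorem1 {k G : Type u} [Field k] [Group G] {H : G → Type u}
    [∀ α, Ring (H α)] [∀ α, Algebra k (H α)] [HopfGCoalgebra k H]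
    [∀ α, Module.Finite k (H α)] (g : HopfGCoalgebra.Pivot k H)
    (hH : HopfGCoalgebra.IsUnimodular k H) :
    Set.BijOn HopfGCoalgebra.traceForm {t | HopfGCoalgebra.IsRightModifiedTrace g t}
        {l | HopfGCoalgebra.IsSymmetrisedRightIntegral g l} ∧
      Set.BijOn HopfGCoalgebra.traceForm {t | HopfGCoalgebra.IsLeftModifiedTrace g t}
        {l | HopfGCoalgebra.IsSymmetrisedLeftIntegral g l} ∧
      (HopfGCoalgebra.IsUnibalanced g ↔ ∀ t : HopfGCoalgebra.TraceFamily k H,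
        HopfGCoalgebra.IsRightModifiedTrace g t → HopfGCoalgebra.IsLeftModifiedTrace g t) := by
  have hR : Set.BijOn traceForm {t | IsRightModifiedTrace g t}
      {l | IsSymmetrisedRightIntegral g l} :=
    bijOn_traceForm (fun _ ht => ht.1) (fun _ ht => ht.isSymmetrisedRightIntegral)
      (fun _ hl => hl.mul_comm hH) fun _ hl => isRightModifiedTrace_formTrace hl (hl.mul_comm hH)
  refine ⟨hR, bijOn_traceForm (fun _ ht => ht.1) (fun _ ht => ht.isSymmetrisedLeftIntegral)
    (fun _ hl => hl.mul_comm hH) fun _ hl => isLeftModifiedTrace_formTrace hl (hl.mul_comm hH),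
    fun h t ht => ?_, fun h l hl => ?_⟩
  · have hl := h _ ht.isSymmetrisedRightIntegral
    rw [ht.1.eq_formTrace]
    exact isLeftModifiedTrace_formTrace hl (hl.mul_comm hH)
  · obtain ⟨t, ht, rfl⟩ := hR.surjOn hl
    exact (h t ht).isSymmetrisedLeftIntegral
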